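/- All graphs are finite and simple. A graph is *$2$-boundary planar* if it can be embedded in the plane without crossing edges so that every vertex lies on the boundary of one of at most two faces. A *$k$-vertex* is a vertex of degree $k$; a vertex is *odd* if its degree is odd. For $n\ge 3$ let $M_n$ be the $3$-regular graph consisting of two disjoint cycles $u_1u_2\cdots u_nu_1$ and $v_1v_2\cdots v_nv_1$ and the edges $v_iu_i$, and let $P_n$ be the $4$-regular graph consisting of the same two cycles and the edges $v_iu_{i-1}$ and $v_iu_i$ (indices modulo $n$). **Lemma.** Let $G$ be a nonempty $2$-boundary planar graph without isolated vertices that is not isomorphic to $M_n$ or $P_n$ for any $n\ge 3$. Then $G$ contains at least one of the following configurations (as a subgraph, with degrees taken in $G$): 1. a vertex $v$ of degree $1$; 2. a triangle $uvw$ with $d_G(v)=2$; 3. a path $uvw$ with $d_G(v)=2$ such that $uw$ is not an edge and $G-v+uw$ is $2$-boundary planar; 4. a $3$-vertex with (at least) two odd neighbors; 5. a triangle $uvw$ with $d_G(v)=d_G(w)=3$; 6. two triangles $xuv$ and $yuv$ with $x\ne y$, $d_G(u)=d_G(v)=4$, $d_G(x)=3$ and $d_G(y)$ odd; 7. a triangle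 $vxy$ and two further triangles $uxv$ and $wvy$ (with $u\ne y$ and $w\ne x$) such that $u\ne w$, $d_G(v)=d_G(x)=d_G(y)=4$ and $d_G(u)=3$; 8. a fan with center $v$ and boundary path $uxyzw$, that is, a path on five distinct vertices all of which are adjacent to $v$, with $d_G(v)=5$, $d_G(x)=d_G(z)=4$ and $d_G(y)=3$. -/

import Mathlib

/-!
Embeddings of finite simple graphs in the plane, given by their combinatorial data: the cyclic order
of the edges around each vertex, and the face on each side of each edge.
-/

namespace PlaneGraph

open SimpleGraph

/-- A rotation system of a graph with an assignment of faces to the corners.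

* `rot` sends a dart (an edge with a direction) to the next dart, in clockwise order, with the same
  initial vertex.
* `face d` is the face on the left of the dart `d`, that is, the face in the corner between `d` and
  the dart before `d` in clockwise order. Walking along `d` and then taking the next dart clockwise at
  its end vertex keeps the same face on the left, so the orbits of `d ↦ rot d.symm` are the closed
  walks that bound faces. A face of a disconnected graph may be bounded by several such walks, and by
  isolated vertices.
* `isolatedFace` is the face that an isolated vertex lies in. -/
structure FaceSystem {V : Type*} [Finite V] (G : SimpleGraph V) where
  rot : Equiv.Perm G.Dart
  rot_fst : ∀ d, (rot d).fst = d.fst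
  rot_cyclic : ∀ d d' : G.Dart, d.fst = d'.fst → rot.SameCycle d d'
  numFaces : ℕ
  face : G.Dart → Fin numFaces
  face_next : ∀ d : G.Dart, face (rot d.symm) = face d
  isolatedFace : {v : V // ∀ w, ¬ G.Adj v w} → Fin numFaces

/-- The vertex `v` lies on the boundary of the face `f`: one of the corners at `v` belongs to `f`, or
`v` is isolated and lies in `f`. -/
def FaceSystem.OnBoundary {V : Type*} [Finite V] {G : SimpleGraph V} (E : FaceSystem G)
    (v : V) (f : Fin E.numFaces) : Prop :=
  (∃ d : G.Dart, d.fst = v ∧ E.face d = f) ∨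
    ∃ h : ∀ w, ¬ G.Adj v w, E.isolatedFace ⟨v, h⟩ = f

/-- A crossing-free embedding of a finite (possibly disconnected) simple graph in the plane, recorded
up to homeomorphism of the sphere by its rotation system and its faces. Such data come from an
embedding in the plane exactly if any two faces are linked by a chain of faces in which consecutive
ones have a common boundary vertex, and Euler's formula
`|V| - |E| + |F| = 1 + (number of components)` holds. For data that are linked but need a surface of
higher genus, or that glue boundary walks together in a way which creates a handle, the left side is
smaller. -/
structure Embedding {V : Type*} [Finite V] (G : SimpleGraph V) extends FaceSystem G where
  faces_linked : ∀ f g : Fin numFaces, Relation.ReflTransGen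
    (fun f g => ∃ v, toFaceSystem.OnBoundary v f ∧ toFaceSystem.OnBoundary v g) f g
  euler : Nat.card V + numFaces = Nat.card G.edgeSet + Nat.card G.ConnectedComponent + 1

/-- `G` has an embedding in the plane in which every vertex lies on the boundary of one of (at most)
two faces. The two faces may coincide. -/
def TwoBoundaryPlanar {V : Type*} [Finite V] (G : SimpleGraph V) : Prop :=
  ∃ (E : Embedding G) (f₁ f₂ : Fin E.numFaces), ∀ v, E.OnBoundary v f₁ ∨ E.OnBoundary v f₂

/-- The graph `G - v + uw` on the vertices other than `v`. -/
def deleteVertexAddEdge {V : Type*} (G : SimpleGraph V) (v u w : V) :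
    SimpleGraph ({v}ᶜ : Set V) :=
  (G ⊔ SimpleGraph.edge u w).induce {v}ᶜ

/-- The 3-regular graphs `M`: two disjoint `n`-cycles whose corresponding vertices are joined
(the `n`-prism, `n ≥ 3`). -/
def graphM (n : ℕ) : SimpleGraph (ZMod n ⊕ ZMod n) :=
  SimpleGraph.fromRel fun
    | .inl i, .inl j => j = i + 1
    | .inr i, .inr j => j = i + 1
    | .inr i, .inl j => j = i
    | .inl _, .inr _ => False

/-- The 4-regular graphs `P`: two disjoint `n`-cycles `u` (left) and `v` (right), with `v i` joined to
`u (i - 1)` and `u i` (the `n`-antiprism, `n ≥ 3`). -/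
def graphP (n : ℕ) : SimpleGraph (ZMod n ⊕ ZMod n) :=
  SimpleGraph.fromRel fun
    | .inl i, .inl j => j = i + 1
    | .inr i, .inr j => j = i + 1
    | .inr i, .inl j => j = i - 1 ∨ j = i
    | .inl _, .inr _ => False

/-- `u v w` are the vertices of a triangle (they are then distinct). -/
def IsTriangle {V : Type*} (G : SimpleGraph V) (u v w : V) : Prop :=
  G.Adj u v ∧ G.Adj v w ∧ G.Adj w u

/-- A vertex of degree 1. -/
def ConfigA {V : Type*} [Fintype V] (G : SimpleGraph V) [DecidableRel G.Adj] : Prop :=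
  ∃ v, G.degree v = 1

/-- A triangle `uvw` with `d(v) = 2`. -/
def ConfigB {V : Type*} [Fintype V] (G : SimpleGraph V) [DecidableRel G.Adj] : Prop :=
  ∃ u v w, IsTriangle G u v w ∧ G.degree v = 2

/-- A path `uvw` with `d(v) = 2`, `uw` not an edge, and `G - v + uw` 2-boundary planar. -/
def ConfigC {V : Type*} [Fintype V] (G : SimpleGraph V) [DecidableRel G.Adj] : Prop :=
  ∃ u v w, u ≠ w ∧ G.Adj u v ∧ G.Adj v w ∧ G.degree v = 2 ∧ ¬ G.Adj u w ∧
    TwoBoundaryPlanar (deleteVertexAddEdge G v u w)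

/-- A vertex of degree 3 with (at least) two neighbors of odd degree. -/
def ConfigD {V : Type*} [Fintype V] (G : SimpleGraph V) [DecidableRel G.Adj] : Prop :=
  ∃ v x y, G.degree v = 3 ∧ G.Adj v x ∧ G.Adj v y ∧ x ≠ y ∧ Odd (G.degree x) ∧ Odd (G.degree y)

/-- A triangle `uvw` with `d(v) = d(w) = 3`. -/
def ConfigE {V : Type*} [Fintype V] (G : SimpleGraph V) [DecidableRel G.Adj] : Prop :=
  ∃ u v w, IsTriangle G u v w ∧ G.degree v = 3 ∧ G.degree w = 3

/-- Two distinct triangles `xuv` and `yuv` sharing the edge `uv`, with `d(u) = d(v) = 4`, `d(x) = 3`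
and `d(y)` odd. -/
def ConfigF {V : Type*} [Fintype V] (G : SimpleGraph V) [DecidableRel G.Adj] : Prop :=
  ∃ x y u v, x ≠ y ∧ IsTriangle G x u v ∧ IsTriangle G y u v ∧
    G.degree u = 4 ∧ G.degree v = 4 ∧ G.degree x = 3 ∧ Odd (G.degree y)

/-- A triangle `vxy` and two other triangles `uxv` and `wvy`, sharing with it the edges `xv` and `vy`,
such that `u ≠ w`, `d(v) = d(x) = d(y) = 4` and `d(u) = 3`. -/
def ConfigG {V : Type*} [Fintype V] (G : SimpleGraph V) [DecidableRel G.Adj] : Prop :=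
  ∃ v x y u w, IsTriangle G v x y ∧ IsTriangle G u x v ∧ IsTriangle G w v y ∧
    u ≠ y ∧ w ≠ x ∧ u ≠ w ∧
    G.degree v = 4 ∧ G.degree x = 4 ∧ G.degree y = 4 ∧ G.degree u = 3

/-- A fan: a path `uxyzw` on five distinct vertices all of which are adjacent to the center `v`, with
`d(v) = 5`, `d(x) = d(z) = 4` and `d(y) = 3`. -/
def ConfigH {V : Type*} [Fintype V] (G : SimpleGraph V) [DecidableRel G.Adj] : Prop :=
  ∃ v u x y z w, [u, x, y, z, w].Nodup ∧
    G.Adj u x ∧ G.Adj x y ∧ G.Adj y z ∧ G.Adj z w ∧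
    G.Adj v u ∧ G.Adj v x ∧ G.Adj v y ∧ G.Adj v z ∧ G.Adj v w ∧
    G.degree v = 5 ∧ G.degree x = 4 ∧ G.degree z = 4 ∧ G.degree y = 3

end PlaneGraph

namespace PlaneGraph

set_option linter.unusedSectionVars false

open SimpleGraph

/-! ### Cycles separate: chains modulo 2 and potentials on the faces -/

section Potentials

open scoped Classical

variable {V : Type*} [Fintype V] {G : SimpleGraph V}

/-! Vertices of degree 1 or 2 give the first three configurations: suppressing a 2-vertex with
nonadjacent neighbors preserves the rotation, the faces and Euler's formula
(`TwoBoundaryPlanar.deleteVertexAddEdge`). So let the minimum degree be at least 3.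

Planarity enters only through a Jordan curve theorem modulo 2, `Embedding.exists_potential`: by
Euler's formula and connectedness of the dual graph, every chain of edges without boundary is the
coboundary of a function on the faces. All later topology compares values of such potentials. A side
of a cycle that contains neither of the two special faces has no vertices in its interior, because
every vertex has a corner in one of them. Minimum degree 3 then forces a chord into that side, and
the chord cuts off a shorter cycle of the same kind. This descent (`Bordered.disk`) shows that a
cycle made of an arc of a border and one edge separates the two faces. Consequently each border is a
single chordless cycle.

The same principle shows that the region between the borders is a strip of triangles and quadrangles
(`Bordered.exists_cap`, `Bordered.exists_triangle`, `Bordered.exists_quad`). The edges across the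
strip form a cyclic sequence, the `Ladder`; a vertex common to both borders counts as a rung of
length zero. At any other vertex the degree is two more than the number of its rungs, so degrees can
be read off the pattern of steps.

The rest is a local analysis of this pattern. Two consecutive steps on one border, or a quadrangle
next to a rung of positive length, produce a configuration. Otherwise triangles with their bases on
alternating borders go all the way round, every vertex has degree 4, and the graph is an antiprism
(`Ladder.exists_iso_graphP`). -/

theorem FaceSystem.face_rot (E : FaceSystem G) (d : G.Dart) : E.face (E.rot d) = E.face d.symm := by
  simpa using E.face_next d.symm

/-- The next dart on the closed walk that bounds the face on the left of a dart. -/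
def FaceSystem.next (E : FaceSystem G) : Equiv.Perm G.Dart :=
  (Dart.symm_involutive.toPerm).trans E.rot

theorem FaceSystem.next_apply (E : FaceSystem G) (d : G.Dart) : E.next d = E.rot d.symm := rfl

@[simp]
theorem FaceSystem.next_fst (E : FaceSystem G) (d : G.Dart) : (E.next d).fst = d.snd := by
  rw [E.next_apply, E.rot_fst]; rfl

@[simp]
theorem FaceSystem.face_apply_next (E : FaceSystem G) (d : G.Dart) :
    E.face (E.next d) = E.face d :=
  E.face_next d

/-- A property of darts that is preserved by the rotation holds at all darts of a vertex. -/
theorem FaceSystem.rot_induction (E : FaceSystem G) {p : G.Dart → Prop}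
    (hp : ∀ d, p d → p (E.rot d)) {d d' : G.Dart} (h : d.fst = d'.fst) (hd : p d) : p d' := by
  obtain ⟨n, -, rfl⟩ := (E.rot_cyclic d d' h).exists_pow_eq'
  clear h
  induction n with
  | zero => simpa using hd
  | succ n ih => rw [pow_succ', Equiv.Perm.mul_apply]; exact hp _ ih

/-- The dual graph of an embedding without isolated vertices is connected. -/
theorem Embedding.face_induction (E : Embedding G) (hiso : ∀ v, ∃ w, G.Adj v w)
    {S : Fin E.numFaces → Prop} (hS : ∀ d, S (E.face d) → S (E.face d.symm)) {f : Fin E.numFaces}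
    (hf : S f) (g : Fin E.numFaces) : S g := by
  induction E.faces_linked f g with
  | refl => exact hf
  | tail _ h ih =>
    obtain ⟨v, h1, h2⟩ := h
    obtain ⟨w, hw⟩ := hiso v
    obtain ⟨d1, hd1, rfl⟩ := h1.resolve_right fun h => h.1 w hw
    obtain ⟨d2, hd2, rfl⟩ := h2.resolve_right fun h => h.1 w hw
    -- Consecutive corners at the common vertex lie on the two sides of one edge, so `S` spreads
    -- around the vertex.
    exact E.rot_induction (p := fun d => S (E.face d)) (fun d hd => by rw [E.face_rot]; exact hS d hd)
      (hd1.trans hd2.symm) ih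

/-- The indicator function of the edge of a dart, as a function on darts. -/
noncomputable def edgeChain (e d : G.Dart) : ZMod 2 :=
  (if d = e then 1 else 0) + (if d.symm = e then 1 else 0)

theorem edgeChain_symm (e d : G.Dart) : edgeChain e d.symm = edgeChain e d := by
  simp [edgeChain, add_comm]

/-- The boundary of a chain of edges. -/
noncomputable def chainBoundary (z : G.Dart → ZMod 2) (v : V) : ZMod 2 :=
  ∑ d : G.Dart, if d.fst = v then z d else 0

theorem chainBoundary_add (z z' : G.Dart → ZMod 2) (v : V) :
    chainBoundary (z + z') v = chainBoundary z v + chainBoundary z' v := by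
  simp only [chainBoundary, ← Finset.sum_add_distrib]
  refine Finset.sum_congr rfl fun d _ => ?_
  split_ifs <;> simp

theorem chainBoundary_zero (v : V) : chainBoundary (0 : G.Dart → ZMod 2) v = 0 := by
  simp [chainBoundary]

theorem chainBoundary_edgeChain (e : G.Dart) (v : V) :
    chainBoundary (edgeChain e) v = (if e.fst = v then 1 else 0) + (if e.snd = v then 1 else 0) := by
  have h : ∀ d : G.Dart, (if d.fst = v then edgeChain e d else 0) =
      (if d = e then (if e.fst = v then 1 else 0) else 0) +
        (if d = e.symm then (if e.snd = v then 1 else 0) else 0) := by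
    intro d
    have h1 : d.symm = e ↔ d = e.symm := ⟨fun h => by rw [← h, Dart.symm_symm],
      fun h => by rw [h, Dart.symm_symm]⟩
    simp only [edgeChain, h1]
    by_cases h2 : d = e
    · subst h2
      have := d.symm_ne.symm
      simp [this]
    · by_cases h3 : d = e.symm
      · subst h3
        simp [h2]
      · simp [h2, h3]
  simp only [chainBoundary, h, Finset.sum_add_distrib]
  simp

variable (G) in
/-- A choice of a direction for every edge. -/
noncomputable def edgeDart (e : G.edgeSet) : G.Dart :=
  Classical.choose (show ∃ d : G.Dart, d.edge = e by
    obtain ⟨e, he⟩ := e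
    induction e with
    | _ x y => exact ⟨⟨(x, y), he⟩, rfl⟩)

theorem edgeDart_edge (e : G.edgeSet) : (edgeDart G e).edge = e :=
  Classical.choose_spec (show ∃ d : G.Dart, d.edge = e by
    obtain ⟨e, he⟩ := e
    induction e with
    | _ x y => exact ⟨⟨(x, y), he⟩, rfl⟩)

theorem edgeDart_or (d : G.Dart) :
    d = edgeDart G ⟨d.edge, d.edge_mem⟩ ∨ d.symm = edgeDart G ⟨d.edge, d.edge_mem⟩ := by
  have := edgeDart_edge (G := G) ⟨d.edge, d.edge_mem⟩
  rcases (dart_edge_eq_iff _ _).1 this with h | h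
  · exact Or.inl h.symm
  · exact Or.inr h.symm

theorem sum_darts_eq_sum_edges {M : Type*} [AddCommMonoid M] (F : G.Dart → M) :
    ∑ d, F d = ∑ e : G.edgeSet, (F (edgeDart G e) + F (edgeDart G e).symm) := by
  rw [← Finset.sum_fiberwise (s := Finset.univ)
    (g := fun d : G.Dart => (⟨d.edge, d.edge_mem⟩ : G.edgeSet))]
  refine Finset.sum_congr rfl fun e _ => ?_
  have : (Finset.univ.filter fun d : G.Dart => (⟨d.edge, d.edge_mem⟩ : G.edgeSet) = e) =
      {edgeDart G e, (edgeDart G e).symm} := by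
    ext d
    simp only [Finset.mem_filter, Finset.mem_univ, true_and, Finset.mem_insert,
      Finset.mem_singleton]
    rw [← dart_edge_eq_iff, edgeDart_edge, Subtype.ext_iff]
  rw [this, Finset.sum_pair (Dart.symm_ne _).symm]

/-- In the plane every cycle separates: a chain of edges without boundary consists of the edges
between two complementary sets of faces. -/
theorem Embedding.exists_potential [Nonempty V] (E : Embedding G) (hiso : ∀ v, ∃ w, G.Adj v w)
    (z : G.Dart → ZMod 2) (hsymm : ∀ d, z d.symm = z d) (hz : ∀ v, chainBoundary z v = 0) :
    ∃ c : Fin E.numFaces → ZMod 2, ∀ d, c (E.face d) + c (E.face d.symm) = z d := by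
  -- `M` is the incidence matrix, whose kernel is the cycle space; `D` below is the coboundary map
  -- on the faces. The claim is that the range of `D` is the whole kernel of `M`.
  let M : Matrix V G.edgeSet (ZMod 2) := Matrix.of fun x e =>
    (if (edgeDart G e).fst = x then 1 else 0) + (if (edgeDart G e).snd = x then 1 else 0)
  have hM : ∀ (y : G.Dart → ZMod 2) (_ : ∀ d, y d.symm = y d),
      M.mulVec (fun e => y (edgeDart G e)) = chainBoundary y := by
    intro y hy
    ext x
    simp only [Matrix.mulVec, dotProduct, chainBoundary, M, Matrix.of_apply]
    rw [sum_darts_eq_sum_edges]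
    refine Finset.sum_congr rfl fun e _ => ?_
    rw [hy, add_mul]
    congr 1 <;> split_ifs <;> simp_all
  let D : (Fin E.numFaces → ZMod 2) →ₗ[ZMod 2] (G.edgeSet → ZMod 2) :=
    { toFun := fun c e => c (E.face (edgeDart G e)) + c (E.face (edgeDart G e).symm)
      map_add' := fun c c' => by ext e; simp only [Pi.add_apply]; ring
      map_smul' := fun a c => by ext e; simp [mul_add] }
  obtain ⟨v₀⟩ := ‹Nonempty V›
  obtain ⟨w₀, hw₀⟩ := hiso v₀
  let d₀ : G.Dart := ⟨(v₀, w₀), hw₀⟩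
  have hrange : LinearMap.range D ≤ LinearMap.ker M.mulVecLin := by
    rintro _ ⟨c, rfl⟩
    rw [LinearMap.mem_ker, Matrix.mulVecLin_apply]
    have h2 : ∀ d : G.Dart, c (E.face d.symm) + c (E.face d.symm.symm) =
        c (E.face d) + c (E.face d.symm) := fun d => by rw [Dart.symm_symm, add_comm]
    refine (hM (fun d => c (E.face d) + c (E.face d.symm)) h2).trans ?_
    ext x
    -- The rotation permutes the darts at `x` and carries the face on the right of a dart to the
    -- face on the left of the next one.
    have h3 : ∑ d : G.Dart, (if d.fst = x then c (E.face d.symm) else 0) =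
        ∑ d : G.Dart, (if d.fst = x then c (E.face d) else 0) := by
      rw [← Equiv.sum_comp E.rot (fun d => if d.fst = x then c (E.face d) else 0)]
      simp only [E.rot_fst, E.face_rot]
    have h4 : chainBoundary (fun d => c (E.face d) + c (E.face d.symm)) x =
        ∑ d : G.Dart, (if d.fst = x then c (E.face d) else 0) +
        ∑ d : G.Dart, (if d.fst = x then c (E.face d.symm) else 0) := by
      rw [chainBoundary, ← Finset.sum_add_distrib]
      refine Finset.sum_congr rfl fun d _ => ?_
      split_ifs <;> simp
    rw [h4, h3]
    exact CharTwo.add_self_eq_zero _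
  -- Connectedness of the dual graph: a function with coboundary 0 is determined by one value.
  have hkerD : Module.finrank (ZMod 2) (LinearMap.ker D) ≤ 1 := by
    let ev : LinearMap.ker D →ₗ[ZMod 2] ZMod 2 :=
      (LinearMap.proj (E.face d₀)).comp (LinearMap.ker D).subtype
    have hinj : Function.Injective ev := by
      rw [← LinearMap.ker_eq_bot, LinearMap.ker_eq_bot']
      rintro ⟨c, hc⟩ h0
      have h0 : c (E.face d₀) = 0 := h0
      rw [LinearMap.mem_ker] at hc
      have hcd : ∀ d : G.Dart, c (E.face d) = 0 → c (E.face d.symm) = 0 := by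
        intro d hd
        have := congrFun hc ⟨d.edge, d.edge_mem⟩
        simp only [D, LinearMap.coe_mk, AddHom.coe_mk, Pi.zero_apply] at this
        rcases edgeDart_or d with h | h <;> rw [← h] at this <;> simpa [hd] using this
      ext f
      exact E.face_induction hiso (S := fun f => c f = 0) hcd h0 f
    simpa using LinearMap.finrank_le_finrank_of_injective hinj
  -- A function in the kernel of the transpose is constant on components, hence determined by its
  -- values at representatives.
  have hkerB : Module.finrank (ZMod 2) (LinearMap.ker M.transpose.mulVecLin) ≤
      Nat.card G.ConnectedComponent := by
    let ev : LinearMap.ker M.transpose.mulVecLin →ₗ[ZMod 2] (G.ConnectedComponent → ZMod 2) :=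
      (LinearMap.funLeft (ZMod 2) (ZMod 2) fun c : G.ConnectedComponent => c.out).comp
        (LinearMap.ker M.transpose.mulVecLin).subtype
    have hinj : Function.Injective ev := by
      rw [← LinearMap.ker_eq_bot, LinearMap.ker_eq_bot']
      rintro ⟨g, hg⟩ h0
      rw [LinearMap.mem_ker, Matrix.mulVecLin_apply] at hg
      have hadj : ∀ x y, G.Adj x y → g x = g y := by
        intro x y hxy
        let d : G.Dart := ⟨(x, y), hxy⟩
        have := congrFun hg ⟨d.edge, d.edge_mem⟩
        simp only [Matrix.mulVec, dotProduct, Matrix.transpose_apply, M, Matrix.of_apply, add_mul,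
          Finset.sum_add_distrib, Pi.zero_apply] at this
        simp only [ite_mul, one_mul, zero_mul, Finset.sum_ite_eq, Finset.mem_univ, if_true] at this
        have h2 := CharTwo.add_eq_zero.1 this
        rcases edgeDart_or d with h | h <;> rw [← h] at h2
        · exact h2
        · exact h2.symm
      have hreach : ∀ x y, G.Reachable x y → g x = g y := by
        rintro x y ⟨p⟩
        induction p with
        | nil => rfl
        | cons h _ ih => exact (hadj _ _ h).trans ih
      ext x
      have h1 := congrFun h0 (G.connectedComponentMk x)
      change g (G.connectedComponentMk x).out = 0 at h1
      have h2 : G.Reachable (G.connectedComponentMk x).out x := by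
        rw [← ConnectedComponent.eq]
        exact Quot.out_eq _
      exact (hreach _ _ h2).symm.trans h1
    simpa [Nat.card_eq_fintype_card] using LinearMap.finrank_le_finrank_of_injective hinj
  have e1 := LinearMap.finrank_range_add_finrank_ker D
  have e2 := LinearMap.finrank_range_add_finrank_ker M.mulVecLin
  have e3 := LinearMap.finrank_range_add_finrank_ker M.transpose.mulVecLin
  have e4 : Module.finrank (ZMod 2) (LinearMap.range M.transpose.mulVecLin) =
    Module.finrank (ZMod 2) (LinearMap.range M.mulVecLin) := M.rank_transpose
  have e5 := E.euler
  simp only [Module.finrank_fintype_fun_eq_card, Fintype.card_fin] at e1 e2 e3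
  rw [Nat.card_eq_fintype_card, Nat.card_eq_fintype_card (α := G.edgeSet)] at e5
  have hle := Submodule.finrank_mono hrange
  -- Euler's formula closes the count: the kernel of `M` has dimension at most |E| - |V| + (number
  -- of components) = |F| - 1, and the range of `D` has at least this dimension.
  have heq : LinearMap.range D = LinearMap.ker M.mulVecLin :=
    Submodule.eq_of_le_of_finrank_le hrange (by omega)
  have hmem : (fun e => z (edgeDart G e)) ∈ LinearMap.range D := by
    rw [heq, LinearMap.mem_ker, Matrix.mulVecLin_apply, hM z hsymm]
    exact funext hz
  obtain ⟨c, hc⟩ := hmem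
  refine ⟨c, fun d => ?_⟩
  have := congrFun hc ⟨d.edge, d.edge_mem⟩
  simp only [D, LinearMap.coe_mk, AddHom.coe_mk] at this
  rcases edgeDart_or d with h | h <;> rw [← h] at this
  · exact this
  · rw [Dart.symm_symm, hsymm, add_comm] at this
    exact this

end Potentials

end PlaneGraph

namespace PlaneGraph

set_option linter.unusedSectionVars false

open SimpleGraph

/-! ### Boundary walks, and cycles made of a boundary arc and one edge -/

section Arcs

open scoped Classical

variable {V : Type*} [Fintype V] {G : SimpleGraph V}

/-- An embedding of a graph of minimum degree at least 3, with two faces such that every vertex lies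
on the boundary of one of them. -/
structure Bordered {V : Type*} [Finite V] (G : SimpleGraph V) extends Embedding G where
  f₁ : Fin numFaces
  f₂ : Fin numFaces
  cover : ∀ v, ∃ d : G.Dart, d.fst = v ∧ (face d = f₁ ∨ face d = f₂)
  rot_ne : ∀ d, rot d ≠ d
  rot_rot_ne : ∀ d, rot (rot d) ≠ d

/-- Exchange the roles of the two faces. -/
def Bordered.swap (E : Bordered G) : Bordered G :=
  { E with
    f₁ := E.f₂
    f₂ := E.f₁
    cover := fun v => (E.cover v).imp fun _ h => ⟨h.1, h.2.symm⟩ }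

theorem Bordered.exists_adj (E : Bordered G) (v : V) : ∃ w, G.Adj v w := by
  obtain ⟨d, rfl, -⟩ := E.cover v
  exact ⟨d.snd, d.adj⟩

theorem zmod_two_eq (a : ZMod 2) : a = 0 ∨ a = 1 := by
  revert a; decide

/-- The function `c` on faces has the coboundary `z`. -/
def FaceSystem.IsPotential (E : FaceSystem G) (c : Fin E.numFaces → ZMod 2) (z : G.Dart → ZMod 2) :
    Prop :=
  ∀ d, c (E.face d) + c (E.face d.symm) = z d

theorem FaceSystem.IsPotential.face_symm {E : FaceSystem G} {c : Fin E.numFaces → ZMod 2}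
    {z : G.Dart → ZMod 2} (h : E.IsPotential c z) (d : G.Dart) :
    c (E.face d.symm) = c (E.face d) + z d := by
  rw [← h d, ← add_assoc, CharTwo.add_self_eq_zero, zero_add]

theorem FaceSystem.IsPotential.face_rot {E : FaceSystem G} {c : Fin E.numFaces → ZMod 2}
    {z : G.Dart → ZMod 2} (h : E.IsPotential c z) (d : G.Dart) :
    c (E.face (E.rot d)) = c (E.face d) + z d := by
  rw [E.face_rot, h.face_symm]

/-- On the way around a vertex the potential changes only across edges of the chain, so all corners
at a vertex off the chain have one value. -/
theorem FaceSystem.IsPotential.eq_of_fst_eq {E : FaceSystem G} {c : Fin E.numFaces → ZMod 2}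
    {z : G.Dart → ZMod 2} (h : E.IsPotential c z) {d d' : G.Dart} (hd : d.fst = d'.fst)
    (hz : ∀ g : G.Dart, g.fst = d.fst → z g = 0) : c (E.face d) = c (E.face d') := by
  have := E.rot_induction (p := fun g => g.fst = d.fst ∧ c (E.face g) = c (E.face d))
    (fun g hg => ⟨by rw [E.rot_fst, hg.1], by rw [h.face_rot, hz g hg.1, add_zero, hg.2]⟩) hd
    ⟨rfl, rfl⟩
  exact this.2.symm

theorem Bordered.exists_potential (E : Bordered G) (f : Fin E.numFaces) (z : G.Dart → ZMod 2)
    (hsymm : ∀ d, z d.symm = z d) (hz : ∀ v, chainBoundary z v = 0) :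
    ∃ c, E.IsPotential c z ∧ c f = 0 := by
  rcases isEmpty_or_nonempty V with hV | hV
  · exact ⟨0, fun d => (hV.false d.fst).elim, rfl⟩
  obtain ⟨c, hc⟩ := E.toEmbedding.exists_potential E.exists_adj z hsymm hz
  refine ⟨fun g => c g + c f, fun d => ?_, CharTwo.add_self_eq_zero _⟩
  rw [← hc d]
  have := CharTwo.add_self_eq_zero (c f)
  linear_combination this

/-- The closed walk around the face on the left of a dart. -/
def FaceSystem.walk (E : FaceSystem G) (d : G.Dart) (i : ℕ) : G.Dart := (E.next ^ i) d

@[simp]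
theorem FaceSystem.walk_zero (E : FaceSystem G) (d : G.Dart) : E.walk d 0 = d := rfl

theorem FaceSystem.walk_succ (E : FaceSystem G) (d : G.Dart) (i : ℕ) :
    E.walk d (i + 1) = E.next (E.walk d i) := by
  rw [walk, pow_succ', Equiv.Perm.mul_apply]; rfl

theorem FaceSystem.walk_walk (E : FaceSystem G) (d : G.Dart) (i j : ℕ) :
    E.walk (E.walk d i) j = E.walk d (i + j) := by
  rw [walk, walk, walk, add_comm, pow_add, Equiv.Perm.mul_apply]

theorem FaceSystem.walk_snd (E : FaceSystem G) (d : G.Dart) (i : ℕ) :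
    (E.walk d i).snd = (E.walk d (i + 1)).fst := by
  rw [walk_succ, next_fst]

theorem FaceSystem.rot_walk_symm (E : FaceSystem G) (d : G.Dart) (i : ℕ) :
    E.rot (E.walk d i).symm = E.walk d (i + 1) := by
  rw [walk_succ, next_apply]

@[simp]
theorem FaceSystem.face_walk (E : FaceSystem G) (d : G.Dart) (i : ℕ) :
    E.face (E.walk d i) = E.face d := by
  induction i with
  | zero => rfl
  | succ i ih => rw [walk_succ, face_apply_next, ih]

theorem FaceSystem.walk_injective (E : FaceSystem G) (i : ℕ) {d d' : G.Dart}
    (h : E.walk d i = E.walk d' i) : d = d' :=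
  (E.next ^ i).injective h

theorem edgeChain_self (e : G.Dart) : edgeChain e e = 1 := by
  simp [edgeChain, e.symm_ne]

theorem edgeChain_eq_zero {e d : G.Dart} (h : d ≠ e) (h' : d.symm ≠ e) : edgeChain e d = 0 := by
  simp [edgeChain, h, h']

/-- The sum of the edges of a part of the boundary walk of a face. -/
noncomputable def FaceSystem.arcChain (E : FaceSystem G) (d : G.Dart) (k : ℕ) : G.Dart → ZMod 2 :=
  ∑ i ∈ Finset.range k, edgeChain (E.walk d i)

theorem FaceSystem.arcChain_apply (E : FaceSystem G) (d : G.Dart) (k : ℕ) (g : G.Dart) :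
    E.arcChain d k g = ∑ i ∈ Finset.range k, edgeChain (E.walk d i) g := by
  simp [arcChain]

theorem FaceSystem.arcChain_symm (E : FaceSystem G) (d : G.Dart) (k : ℕ) (g : G.Dart) :
    E.arcChain d k g.symm = E.arcChain d k g := by
  simp [arcChain_apply, edgeChain_symm]

theorem FaceSystem.chainBoundary_arcChain (E : FaceSystem G) (d : G.Dart) (k : ℕ) (v : V) :
    chainBoundary (E.arcChain d k) v =
      (if d.fst = v then 1 else 0) + (if (E.walk d k).fst = v then 1 else 0) := by
  induction k with
  | zero =>
    simp only [arcChain, Finset.range_zero, Finset.sum_empty, chainBoundary_zero, walk_zero]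
    exact (CharTwo.add_self_eq_zero _).symm
  | succ k ih =>
    rw [arcChain, Finset.sum_range_succ, chainBoundary_add, ← arcChain, ih, chainBoundary_edgeChain,
      walk_snd]
    have := CharTwo.add_self_eq_zero (if (E.walk d k).fst = v then (1 : ZMod 2) else 0)
    linear_combination this

theorem FaceSystem.arcChain_eq_zero (E : FaceSystem G) {d : G.Dart} {k : ℕ} {g : G.Dart}
    (h : ∀ i < k, E.walk d i ≠ g) (h' : ∀ i < k, E.walk d i ≠ g.symm) : E.arcChain d k g = 0 := by
  rw [arcChain_apply]
  exact Finset.sum_eq_zero fun i hi => edgeChain_eq_zero (h i (Finset.mem_range.1 hi)).symm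
    (h' i (Finset.mem_range.1 hi)).symm

theorem FaceSystem.arcChain_eq_one (E : FaceSystem G) {d : G.Dart} {k i : ℕ} (hi : i < k)
    (h : ∀ j < k, E.walk d j = E.walk d i → j = i) (h' : ∀ j < k, E.walk d j ≠ (E.walk d i).symm) :
    E.arcChain d k (E.walk d i) = 1 := by
  rw [arcChain_apply, Finset.sum_eq_single i, edgeChain_self]
  · exact fun j hj hji => edgeChain_eq_zero (fun e => hji (h j (Finset.mem_range.1 hj) e.symm))
      (h' j (Finset.mem_range.1 hj)).symm
  · exact fun hi' => (hi' (Finset.mem_range.2 hi)).elim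

theorem Bordered.next_ne_symm (E : Bordered G) (d : G.Dart) : E.next d ≠ d.symm := by
  rw [E.next_apply]; exact E.rot_ne _

/-- If a cycle consists of an arc of the boundary of the first face and one more edge, then it
separates the two faces. -/
theorem Bordered.disk (E : Bordered G) (k : ℕ) : ∀ (d e : G.Dart) (c : Fin E.numFaces → ZMod 2),
    2 ≤ k → E.face d = E.f₁ → (∀ i j, i < j → j ≤ k → (E.walk d i).fst ≠ (E.walk d j).fst) →
    e.fst = (E.walk d k).fst → e.snd = d.fst →
    E.IsPotential c (E.arcChain d k + edgeChain e) → c E.f₁ = 0 → c E.f₂ ≠ 0 := by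
  induction k using Nat.strong_induction_on with
  | _ k ih =>
  -- Suppose that both faces have potential 0. The other side of the cycle then contains neither,
  -- and a chord into that side will give a shorter cycle with the same defect.
  intro d e c hk hd hinj he he' hc h1 h2
  have hinj' : ∀ i j, i ≤ k → j ≤ k → (E.walk d i).fst = (E.walk d j).fst → i = j := by
    intro i j hi hj h
    rcases lt_trichotomy i j with hij | hij | hij
    · exact (hinj i j hij hj h).elim
    · exact hij
    · exact (hinj j i hij hi h.symm).elim
  have hw : ∀ i j, i < k → j < k → E.walk d i = E.walk d j → i = j :=
    fun i j hi hj h => hinj' i j hi.le hj.le (by rw [h])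
  have hsymm : ∀ i j, i < k → j < k → E.walk d j ≠ (E.walk d i).symm := by
    intro i j hi hj h
    have e1 : (E.walk d j).fst = (E.walk d (i + 1)).fst := by
      rw [h, ← E.walk_snd]; rfl
    have e2 : (E.walk d (j + 1)).fst = (E.walk d i).fst := by
      rw [← E.walk_snd, h]; rfl
    have := hinj' _ _ hj.le hi e1
    have := hinj' _ _ hj hi.le e2
    omega
  have harce : ∀ i < k, edgeChain e (E.walk d i) = 0 := by
    intro i hi
    refine edgeChain_eq_zero (fun h => ?_) (fun h => ?_)
    · have := hinj' i k hi.le le_rfl (by rw [h, he])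
      omega
    · have e1 : (E.walk d i).snd = e.fst := by rw [← h]; rfl
      have e2 : (E.walk d i).fst = e.snd := by rw [← h]; rfl
      have := hinj' (i + 1) k hi le_rfl (by rw [← E.walk_snd, e1, he])
      have := hinj' i 0 hi.le (Nat.zero_le _) (by rw [e2, he']; rfl)
      omega
  have hz1 : ∀ i < k, (E.arcChain d k + edgeChain e) (E.walk d i) = 1 := by
    intro i hi
    rw [Pi.add_apply, harce i hi, add_zero]
    exact E.arcChain_eq_one hi (fun j hj h => hw j i hj hi h) (fun j hj => hsymm i j hi hj)
  have hoff : ∀ g : G.Dart, (∀ i ≤ k, g.fst ≠ (E.walk d i).fst) →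
      (E.arcChain d k + edgeChain e) g = 0 := by
    intro g hg
    have a1 : E.arcChain d k g = 0 := by
      refine E.arcChain_eq_zero (fun i hi h => hg i hi.le (by rw [h])) (fun i hi h => ?_)
      refine hg (i + 1) hi ?_
      rw [← E.walk_snd, h]; rfl
    have a2 : edgeChain e g = 0 := by
      refine edgeChain_eq_zero (fun h => hg k le_rfl (by rw [h, he])) (fun h => ?_)
      refine hg 0 (Nat.zero_le _) ?_
      rw [E.walk_zero, ← he', ← h]; rfl
    rw [Pi.add_apply, a1, a2, add_zero]
  -- The second vertex of the arc has degree at least 3, and the dart after `walk d 1` is neither of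
  -- its two cycle darts: it enters the side with potential 1.
  set g : G.Dart := E.rot (E.walk d 1) with hgdef
  have hg1 : g ≠ E.walk d 1 := E.rot_ne _
  have hg0 : g ≠ d.symm := by
    intro h
    have : E.rot d.symm = E.walk d 1 := E.rot_walk_symm d 0
    exact E.rot_rot_ne d.symm (by rw [this, ← hgdef, h])
  have hgfst : g.fst = (E.walk d 1).fst := E.rot_fst _
  have hgz : (E.arcChain d k + edgeChain e) g = 0 := by
    have a1 : E.arcChain d k g = 0 := by
      refine E.arcChain_eq_zero (fun i hi h => ?_) (fun i hi h => ?_)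
      · have := hinj' i 1 hi.le (by omega) (by rw [h, hgfst])
        subst this
        exact hg1 h.symm
      · have := hinj' (i + 1) 1 hi (by omega) (by rw [← E.walk_snd, h, ← hgfst]; rfl)
        obtain rfl : i = 0 := by omega
        exact hg0 (by rw [← E.walk_zero d, h, Dart.symm_symm])
    have a2 : edgeChain e g = 0 := by
      refine edgeChain_eq_zero (fun h => ?_) (fun h => ?_)
      · have := hinj' 1 k (by omega) le_rfl (by rw [← hgfst, h, he])
        omega
      · have := hinj' 1 0 (by omega) (by omega) (by rw [← hgfst, E.walk_zero, ← he', ← h]; rfl)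
        omega
    rw [Pi.add_apply, a1, a2, add_zero]
  have hcg : c (E.face g) = 1 := by
    rw [hgdef, hc.face_rot, hz1 1 (by omega), E.face_walk, hd, h1, zero_add]
  have hcg' : c (E.face g.symm) = 1 := by
    rw [hc.face_symm, hgz, add_zero, hcg]
  -- If the end of `g` were off the cycle, all its corners would have potential 1, but one of them
  -- lies in the first or the second face.
  obtain ⟨l, hl, hgl⟩ : ∃ l ≤ k, g.snd = (E.walk d l).fst := by
    by_contra! hcon
    obtain ⟨g', hg', hf⟩ := E.cover g.snd
    have := hc.eq_of_fst_eq (d := g.symm) (d' := g') hg'.symm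
      (fun a ha => hoff a fun i hi => by rw [ha]; exact hcon i hi)
    rw [hcg'] at this
    rcases hf with hf | hf
    · rw [hf, h1] at this
      exact one_ne_zero this
    · rw [hf, h2] at this
      exact one_ne_zero this
  have hl0 : l ≠ 0 := by
    rintro rfl
    refine hg0 (Dart.ext _ _ (Prod.ext ?_ hgl))
    rw [hgfst, ← E.walk_snd]; rfl
  have hl1 : l ≠ 1 := by
    rintro rfl
    exact g.fst_ne_snd (by rw [hgl, hgfst])
  have hl2 : l ≠ 2 := by
    rintro rfl
    exact hg1 (Dart.ext _ _ (Prod.ext hgfst (by rw [E.walk_snd]; exact hgl)))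
  have hwalk : E.walk (E.walk d 1) (l - 1) = E.walk d l := by
    rw [E.walk_walk]; congr 1; omega
  -- The shorter cycle runs along the arc from vertex 1 to vertex `l` and back along `g`. Since `l ≥
  -- 3`, its arc still has at least two edges.
  obtain ⟨c', hc', h1'⟩ := E.exists_potential E.f₁
    (E.arcChain (E.walk d 1) (l - 1) + edgeChain g.symm)
    (fun a => by simp only [Pi.add_apply, E.arcChain_symm, edgeChain_symm])
    (fun v => by
      rw [chainBoundary_add, E.chainBoundary_arcChain, chainBoundary_edgeChain, hwalk, ← hgl]
      change _ + ((if g.snd = v then (1 : ZMod 2) else 0) + (if g.fst = v then 1 else 0)) = 0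
      rw [hgfst]
      generalize (if (E.walk d 1).fst = v then (1 : ZMod 2) else 0) = a
      generalize (if g.snd = v then (1 : ZMod 2) else 0) = b
      linear_combination CharTwo.add_self_eq_zero a + CharTwo.add_self_eq_zero b)
  refine ih (l - 1) (by omega) (E.walk d 1) g.symm c' (by omega) (by rw [E.face_walk, hd]) ?_ ?_
    hgfst hc' h1' ?_
  · intro i j hij hj
    rw [E.walk_walk, E.walk_walk]
    exact hinj _ _ (by omega) (by omega)
  · rw [hwalk, ← hgl]; rfl
  -- The initial vertex of the old arc is off the new cycle, so its corners are all on the side of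
  -- the first face. This rules out crossing `e` below.
  have hx0 : ∀ a : G.Dart, a.fst = d.fst → c' (E.face a) = 0 := by
    intro a ha
    rw [← h1', ← hd]
    refine hc'.eq_of_fst_eq ha fun b hb => ?_
    rw [ha] at hb
    have a1 : E.arcChain (E.walk d 1) (l - 1) b = 0 := by
      refine E.arcChain_eq_zero (fun i hi h => ?_) (fun i hi h => ?_)
      · rw [E.walk_walk] at h
        have := hinj' (1 + i) 0 (by omega) (by omega) (by rw [h, hb]; rfl)
        omega
      · rw [E.walk_walk] at h
        have := hinj' (1 + i + 1) 0 (by omega) (by omega)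
          (by rw [← E.walk_snd, h, E.walk_zero, ← hb]; rfl)
        omega
    have a2 : edgeChain g.symm b = 0 := by
      refine edgeChain_eq_zero (fun h => ?_) (fun h => ?_)
      · have := hinj' l 0 hl (by omega) (by rw [E.walk_zero, ← hb, h, ← hgl]; rfl)
        omega
      · have := hinj' 1 0 (by omega) (by omega)
          (by rw [E.walk_zero, ← hb, ← hgfst, ← Dart.symm_symm b, h]; rfl)
        omega
    rw [Pi.add_apply, a1, a2, add_zero]
  -- If the new cycle separated the faces, the second face would be inside the new cycle and outside
  -- the old one. No edge leads out of this set of faces, yet the first face is not in it.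
  by_contra hne
  have hS := E.toEmbedding.face_induction E.exists_adj
    (S := fun f => c' f = 1 ∧ c f = 0) ?_ (f := E.f₂) ⟨(zmod_two_eq _).resolve_left hne, h2⟩ E.f₁
  · simp [h1'] at hS
  rintro a ⟨ha', ha⟩
  have b1 : ∀ i, E.walk d i ≠ a := by
    rintro i rfl
    rw [E.face_walk, hd, h1'] at ha'
    exact zero_ne_one ha'
  have b2 : ∀ i < k, E.walk d i ≠ a.symm := by
    intro i hi h
    have := hc (E.walk d i)
    rw [hz1 i hi, E.face_walk, hd, h1, h, Dart.symm_symm, ha, add_zero] at this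
    exact zero_ne_one this
  have b3 : a ≠ e := by
    rintro rfl
    have := hx0 (E.rot a.symm) (by rw [E.rot_fst, ← he']; rfl)
    rw [E.face_rot, Dart.symm_symm, ha'] at this
    exact one_ne_zero this
  have b4 : a.symm ≠ e := by
    rintro rfl
    have := hx0 a he'
    rw [ha'] at this
    exact one_ne_zero this
  have b5 : a ≠ g.symm := by
    rintro rfl
    rw [hcg'] at ha
    exact one_ne_zero ha
  have b6 : a.symm ≠ g.symm := by
    intro h
    rw [← Dart.symm_symm a, h, Dart.symm_symm, hcg] at ha
    exact one_ne_zero ha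
  have z1 : (E.arcChain d k + edgeChain e) a = 0 := by
    rw [Pi.add_apply, E.arcChain_eq_zero (fun i _ => b1 i) b2, edgeChain_eq_zero b3 b4, add_zero]
  have z2 : (E.arcChain (E.walk d 1) (l - 1) + edgeChain g.symm) a = 0 := by
    rw [Pi.add_apply, E.arcChain_eq_zero, edgeChain_eq_zero b5 b6, add_zero]
    · intro i _; rw [E.walk_walk]; exact b1 _
    · intro i hi; rw [E.walk_walk]; exact b2 _ (by omega)
  exact ⟨by rw [hc'.face_symm, z2, ha', add_zero], by rw [hc.face_symm, z1, ha, add_zero]⟩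

end Arcs

end PlaneGraph

namespace PlaneGraph

set_option linter.unusedSectionVars false

open SimpleGraph

/-! ### The border of each face is a chordless cycle -/

section Borders

open scoped Classical

variable {V : Type*} [Fintype V] {G : SimpleGraph V}

theorem FaceSystem.IsPotential.add {E : FaceSystem G} {c c' : Fin E.numFaces → ZMod 2}
    {z z' : G.Dart → ZMod 2} (h : E.IsPotential c z) (h' : E.IsPotential c' z') :
    E.IsPotential (c + c') (z + z') := by
  intro d
  simp only [Pi.add_apply, ← h d, ← h' d]
  ring

theorem FaceSystem.arcChain_add (E : FaceSystem G) (d : G.Dart) (k l : ℕ) :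
    E.arcChain d (k + l) = E.arcChain d k + E.arcChain (E.walk d k) l := by
  rw [arcChain, Finset.sum_range_add, arcChain, arcChain]
  simp only [walk_walk]

theorem FaceSystem.arcChain_succ (E : FaceSystem G) (d : G.Dart) (k : ℕ) :
    E.arcChain d (k + 1) = E.arcChain d k + edgeChain (E.walk d k) :=
  Finset.sum_range_succ _ _

theorem FaceSystem.exists_period (E : FaceSystem G) (d : G.Dart) :
    ∃ L, 0 < L ∧ E.walk d L = d ∧ ∀ i j, i < j → j < L → E.walk d i ≠ E.walk d j := by
  have hex : ∃ L, 0 < L ∧ E.walk d L = d :=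
    ⟨orderOf E.next, orderOf_pos _, by rw [FaceSystem.walk, pow_orderOf_eq_one]; rfl⟩
  refine ⟨Nat.find hex, (Nat.find_spec hex).1, (Nat.find_spec hex).2, fun i j hij hj h => ?_⟩
  have : E.walk (E.walk d (j - i)) i = E.walk d i := by
    rw [E.walk_walk, h]; congr 1; omega
  exact Nat.find_min hex (m := j - i) (by omega) ⟨by omega, E.walk_injective i this⟩

theorem FaceSystem.chainBoundary_closed_arcChain (E : FaceSystem G) {d : G.Dart} {k : ℕ}
    (h : (E.walk d k).fst = d.fst) (v : V) : chainBoundary (E.arcChain d k) v = 0 := by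
  rw [E.chainBoundary_arcChain, h]
  exact CharTwo.add_self_eq_zero _

/-- Every closed part of the boundary walk of the first face separates the two faces. -/
theorem Bordered.separates_of_closed_arc (E : Bordered G) (k : ℕ) :
    ∀ (d : G.Dart) (c : Fin E.numFaces → ZMod 2), 1 ≤ k → E.face d = E.f₁ →
    (∀ i j, i < j → j < k → E.walk d i ≠ E.walk d j) → (E.walk d k).fst = d.fst →
    E.IsPotential c (E.arcChain d k) → c E.f₁ = 0 → c E.f₂ = 1 := by
  induction k using Nat.strong_induction_on with
  | _ k ih =>
  intro d c hk hd hinj hclosed hc h1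
  refine (zmod_two_eq _).resolve_left ?_
  have hk1 : k ≠ 1 := by
    rintro rfl
    rw [← E.walk_snd] at hclosed
    exact d.fst_ne_snd hclosed.symm
  have hk2 : k ≠ 2 := by
    rintro rfl
    refine E.next_ne_symm d (Dart.ext _ _ (Prod.ext (E.next_fst d) ?_))
    rw [← E.walk_snd] at hclosed
    exact hclosed
  obtain ⟨m, rfl⟩ : ∃ m, k = m + 1 := ⟨k - 1, by omega⟩
  -- If no vertex repeats, the last edge of the walk plays the role of the additional edge in
  -- `disk`. Otherwise a shorter closed subwalk separates the faces by induction.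
  by_cases hx : ∀ i j, i < j → j ≤ m → (E.walk d i).fst ≠ (E.walk d j).fst
  · refine E.disk m d (E.walk d m) c (by omega) hd hx rfl ?_ ?_ h1
    · rw [E.walk_snd, hclosed]
    · rw [← E.arcChain_succ]; exact hc
  push Not at hx
  obtain ⟨i, j, hij, hj, hxy⟩ := hx
  intro h2
  have hwalk : (E.walk (E.walk d i) (j - i)) = E.walk d j := by
    rw [E.walk_walk]; congr 1; omega
  have hclosed' : (E.walk (E.walk d i) (j - i)).fst = (E.walk d i).fst := by
    rw [hwalk, hxy]
  obtain ⟨c', hc', h1'⟩ := E.exists_potential E.f₁ (E.arcChain (E.walk d i) (j - i))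
    (E.arcChain_symm _ _) (E.chainBoundary_closed_arcChain hclosed')
  have h2' := ih (j - i) (by omega) (E.walk d i) c' (by omega) (by rw [E.face_walk, hd])
    (fun a b hab hb => by rw [E.walk_walk, E.walk_walk]; exact hinj _ _ (by omega) (by omega))
    hclosed' hc' h1'
  -- As in `disk`, faces beyond the subwalk but on the near side of the whole walk form a set that
  -- cannot be left and misses the first face.
  have hS := E.toEmbedding.face_induction E.exists_adj
    (S := fun f => c' f = 1 ∧ c f = 0) ?_ (f := E.f₂) ⟨h2', h2⟩ E.f₁
  · simp [h1'] at hS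
  rintro a ⟨ha', ha⟩
  have b1 : ∀ l, E.walk d l ≠ a := by
    rintro l rfl
    rw [E.face_walk, hd, h1'] at ha'
    exact zero_ne_one ha'
  have b2 : ∀ l < j - i, E.walk (E.walk d i) l ≠ a.symm := by
    intro l hl h
    rw [E.walk_walk] at h
    have := hc (E.walk d (i + l))
    rw [E.arcChain_eq_one (by omega), E.face_walk, hd, h1, h, Dart.symm_symm, ha, add_zero] at this
    · exact zero_ne_one this
    · intro n hn h'
      rcases lt_trichotomy n (i + l) with h3 | h3 | h3
      · exact (hinj _ _ h3 (by omega) h').elim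
      · exact h3
      · exact (hinj _ _ h3 (by omega) h'.symm).elim
    · intro n hn h'
      exact b1 n (by rw [h', h, Dart.symm_symm])
  have z2 : c' (E.face a.symm) = 1 := by
    rw [hc'.face_symm, E.arcChain_eq_zero _ b2, ha', add_zero]
    intro l _; rw [E.walk_walk]; exact b1 _
  refine ⟨z2, ?_⟩
  rw [hc.face_symm, E.arcChain_eq_zero (fun l _ => b1 l), ha, add_zero]
  rintro l - h
  rw [← h, E.face_walk, hd, h1'] at z2
  exact zero_ne_one z2

theorem Bordered.exists_separator (E : Bordered G) {d : G.Dart} (hd : E.face d = E.f₁) {L : ℕ}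
    (hL : 0 < L) (hdL : E.walk d L = d) (hinj : ∀ i j, i < j → j < L → E.walk d i ≠ E.walk d j) :
    ∃ c, E.IsPotential c (E.arcChain d L) ∧ c E.f₁ = 0 ∧ c E.f₂ = 1 := by
  obtain ⟨c, hc, h1⟩ := E.exists_potential E.f₁ (E.arcChain d L) (E.arcChain_symm _ _)
    (E.chainBoundary_closed_arcChain (by rw [hdL]))
  exact ⟨c, hc, h1, E.separates_of_closed_arc L d c hL hd hinj (by rw [hdL]) hc h1⟩

/-- A coboundary of a whole border takes different values at the two faces. -/
theorem Bordered.border_potential (E : Bordered G) {d : G.Dart} (hd : E.face d = E.f₁) {L : ℕ}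
    (hL : 0 < L) (hdL : E.walk d L = d) (hinj : ∀ i j, i < j → j < L → E.walk d i ≠ E.walk d j)
    {c : Fin E.numFaces → ZMod 2} (hc : E.IsPotential c (E.arcChain d L)) (h1 : c E.f₁ = 0) :
    c E.f₂ = 1 :=
  E.separates_of_closed_arc L d c hL hd hinj (by rw [hdL]) hc h1

/-- A second boundary walk of the first face would separate the two faces as well. The faces beyond
both walks form a set that cannot be left: an edge of one walk leads to the first face without
crossing the other walk, whose potential would have to be both 0 and 1 there. -/
theorem Bordered.walk_eq_of_face (E : Bordered G) {d d' : G.Dart} (hd : E.face d = E.f₁)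
    (hd' : E.face d' = E.f₁) {L : ℕ} (hL : 0 < L) (hdL : E.walk d L = d)
    (hinj : ∀ i j, i < j → j < L → E.walk d i ≠ E.walk d j) : ∃ i < L, E.walk d i = d' := by
  by_contra! hcon
  have hcon' : ∀ i, E.walk d i ≠ d' := by
    intro i h
    refine hcon (i % L) (Nat.mod_lt _ hL) ?_
    rw [← h]
    have hmul : ∀ q, E.walk d (L * q) = d := by
      intro q
      induction q with
      | zero => rfl
      | succ q ihq => rw [Nat.mul_succ, ← E.walk_walk, ihq, hdL]
    conv_rhs => rw [← Nat.div_add_mod i L, ← E.walk_walk, hmul]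
  obtain ⟨M, hM, hdM, hinjM⟩ := E.exists_period d'
  have hdisj : ∀ i j, E.walk d i ≠ E.walk d' j := by
    intro i j h
    have h3 : E.walk d (i + (M * j - j)) = d' := by
      rw [← E.walk_walk, h, E.walk_walk]
      have : j + (M * j - j) = M * j := by
        have : j ≤ M * j := Nat.le_mul_of_pos_left j hM
        omega
      rw [this]
      clear h this
      induction j with
      | zero => rfl
      | succ q ihq => rw [Nat.mul_succ, ← E.walk_walk, ihq, hdM]
    exact hcon' _ h3
  obtain ⟨c, hc, h1, h2⟩ := E.exists_separator hd hL hdL hinj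
  obtain ⟨c', hc', h1', h2'⟩ := E.exists_separator hd' hM hdM hinjM
  have hS := E.toEmbedding.face_induction E.exists_adj
    (S := fun f => c f = 1 ∧ c' f = 1) ?_ (f := E.f₂) ⟨h2, h2'⟩ E.f₁
  · simp [h1'] at hS
  rintro a ⟨ha, ha'⟩
  have hf : E.face a ≠ E.f₁ := by
    intro h
    rw [h, h1] at ha
    exact zero_ne_one ha
  have b1 : ∀ i, E.walk d i ≠ a := by
    rintro i rfl
    exact hf (by rw [E.face_walk, hd])
  have b1' : ∀ i, E.walk d' i ≠ a := by
    rintro i rfl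
    exact hf (by rw [E.face_walk, hd'])
  have b2 : ∀ i < L, E.walk d i ≠ a.symm := by
    intro i _ h
    have h3 := hc' a
    rw [E.arcChain_eq_zero (fun j _ => b1' j) (fun j _ h' => hdisj i j (h.trans h'.symm)), ← h,
      E.face_walk, hd, h1', ha'] at h3
    exact one_ne_zero h3
  have b2' : ∀ i < M, E.walk d' i ≠ a.symm := by
    intro i _ h
    have h3 := hc a
    rw [E.arcChain_eq_zero (fun j _ => b1 j) (fun j _ h' => hdisj j i (h'.trans h.symm)), ← h,
      E.face_walk, hd', h1, ha] at h3
    exact one_ne_zero h3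
  exact ⟨by rw [hc.face_symm, E.arcChain_eq_zero (fun i _ => b1 i) b2, ha, add_zero],
    by rw [hc'.face_symm, E.arcChain_eq_zero (fun i _ => b1' i) b2', ha', add_zero]⟩

theorem Bordered.f₁_ne_f₂ (E : Bordered G) [Nonempty V] : E.f₁ ≠ E.f₂ := by
  intro h
  obtain ⟨v⟩ := ‹Nonempty V›
  obtain ⟨d, -, hd⟩ := E.cover v
  have hd : E.face d = E.f₁ := hd.elim id fun h' => h'.trans h.symm
  obtain ⟨L, hL, hdL, hinj⟩ := E.exists_period d
  obtain ⟨c, -, h1, h2⟩ := E.exists_separator hd hL hdL hinj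
  rw [← h, h1] at h2
  exact zero_ne_one h2

/-- Sub-arcs of a period are injective. -/
theorem FaceSystem.walk_ne_of_period (E : FaceSystem G) {d : G.Dart} {L : ℕ}
    (hdL : E.walk d L = d) (hinj : ∀ i j, i < j → j < L → E.walk d i ≠ E.walk d j) (s : ℕ) :
    E.walk (E.walk d s) L = E.walk d s ∧
      ∀ i j, i < j → j < L → E.walk (E.walk d s) i ≠ E.walk (E.walk d s) j := by
  refine ⟨by rw [E.walk_walk, add_comm, ← E.walk_walk, hdL], fun i j hij hj h => ?_⟩
  rw [E.walk_walk, E.walk_walk, add_comm s i, add_comm s j, ← E.walk_walk, ← E.walk_walk,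
    E.walk_walk d i s, E.walk_walk d j s, add_comm i s, add_comm j s] at h
  refine hinj i j hij hj (E.walk_injective s ?_)
  rw [E.walk_walk, E.walk_walk, add_comm i s, add_comm j s, h]

/-- The boundary walk of the first face is a cycle: it visits every vertex at most once. -/
theorem Bordered.eq_of_face_eq_f₁ (E : Bordered G) {d d' : G.Dart} (hd : E.face d = E.f₁)
    (hd' : E.face d' = E.f₁) (h : d.fst = d'.fst) : d = d' := by
  by_contra hne
  obtain ⟨L, hL, hdL, hinj⟩ := E.exists_period d
  obtain ⟨k, hk, rfl⟩ := E.walk_eq_of_face hd hd' hL hdL hinj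
  have hk0 : k ≠ 0 := by
    rintro rfl
    exact hne rfl
  obtain ⟨-, hinj'⟩ := E.walk_ne_of_period hdL hinj k
  have hw : E.walk (E.walk d k) (L - k) = d := by
    rw [E.walk_walk, ← hdL]; congr 1; omega
  -- A repeated vertex cuts the border into two closed walks. Each of them separates the faces, and
  -- so does their sum, the whole border; but 1 + 1 = 0.
  obtain ⟨c, hc, h1⟩ := E.exists_potential E.f₁ (E.arcChain d k) (E.arcChain_symm _ _)
    (E.chainBoundary_closed_arcChain h.symm)
  obtain ⟨c', hc', h1'⟩ := E.exists_potential E.f₁ (E.arcChain (E.walk d k) (L - k))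
    (E.arcChain_symm _ _) (E.chainBoundary_closed_arcChain (by rw [hw, h]))
  have h2 := E.separates_of_closed_arc k d c (by omega) hd
    (fun i j hij hj => hinj i j hij (hj.trans hk)) h.symm hc h1
  have h2' := E.separates_of_closed_arc (L - k) (E.walk d k) c' (by omega) hd'
    (fun i j hij hj => hinj' i j hij (by omega)) (by rw [hw, h]) hc' h1'
  have hcc := hc.add hc'
  rw [← E.arcChain_add, show k + (L - k) = L by omega] at hcc
  have h3 := E.border_potential hd hL hdL hinj hcc (by simp [h1, h1'])
  rw [Pi.add_apply, h2, h2'] at h3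
  exact absurd h3 (by decide)

/-- Otherwise `d.symm` and the dart that follows `d` would both be the unique border dart at their
vertex, and the walk would turn back along `d`. -/
theorem Bordered.face_symm_ne_f₁ (E : Bordered G) {d : G.Dart} (hd : E.face d = E.f₁) :
    E.face d.symm ≠ E.f₁ := by
  intro h
  refine E.next_ne_symm d (E.eq_of_face_eq_f₁ (by rw [E.face_apply_next, hd]) h ?_)
  rw [E.next_fst]; rfl

/-- The border of the first face has no chords. -/
theorem Bordered.face_eq_f₁_of_ends (E : Bordered G) {d d' e : G.Dart} (hd : E.face d = E.f₁)
    (hd' : E.face d' = E.f₁) (he : e.fst = d'.fst) (he' : e.snd = d.fst) :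
    E.face e = E.f₁ ∨ E.face e.symm = E.f₁ := by
  by_contra! hne
  obtain ⟨L, hL, hdL, hinj⟩ := E.exists_period d
  obtain ⟨k, hk, rfl⟩ := E.walk_eq_of_face hd hd' hL hdL hinj
  have hk0 : k ≠ 0 := by
    rintro rfl
    exact e.fst_ne_snd (by rw [he, he']; rfl)
  have hk1 : k ≠ 1 := by
    rintro rfl
    refine hne.2 ?_
    rw [← hd]
    congr 1
    refine Dart.ext _ _ (Prod.ext he' ?_)
    change e.fst = d.snd
    rw [he, ← E.walk_snd, E.walk_zero]
  have hkL : k + 1 ≠ L := by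
    rintro rfl
    refine hne.1 ?_
    rw [← hd']
    congr 1
    refine Dart.ext _ _ (Prod.ext he ?_)
    rw [he', E.walk_snd, hdL]
  obtain ⟨hdL', hinj'⟩ := E.walk_ne_of_period hdL hinj k
  have hv : ∀ i j, i < j → j < L → (E.walk d i).fst ≠ (E.walk d j).fst := fun i j hij hj h =>
    hinj i j hij hj
      (E.eq_of_face_eq_f₁ (by rw [E.face_walk, hd]) (by rw [E.face_walk, hd]) h)
  have hv' : ∀ i j, i < j → j < L →
      (E.walk (E.walk d k) i).fst ≠ (E.walk (E.walk d k) j).fst := fun i j hij hj h =>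
    hinj' i j hij hj
      (E.eq_of_face_eq_f₁ (by rw [E.face_walk, hd']) (by rw [E.face_walk, hd']) h)
  have hw : E.walk (E.walk d k) (L - k) = d := by
    rw [E.walk_walk, ← hdL]; congr 1; omega
  obtain ⟨c, hc, h1⟩ := E.exists_potential E.f₁ (E.arcChain d k + edgeChain e)
    (fun a => by simp only [Pi.add_apply, E.arcChain_symm, edgeChain_symm])
    (fun v => by
      rw [chainBoundary_add, E.chainBoundary_arcChain, chainBoundary_edgeChain, he, he']
      linear_combination CharTwo.add_self_eq_zero (if d.fst = v then (1 : ZMod 2) else 0) +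
        CharTwo.add_self_eq_zero (if (E.walk d k).fst = v then (1 : ZMod 2) else 0))
  obtain ⟨c', hc', h1'⟩ := E.exists_potential E.f₁
    (E.arcChain (E.walk d k) (L - k) + edgeChain e.symm)
    (fun a => by simp only [Pi.add_apply, E.arcChain_symm, edgeChain_symm])
    (fun v => by
      rw [chainBoundary_add, E.chainBoundary_arcChain, chainBoundary_edgeChain, hw,
        show e.symm.fst = d.fst from he', show e.symm.snd = (E.walk d k).fst from he]
      linear_combination CharTwo.add_self_eq_zero (if d.fst = v then (1 : ZMod 2) else 0) +
        CharTwo.add_self_eq_zero (if (E.walk d k).fst = v then (1 : ZMod 2) else 0))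
  have h2 := (zmod_two_eq _).resolve_left <| E.disk k d e c (by omega) hd
    (fun i j hij hj => hv i j hij (by omega)) he he' hc h1
  have h2' := (zmod_two_eq _).resolve_left <| E.disk (L - k) (E.walk d k) e.symm c' (by omega) hd'
    (fun i j hij hj => hv' i j hij (by omega)) (by rw [hw]; exact he') he hc' h1'
  have hcc := hc.add hc'
  have hee : edgeChain e.symm = edgeChain e := by
    ext a
    rw [edgeChain, edgeChain, add_comm]
    have e1 : a.symm = e.symm ↔ a = e := Dart.symm_involutive.injective.eq_iff
    have e2 : a.symm = e ↔ a = e.symm := ⟨fun h => by rw [← h, Dart.symm_symm],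
      fun h => by rw [h, Dart.symm_symm]⟩
    simp only [e1, e2]
  -- A chord closes each of the two arcs to a cycle that separates the faces by `disk`. The chord
  -- cancels in the sum, which is the whole border, and again 1 + 1 would have to be 1.
  have hz : E.arcChain d k + edgeChain e + (E.arcChain (E.walk d k) (L - k) + edgeChain e.symm) =
      E.arcChain d L := by
    rw [hee, show L = k + (L - k) by omega, E.arcChain_add, show k + (L - k) - k = L - k by omega]
    ext a
    simp only [Pi.add_apply]
    linear_combination CharTwo.add_self_eq_zero (edgeChain e a)
  rw [hz] at hcc
  have h3 := E.border_potential hd hL hdL hinj hcc (by simp [h1, h1'])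
  rw [Pi.add_apply, h2, h2'] at h3
  exact absurd h3 (by decide)

end Borders

end PlaneGraph

namespace PlaneGraph

set_option linter.unusedSectionVars false

open SimpleGraph

/-! ### Closing a path across the strip by at most one border edge -/

section Caps

open scoped Classical

variable {V : Type*} [Fintype V] {G : SimpleGraph V}

/-- The vertex lies on the border of the first face. -/
def Bordered.On₁ (E : Bordered G) (v : V) : Prop := ∃ d : G.Dart, d.fst = v ∧ E.face d = E.f₁

/-- The vertex lies on the border of the second face. -/
def Bordered.On₂ (E : Bordered G) (v : V) : Prop := ∃ d : G.Dart, d.fst = v ∧ E.face d = E.f₂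

theorem Bordered.on_or_on (E : Bordered G) (v : V) : E.On₁ v ∨ E.On₂ v := by
  obtain ⟨d, hd, h | h⟩ := E.cover v
  · exact Or.inl ⟨d, hd, h⟩
  · exact Or.inr ⟨d, hd, h⟩

theorem Bordered.face_of_on₁ (E : Bordered G) {e : G.Dart} (h : E.On₁ e.fst) (h' : E.On₁ e.snd) :
    E.face e = E.f₁ ∨ E.face e.symm = E.f₁ := by
  obtain ⟨d, hd, hf⟩ := h
  obtain ⟨d', hd', hf'⟩ := h'
  exact E.face_eq_f₁_of_ends hf' hf hd.symm hd'.symm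

theorem Bordered.face_of_on₂ (E : Bordered G) {e : G.Dart} (h : E.On₂ e.fst) (h' : E.On₂ e.snd) :
    E.face e = E.f₂ ∨ E.face e.symm = E.f₂ :=
  E.swap.face_of_on₁ h h'

theorem Bordered.eq_of_face_eq_f₂ (E : Bordered G) {d d' : G.Dart} (hd : E.face d = E.f₂)
    (hd' : E.face d' = E.f₂) (h : d.fst = d'.fst) : d = d' :=
  E.swap.eq_of_face_eq_f₁ hd hd' h

theorem Bordered.face_symm_ne_f₂ (E : Bordered G) {d : G.Dart} (hd : E.face d = E.f₂) :
    E.face d.symm ≠ E.f₂ :=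
  E.swap.face_symm_ne_f₁ hd

theorem Bordered.on₁_snd (E : Bordered G) {d : G.Dart} (h : E.face d = E.f₁) : E.On₁ d.snd :=
  ⟨E.next d, E.next_fst d, by rw [E.face_apply_next, h]⟩

theorem Bordered.on₂_snd (E : Bordered G) {d : G.Dart} (h : E.face d = E.f₂) : E.On₂ d.snd :=
  E.swap.on₁_snd h

theorem edgeChain_ne_zero {e d : G.Dart} (h : edgeChain e d ≠ 0) : d = e ∨ d = e.symm := by
  by_contra! hne
  exact h (edgeChain_eq_zero hne.1 fun h' => hne.2 (by rw [← h', Dart.symm_symm]))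

/-- Around a vertex with exactly two darts on a cycle, these being consecutive in the rotation, one
side of the cycle has a single corner. -/
theorem FaceSystem.IsPotential.sector {E : FaceSystem G} {c : Fin E.numFaces → ZMod 2}
    {z : G.Dart → ZMod 2} (h : E.IsPotential c z) {r d : G.Dart} (hne : E.rot r ≠ r)
    (hr : z r = 1)
    (hr' : z (E.rot r) = 1) (hz : ∀ a : G.Dart, a.fst = r.fst → a ≠ r → a ≠ E.rot r → z a = 0)
    (hd : d.fst = r.fst) (hdr : d ≠ E.rot r) (hcd : c (E.face d) = 0) {a : G.Dart}
    (ha : a.fst = r.fst) : c (E.face a) = if a = E.rot r then 1 else 0 := by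
  refine (E.rot_induction (p := fun a => a.fst = r.fst ∧
    c (E.face a) = if a = E.rot r then 1 else 0) ?_ (hd.trans ha.symm) ⟨hd, ?_⟩).2
  · rintro b ⟨hb, hcb⟩
    refine ⟨by rw [E.rot_fst, hb], ?_⟩
    rw [h.face_rot, hcb]
    simp only [EmbeddingLike.apply_eq_iff_eq]
    by_cases h1 : b = r
    · subst h1
      rw [if_neg hne.symm, if_pos rfl, hr, zero_add]
    · by_cases h2 : b = E.rot r
      · rw [if_pos h2, if_neg h1, h2, hr']
        exact CharTwo.add_self_eq_zero _
      · rw [if_neg h2, if_neg h1, hz b hb h1 h2, zero_add]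
  · rw [hcd, if_neg hdr]

/-- A chain between two vertices of the border of the second face that runs through vertices off this
border, and has no further edges at its vertices on one side, can be closed by at most one edge of the
border. -/
theorem Bordered.exists_cap (E : Bordered G) {d d' : G.Dart} (hd : E.face d = E.f₂)
    (hd' : E.face d' = E.f₂) (p : G.Dart → ZMod 2) (hsymm : ∀ a, p a.symm = p a)
    (hbd : ∀ v, chainBoundary p v = (if d.fst = v then 1 else 0) + (if d'.fst = v then 1 else 0))
    (hp : ∀ a, p a ≠ 0 → E.On₂ a.fst → ¬ E.On₂ a.snd)
    (hp' : ∀ a, p a ≠ 0 → E.On₂ a.fst → a.fst = d.fst ∨ a.fst = d'.fst)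
    (hP : ∀ c z, E.IsPotential c z → (∀ a : G.Dart, ¬ E.On₂ a.fst → z a = p a) → c E.f₁ = 0 →
      ∀ a b : G.Dart, ¬ E.On₂ a.fst → b.fst = a.fst → p b ≠ 0 → c (E.face a) = 1 →
        c (E.face a.symm) = 0) :
    ∃ c z, E.IsPotential c z ∧ c E.f₁ = 0 ∧ c E.f₂ = 0 ∧
      (∀ a : G.Dart, ¬ E.On₂ a.fst → z a = p a) ∧ (∀ a, c (E.face a) = 1 → z a = 1) ∧
      ((d = d' ∧ z = p) ∨ (d.snd = d'.fst ∧ z = edgeChain d + p) ∨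
        (d'.snd = d.fst ∧ z = edgeChain d' + p)) := by
  obtain ⟨L, hL, hdL, hinj⟩ := E.exists_period d
  obtain ⟨k₀, hk₀, hkd⟩ := E.swap.walk_eq_of_face hd hd' hL hdL hinj
  change E.walk d k₀ = d' at hkd
  subst hkd
  have hw : E.walk (E.walk d k₀) (L - k₀) = d := by
    rw [E.walk_walk]
    conv_rhs => rw [← hdL]
    congr 1; omega
  obtain ⟨hdL', hinj'⟩ := E.walk_ne_of_period hdL hinj k₀
  -- Either arc of the border between the ends closes `p`. The two potentials add up to one of the
  -- whole border, which separates the faces, so exactly one arc leaves both faces on the same side;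
  -- this arc is `walk g 0, …, walk g (k - 1)`.
  have key : ∃ g k c, E.face g = E.f₂ ∧ E.walk g L = g ∧
      (∀ i j, i < j → j < L → E.walk g i ≠ E.walk g j) ∧ k ≤ L ∧
      (g = d ∧ E.walk g k = E.walk d k₀ ∨ g = E.walk d k₀ ∧ E.walk g k = d) ∧
      E.IsPotential c (E.arcChain g k + p) ∧ c E.f₁ = 0 ∧ c E.f₂ = 0 := by
    obtain ⟨c, hc, h2⟩ := E.exists_potential E.f₂ (E.arcChain d k₀ + p)
      (fun a => by simp only [Pi.add_apply, E.arcChain_symm, hsymm])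
      (fun v => by
        rw [chainBoundary_add, E.chainBoundary_arcChain, hbd]
        linear_combination CharTwo.add_self_eq_zero (if d.fst = v then (1 : ZMod 2) else 0) +
          CharTwo.add_self_eq_zero (if (E.walk d k₀).fst = v then (1 : ZMod 2) else 0))
    obtain ⟨c', hc', h2'⟩ := E.exists_potential E.f₂ (E.arcChain (E.walk d k₀) (L - k₀) + p)
      (fun a => by simp only [Pi.add_apply, E.arcChain_symm, hsymm])
      (fun v => by
        rw [chainBoundary_add, E.chainBoundary_arcChain, hbd, hw]
        linear_combination CharTwo.add_self_eq_zero (if d.fst = v then (1 : ZMod 2) else 0) +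
          CharTwo.add_self_eq_zero (if (E.walk d k₀).fst = v then (1 : ZMod 2) else 0))
    have hz : E.arcChain d k₀ + p + (E.arcChain (E.walk d k₀) (L - k₀) + p) = E.arcChain d L := by
      rw [show L = k₀ + (L - k₀) by omega, E.arcChain_add, show k₀ + (L - k₀) - k₀ = L - k₀ by omega]
      ext a
      simp only [Pi.add_apply]
      linear_combination CharTwo.add_self_eq_zero (p a)
    have hcc := hc.add hc'
    rw [hz] at hcc
    have h3 : (c + c') E.f₁ = 1 :=
      E.swap.border_potential hd hL hdL hinj hcc
        (show c E.f₂ + c' E.f₂ = 0 by rw [h2, h2', add_zero])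
    rcases zmod_two_eq (c E.f₁) with h1 | h1
    · exact ⟨d, k₀, c, hd, hdL, hinj, hk₀.le, Or.inl ⟨rfl, rfl⟩, hc, h1, h2⟩
    · refine ⟨E.walk d k₀, L - k₀, c', hd', hdL', hinj', by omega, Or.inr ⟨rfl, hw⟩, hc', ?_, h2'⟩
      rw [Pi.add_apply, h1] at h3
      simpa using h3
  clear hdL' hinj' hw hdL hinj
  obtain ⟨g, k, c, hg, hgL, hinj, hkL, hends, hc, h1, h2⟩ := key
  have hon : ∀ i, E.On₂ (E.walk g i).fst := fun i => ⟨_, rfl, by rw [E.face_walk, hg]⟩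
  have harc : ∀ a : G.Dart, ¬ E.On₂ a.fst → E.arcChain g k a = 0 := by
    intro a ha
    refine E.arcChain_eq_zero (fun i _ h => ha (h ▸ hon i)) fun i _ h => ha ?_
    have := hon (i + 1)
    rw [← E.walk_snd, h] at this
    exact this
  have hoff : ∀ a : G.Dart, ¬ E.On₂ a.fst → (E.arcChain g k + p) a = p a := fun a ha => by
    rw [Pi.add_apply, harc a ha, zero_add]
  have hint2 : ∀ a : G.Dart, ¬ E.On₂ a.fst → c (E.face a) = 1 → c (E.face a.symm) = 0 := by
    intro a ha hca
    by_cases hb : ∃ b : G.Dart, b.fst = a.fst ∧ p b ≠ 0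
    · obtain ⟨b, hb, hpb⟩ := hb
      exact hP c _ hc hoff h1 a b ha hb hpb hca
    · push Not at hb
      obtain ⟨a', ha', hf⟩ := E.cover a.fst
      have := hc.eq_of_fst_eq (d := a) (d' := a') ha'.symm
        (fun b hb' => by rw [hoff b (by rw [hb']; exact ha), hb b hb'])
      rw [hca] at this
      rcases hf with hf | hf
      · rw [hf, h1] at this
        exact absurd this (by decide)
      · rw [hf, h2] at this
        exact absurd this (by decide)
  -- No edge has potential 1 on both sides: off the second border by `hP` or for lack of a corner in
  -- a special face, and between two vertices of the border because it has no chords.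
  have hint : ∀ a : G.Dart, c (E.face a) = 1 → c (E.face a.symm) = 0 := by
    intro a ha
    refine (zmod_two_eq _).resolve_right fun ha' => ?_
    by_cases h3 : E.On₂ a.fst
    · by_cases h4 : E.On₂ a.snd
      · rcases E.face_of_on₂ h3 h4 with h5 | h5
        · rw [h5, h2] at ha
          exact absurd ha (by decide)
        · rw [h5, h2] at ha'
          exact absurd ha' (by decide)
      · have := hint2 a.symm h4 ha'
        rw [Dart.symm_symm, ha] at this
        exact absurd this (by decide)
    · have := hint2 a h3 ha
      rw [ha'] at this
      exact absurd this (by decide)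
  have hcz : ∀ a, c (E.face a) = 1 → (E.arcChain g k + p) a = 1 := by
    intro a ha
    rw [← hc a, ha, hint a ha, add_zero]
  -- At an inner vertex of the arc, the dart after `walk g 1` enters the side with potential 1. It
  -- would have to lie on the cycle, but it is not in the arc, and `p` meets the border only at the
  -- ends of the arc.
  have hk : k < 2 := by
    by_contra! hk
    have hz1 : (E.arcChain g k + p) (E.walk g 1) = 1 := by
      have hp0 : p (E.walk g 1) = 0 := by
        by_contra hne
        exact hp _ hne (hon 1) (by rw [E.walk_snd]; exact hon 2)
      rw [Pi.add_apply, hp0, add_zero]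
      refine E.arcChain_eq_one (by omega) (fun j hj h => ?_) fun j _ h => ?_
      · rcases lt_trichotomy j 1 with h3 | h3 | h3
        · exact (hinj _ _ h3 (by omega) h).elim
        · exact h3
        · exact (hinj _ _ h3 (by omega) h.symm).elim
      · refine E.face_symm_ne_f₂ (d := E.walk g 1) (by rw [E.face_walk, hg]) ?_
        rw [← h, E.face_walk, hg]
    have hcg : c (E.face (E.rot (E.walk g 1))) = 1 := by
      rw [hc.face_rot, hz1, E.face_walk, hg, h2, zero_add]
    have h3 := hcz _ hcg
    have hu : ∀ i j, (E.walk g i).fst = (E.walk g j).fst → E.walk g i = E.walk g j := fun i j h =>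
      E.eq_of_face_eq_f₂ (by rw [E.face_walk, hg]) (by rw [E.face_walk, hg]) h
    have ha0 : E.arcChain g k (E.rot (E.walk g 1)) = 0 := by
      refine E.arcChain_eq_zero (fun i _ h => ?_) fun i _ h => ?_
      · have := hu i 1 (by rw [h, E.rot_fst])
        exact E.rot_ne (E.walk g 1) (by rw [← h, this])
      · have h4 := hu (i + 1) 1 (by rw [← E.walk_snd, h]; exact E.rot_fst _)
        rw [E.walk_succ, E.walk_succ] at h4
        have h5 := E.next.injective h4
        rw [h5] at h
        refine E.rot_rot_ne (E.walk g 0).symm ?_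
        rw [E.rot_walk_symm, zero_add, h, Dart.symm_symm]
    have hp0 : p (E.rot (E.walk g 1)) ≠ 0 := by
      rw [Pi.add_apply, ha0, zero_add] at h3
      rw [h3]; decide
    have h4 := hp' _ hp0 (by rw [E.rot_fst]; exact hon 1)
    rw [E.rot_fst] at h4
    have h5 : (E.walk g 1).fst = (E.walk g 0).fst ∨ (E.walk g 1).fst = (E.walk g k).fst := by
      rcases hends with ⟨hg1, hg2⟩ | ⟨hg1, hg2⟩
      · rw [hg2, E.walk_zero]
        rcases h4 with h4 | h4
        · left; rw [h4, hg1]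
        · right; exact h4
      · rw [hg2, E.walk_zero]
        rcases h4 with h4 | h4
        · right; exact h4
        · left; rw [h4, ← hg1]
    rcases h5 with h5 | h5
    · exact hinj 0 1 (by omega) (by omega) (hu 1 0 h5).symm
    · have h6 := hu 1 k h5
      rcases hkL.lt_or_eq with h7 | h7
      · exact hinj 1 k (by omega) h7 h6
      · rw [h7, hgL] at h6
        exact hinj 0 1 (by omega) (by omega) h6.symm
  refine ⟨c, _, hc, h1, h2, hoff, hcz, ?_⟩
  obtain rfl | rfl : k = 0 ∨ k = 1 := by omega
  · left
    refine ⟨?_, by ext a; simp [FaceSystem.arcChain]⟩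
    rcases hends with ⟨hg1, hg2⟩ | ⟨hg1, hg2⟩
    · rw [← hg2, E.walk_zero, hg1]
    · exact hg2.symm.trans hg1
  · right
    have harc1 : E.arcChain g 1 = edgeChain g := by simp [FaceSystem.arcChain]
    rw [harc1]
    rcases hends with ⟨hg1, hg2⟩ | ⟨hg1, hg2⟩
    · left
      refine ⟨?_, by rw [hg1]⟩
      rw [← hg2, ← E.walk_snd, E.walk_zero, hg1]
    · right
      refine ⟨?_, by rw [hg1]⟩
      rw [← hg1]
      conv_rhs => rw [← hg2]
      rw [← E.walk_snd, E.walk_zero]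

end Caps

end PlaneGraph

namespace PlaneGraph

set_option linter.unusedSectionVars false

open SimpleGraph

/-! ### The faces between the borders are triangles and quadrangles -/

section Strips

open scoped Classical

variable {V : Type*} [Fintype V] {G : SimpleGraph V}

/-- Two consecutive edges from a vertex off the second border to this border bound a triangular
face. -/
theorem Bordered.exists_triangle (E : Bordered G) {r : G.Dart} (hu : ¬ E.On₂ r.fst)
    (hw : E.On₂ r.snd) (hw' : E.On₂ (E.rot r).snd) (hf : E.face (E.rot r) ≠ E.f₁) :
    ∃ d, E.face d = E.f₂ ∧ E.rot (E.rot r).symm = d.symm ∧ E.rot d = r.symm := by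
  obtain ⟨d, hd, hfd⟩ := hw
  obtain ⟨d', hd', hfd'⟩ := hw'
  set r' := E.rot r with hr'
  have hru : r'.fst = r.fst := E.rot_fst r
  have hne : r' ≠ r := E.rot_ne r
  have hww : r.snd ≠ r'.snd := fun h => hne (Dart.ext _ _ (Prod.ext hru h.symm))
  have hu2 : ∀ v, E.On₂ v → r.fst ≠ v := fun v hv h => hu (h ▸ hv)
  have hwu : r.fst ≠ r.snd := r.fst_ne_snd
  have hwu' : r.fst ≠ r'.snd := hru ▸ r'.fst_ne_snd
  obtain ⟨d₁, hd₁, hfd₁⟩ := (E.on_or_on r.fst).resolve_right hu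
  -- The path from `r.snd` through `r.fst` to `r'.snd`, to be closed along the second border.
  set p : G.Dart → ZMod 2 := edgeChain r + edgeChain r' with hp
  have hp_ne : ∀ a, p a ≠ 0 → a = r ∨ a = r.symm ∨ a = r' ∨ a = r'.symm := by
    intro a ha
    by_contra! hcon
    refine ha ?_
    rw [hp, Pi.add_apply]
    have h1 : edgeChain r a = 0 := by
      by_contra h
      rcases edgeChain_ne_zero h with h | h
      exacts [hcon.1 h, hcon.2.1 h]
    have h2 : edgeChain r' a = 0 := by
      by_contra h
      rcases edgeChain_ne_zero h with h | h
      exacts [hcon.2.2.1 h, hcon.2.2.2 h]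
    rw [h1, h2, add_zero]
  have hpr : p r = 1 := by
    rw [hp, Pi.add_apply, edgeChain_self, edgeChain_eq_zero hne.symm, add_zero]
    intro h
    exact hwu' (by rw [← h]; rfl)
  have hpr' : p r' = 1 := by
    rw [hp, Pi.add_apply, edgeChain_self, edgeChain_eq_zero hne, zero_add]
    intro h
    exact hwu'.symm (by rw [← h]; rfl)
  -- The only corner at `r.fst` with potential 1 is the one between `r` and `r'`: by `hf`, the first
  -- face lies in another corner, and its potential is 0.
  have hsec : ∀ c z, E.IsPotential c z → (∀ a : G.Dart, ¬ E.On₂ a.fst → z a = p a) →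
      c E.f₁ = 0 → ∀ a : G.Dart, a.fst = r.fst → c (E.face a) = if a = r' then 1 else 0 := by
    intro c z hc hz h1 a ha
    refine hc.sector hne (by rw [hz r hu, hpr]) (by rw [hz _ (by rw [hru]; exact hu), hpr']) ?_ hd₁
      (fun h => hf (by rw [hr', ← h, hfd₁])) (by rw [hfd₁, h1]) ha
    intro b hb hbr hbr'
    rw [hz b (by rw [hb]; exact hu)]
    by_contra hpb
    rcases hp_ne b hpb with h | h | h | h
    · exact hbr h
    · exact hwu.symm (by rw [← hb, h]; rfl)
    · exact hbr' h
    · exact hwu'.symm (by rw [← hb, h]; rfl)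
  obtain ⟨c, z, hc, h1, h2, hz, hcz, hcase⟩ := E.exists_cap hfd hfd' p
    (fun a => by simp only [hp, Pi.add_apply, edgeChain_symm])
    (fun v => by
      rw [hp, chainBoundary_add, chainBoundary_edgeChain, chainBoundary_edgeChain, hd, hd', hru]
      linear_combination CharTwo.add_self_eq_zero (if r.fst = v then (1 : ZMod 2) else 0))
    (by
      intro a ha ha2
      rcases hp_ne a ha with rfl | rfl | rfl | rfl
      · exact (hu ha2).elim
      · exact hu
      · exact (hu (hru ▸ ha2)).elim
      · exact fun h => hu (hru ▸ h))
    (by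
      intro a ha ha2
      rcases hp_ne a ha with rfl | rfl | rfl | rfl
      · exact (hu ha2).elim
      · exact Or.inl hd.symm
      · exact (hu (hru ▸ ha2)).elim
      · exact Or.inr hd'.symm)
    (by
      intro c z hc hz h1 a b ha hba hpb hca
      have hau : a.fst = r.fst := by
        rcases hp_ne b hpb with rfl | rfl | rfl | rfl
        · exact hba.symm
        · exact (ha (hba ▸ (⟨d, hd, hfd⟩ : E.On₂ r.snd))).elim
        · rw [← hba, hru]
        · exact (ha (hba ▸ (⟨d', hd', hfd'⟩ : E.On₂ r'.snd))).elim
      have h3 := hsec c z hc hz h1 a hau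
      have h4 : a = r' := by
        by_contra h
        rw [if_neg h, hca] at h3
        exact one_ne_zero h3
      rw [← E.face_rot, hsec c z hc hz h1 _ (by rw [E.rot_fst, hau]), if_neg]
      rw [h4]
      exact E.rot_ne r')
  have hdd' : d ≠ d' := by
    rintro rfl
    exact hww (hd.symm.trans hd')
  have hcr : c (E.face r') = 1 := by rw [hsec c z hc hz h1 r' hru, if_pos rfl]
  have hcy : c (E.face (E.rot r'.symm)) = 1 := by rw [E.face_rot, Dart.symm_symm, hcr]
  have hyfst : (E.rot r'.symm).fst = r'.snd := E.rot_fst _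
  have hymem : ∀ g : G.Dart, z = edgeChain g + p → ∀ y, c (E.face y) = 1 → y ≠ g →
      y = g.symm ∨ y = r ∨ y = r.symm ∨ y = r' ∨ y = r'.symm := by
    intro g hg y hy hyg
    have h3 := hcz y hy
    rw [hg, Pi.add_apply] at h3
    by_contra! hcon
    have h4 : edgeChain g y = 0 := by
      by_contra h
      rcases edgeChain_ne_zero h with h | h
      exacts [hyg h, hcon.1 h]
    have h5 : p y = 0 := by
      by_contra h
      rcases hp_ne y h with h | h | h | h
      exacts [hcon.2.1 h, hcon.2.2.1 h, hcon.2.2.2.1 h, hcon.2.2.2.2 h]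
    rw [h4, h5] at h3
    exact absurd h3 (by decide)
  have hface2 : ∀ {y g : G.Dart}, E.face g = E.f₂ → c (E.face y) = 1 → y ≠ g := by
    rintro y g hg hy rfl
    rw [hg, h2] at hy
    exact zero_ne_one hy
  rcases hcase with ⟨h, -⟩ | ⟨h, hzd⟩ | ⟨h, hzd⟩
  · exact (hdd' h).elim
  · have hy1 : E.rot r'.symm = d.symm := by
      rcases hymem d hzd _ hcy (hface2 hfd hcy) with h' | h' | h' | h' | h'
      · exact h'
      · exact (hwu' (by rw [← hyfst, h'])).elim
      · exact (hww (by rw [← hyfst, h']; rfl)).elim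
      · exact (hwu' (by rw [← hyfst, h', hru])).elim
      · exact (E.rot_ne _ h').elim
    refine ⟨d, hfd, hy1, ?_⟩
    have hcy2 : c (E.face (E.rot d)) = 1 := by rw [E.face_rot, ← hy1, hcy]
    have hfst2 : (E.rot d).fst = r.snd := by rw [E.rot_fst, hd]
    rcases hymem d hzd _ hcy2 (hface2 hfd hcy2) with h' | h' | h' | h' | h'
    · exact (hww (by rw [← hfst2, h', ← hd', ← h]; rfl)).elim
    · exact (hwu (by rw [← hfst2, h'])).elim
    · exact h'
    · exact (hwu (by rw [← hfst2, h', hru])).elim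
    · exact (hww (by rw [← hfst2, h']; rfl)).elim
  -- With this orientation the dart after `r'.symm` would have to be `d'`, the only other cycle dart
  -- at `r'.snd`. But `d'` has the second face on its left, where the potential is 0.
  · exfalso
    rcases hymem d' hzd _ hcy (hface2 hfd' hcy) with h' | h' | h' | h' | h'
    · exact hww (by rw [← hyfst, h', ← hd, ← h]; rfl)
    · exact hwu' (by rw [← hyfst, h'])
    · exact hww (by rw [← hyfst, h']; rfl)
    · exact hwu' (by rw [← hyfst, h', hru])
    · exact E.rot_ne _ h'

/-- The consecutive edges from two neighboring vertices off the second border to this border bound a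
triangular or a quadrangular face. -/
theorem Bordered.exists_quad (E : Bordered G) {e r : G.Dart} (he : E.face e = E.f₁)
    (ha : ¬ E.On₂ e.fst) (hs : ¬ E.On₂ e.snd) (hb : E.On₂ (E.rot e).snd) (hq : E.On₂ r.snd)
    (hr : E.rot r = e.symm) :
    E.rot (E.rot e).symm = r.symm ∨
      ∃ d, E.face d = E.f₂ ∧ E.rot (E.rot e).symm = d.symm ∧ E.rot d = r.symm := by
  obtain ⟨d, hd, hfd⟩ := hb
  obtain ⟨d', hd', hfd'⟩ := hq
  set t := E.rot e with ht
  have htfst : t.fst = e.fst := E.rot_fst e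
  have hte : t ≠ e := E.rot_ne e
  have hrfst : r.fst = e.snd := by
    rw [← E.rot_fst, hr]; rfl
  have hes : e.fst ≠ e.snd := e.fst_ne_snd
  have hb2 : E.On₂ t.snd := ⟨d, hd, hfd⟩
  have hq2 : E.On₂ r.snd := ⟨d', hd', hfd'⟩
  have hab : e.fst ≠ t.snd := fun h => ha (h ▸ hb2)
  have haq : e.fst ≠ r.snd := fun h => ha (h ▸ hq2)
  have hsb : e.snd ≠ t.snd := fun h => hs (h ▸ hb2)
  have hsq : e.snd ≠ r.snd := fun h => hs (h ▸ hq2)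
  obtain ⟨d₁, hd₁, hfd₁⟩ := (E.on_or_on e.snd).resolve_right hs
  -- The path `t.snd`, `e.fst`, `e.snd`, `r.snd`. Its two inner vertices are off the second border,
  -- and each has one corner on the side with potential 1.
  set p : G.Dart → ZMod 2 := edgeChain t + edgeChain e + edgeChain r with hp
  have hp_ne : ∀ a, p a ≠ 0 →
      a = t ∨ a = t.symm ∨ a = e ∨ a = e.symm ∨ a = r ∨ a = r.symm := by
    intro a ha
    by_contra! hcon
    refine ha ?_
    have h1 : edgeChain t a = 0 := by
      by_contra h
      rcases edgeChain_ne_zero h with h | h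
      exacts [hcon.1 h, hcon.2.1 h]
    have h2 : edgeChain e a = 0 := by
      by_contra h
      rcases edgeChain_ne_zero h with h | h
      exacts [hcon.2.2.1 h, hcon.2.2.2.1 h]
    have h3 : edgeChain r a = 0 := by
      by_contra h
      rcases edgeChain_ne_zero h with h | h
      exacts [hcon.2.2.2.2.1 h, hcon.2.2.2.2.2 h]
    rw [hp, Pi.add_apply, Pi.add_apply, h1, h2, h3, add_zero, add_zero]
  have hne_of_fst : ∀ {a b : G.Dart}, a.fst ≠ b.fst → a ≠ b := fun h h' => h (by rw [h'])
  have hne_of_snd : ∀ {a b : G.Dart}, a.snd ≠ b.snd → a ≠ b := fun h h' => h (by rw [h'])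
  have hpt : p t = 1 := by
    rw [hp, Pi.add_apply, Pi.add_apply, edgeChain_self, edgeChain_eq_zero hte, edgeChain_eq_zero,
      add_zero, add_zero]
    · exact hne_of_fst (by rw [htfst, hrfst]; exact hes)
    · exact hne_of_fst (by rw [hrfst]; exact hsb.symm)
    · exact hne_of_fst hab.symm
  have hpe : p e = 1 := by
    rw [hp, Pi.add_apply, Pi.add_apply, edgeChain_self, edgeChain_eq_zero hte.symm,
      edgeChain_eq_zero, add_zero, zero_add]
    · exact hne_of_fst (by rw [hrfst]; exact hes)
    · exact hne_of_snd haq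
    · exact hne_of_snd hab
  have hpes : p e.symm = 1 := by
    rw [← hpe, hp]
    simp only [Pi.add_apply, edgeChain_symm]
  have hpr : p r = 1 := by
    rw [hp, Pi.add_apply, Pi.add_apply, edgeChain_self, edgeChain_eq_zero (e := t),
      edgeChain_eq_zero (e := e), add_zero, zero_add]
    · exact hne_of_fst (by rw [hrfst]; exact hes.symm)
    · exact hne_of_fst haq.symm
    · exact hne_of_fst (by rw [htfst, hrfst]; exact hes.symm)
    · exact hne_of_snd (by change r.fst ≠ _; rw [hrfst]; exact hsb)
  have hseca : ∀ c z, E.IsPotential c z → (∀ a : G.Dart, ¬ E.On₂ a.fst → z a = p a) →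
      c E.f₁ = 0 → ∀ a : G.Dart, a.fst = e.fst → c (E.face a) = if a = t then 1 else 0 := by
    intro c z hc hz h1 a haf
    refine hc.sector hte (by rw [hz e ha, hpe]) (by rw [hz _ (by rw [htfst]; exact ha), hpt]) ?_ rfl
      hte.symm (by rw [he, h1]) haf
    intro b hb hbr hbr'
    rw [hz b (by rw [hb]; exact ha)]
    by_contra hpb
    rcases hp_ne b hpb with h | h | h | h | h | h
    · exact hbr' h
    · exact hab.symm (by rw [← hb, h]; rfl)
    · exact hbr h
    · exact hes.symm (by rw [← hb, h]; rfl)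
    · exact hes.symm (by rw [← hb, h, hrfst])
    · exact haq.symm (by rw [← hb, h]; rfl)
  have hsecs : ∀ c z, E.IsPotential c z → (∀ a : G.Dart, ¬ E.On₂ a.fst → z a = p a) →
      c E.f₁ = 0 → ∀ a : G.Dart, a.fst = e.snd → c (E.face a) = if a = e.symm then 1 else 0 := by
    intro c z hc hz h1 a haf
    rw [← hr]
    refine hc.sector (E.rot_ne r) (by rw [hz r (by rw [hrfst]; exact hs), hpr])
      (by rw [hr, hz e.symm hs, hpes]) ?_ (hd₁.trans hrfst.symm) ?_ (by rw [hfd₁, h1])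
      (haf.trans hrfst.symm)
    · intro b hb hbr hbr'
      rw [hr] at hbr'
      rw [hrfst] at hb
      rw [hz b (by rw [hb]; exact hs)]
      by_contra hpb
      rcases hp_ne b hpb with h | h | h | h | h | h
      · exact hes (by rw [← hb, h, htfst])
      · exact hsb.symm (by rw [← hb, h]; rfl)
      · exact hes (by rw [← hb, h])
      · exact hbr' h
      · exact hbr h
      · exact hsq.symm (by rw [← hb, h]; rfl)
    · rw [hr]
      intro h
      exact E.face_symm_ne_f₁ he (by rw [← h, hfd₁])
  obtain ⟨c, z, hc, h1, h2, hz, hcz, hcase⟩ := E.exists_cap hfd hfd' p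
    (fun a => by simp only [hp, Pi.add_apply, edgeChain_symm])
    (fun v => by
      rw [hp, chainBoundary_add, chainBoundary_add, chainBoundary_edgeChain,
        chainBoundary_edgeChain, chainBoundary_edgeChain, hd, hd', htfst, hrfst]
      linear_combination CharTwo.add_self_eq_zero (if e.fst = v then (1 : ZMod 2) else 0) +
        CharTwo.add_self_eq_zero (if e.snd = v then (1 : ZMod 2) else 0))
    (by
      intro a hpa ha2
      rcases hp_ne a hpa with rfl | rfl | rfl | rfl | rfl | rfl
      · exact (ha (htfst ▸ ha2)).elim
      · exact fun h => ha (htfst ▸ h)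
      · exact (ha ha2).elim
      · exact (hs ha2).elim
      · exact (hs (hrfst ▸ ha2)).elim
      · exact fun h => hs (hrfst ▸ h))
    (by
      intro a hpa ha2
      rcases hp_ne a hpa with rfl | rfl | rfl | rfl | rfl | rfl
      · exact (ha (htfst ▸ ha2)).elim
      · exact Or.inl hd.symm
      · exact (ha ha2).elim
      · exact (hs ha2).elim
      · exact (hs (hrfst ▸ ha2)).elim
      · exact Or.inr hd'.symm)
    (by
      intro c z hc hz h1 a b hna hba hpb hca
      have hau : a.fst = e.fst ∨ a.fst = e.snd := by
        rcases hp_ne b hpb with rfl | rfl | rfl | rfl | rfl | rfl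
        · exact Or.inl (by rw [← hba, htfst])
        · exact (hna (hba ▸ hb2)).elim
        · exact Or.inl hba.symm
        · exact Or.inr hba.symm
        · exact Or.inr (by rw [← hba, hrfst])
        · exact (hna (hba ▸ hq2)).elim
      rcases hau with hau | hau
      · have h3 := hseca c z hc hz h1 a hau
        have h4 : a = t := by
          by_contra h
          rw [if_neg h, hca] at h3
          exact one_ne_zero h3
        rw [← E.face_rot, hseca c z hc hz h1 _ (by rw [E.rot_fst, hau]), if_neg]
        rw [h4]
        exact E.rot_ne t
      · have h3 := hsecs c z hc hz h1 a hau
        have h4 : a = e.symm := by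
          by_contra h
          rw [if_neg h, hca] at h3
          exact one_ne_zero h3
        rw [← E.face_rot, hsecs c z hc hz h1 _ (by rw [E.rot_fst, hau]), if_neg]
        rw [h4]
        exact E.rot_ne _)
  have hct : c (E.face t) = 1 := by rw [hseca c z hc hz h1 t htfst, if_pos rfl]
  have hcy : c (E.face (E.rot t.symm)) = 1 := by rw [E.face_rot, Dart.symm_symm, hct]
  have hyfst : (E.rot t.symm).fst = t.snd := E.rot_fst _
  have hpmem : ∀ y : G.Dart, E.On₂ y.fst → p y ≠ 0 → y = t.symm ∨ y = r.symm := by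
    intro y hy hpy
    rcases hp_ne y hpy with rfl | rfl | rfl | rfl | rfl | rfl
    · exact (ha (htfst ▸ hy)).elim
    · exact Or.inl rfl
    · exact (ha hy).elim
    · exact (hs hy).elim
    · exact (hs (hrfst ▸ hy)).elim
    · exact Or.inr rfl
  have hymem : ∀ g : G.Dart, E.face g = E.f₂ → z = edgeChain g + p → ∀ y : G.Dart, E.On₂ y.fst →
      c (E.face y) = 1 → y = g.symm ∨ y = t.symm ∨ y = r.symm := by
    intro g hfg hg y hyon hy
    have h3 := hcz y hy
    rw [hg, Pi.add_apply] at h3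
    by_contra! hcon
    have h4 : edgeChain g y = 0 := by
      by_contra h
      rcases edgeChain_ne_zero h with h | h
      · rw [h, hfg, h2] at hy
        exact zero_ne_one hy
      · exact hcon.1 h
    have h5 : p y = 0 := by
      by_contra h
      rcases hpmem y hyon h with h | h
      exacts [hcon.2.1 h, hcon.2.2 h]
    rw [h4, h5] at h3
    exact absurd h3 (by decide)
  have hyon : E.On₂ (E.rot t.symm).fst := by rw [hyfst]; exact hb2
  -- Equal ends give a triangle and one further border edge a quadrangle; the second face on the
  -- left of the border edge excludes one orientation.
  rcases hcase with ⟨-, hzp⟩ | ⟨h, hzd⟩ | ⟨h, hzd⟩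
  · left
    have h3 := hcz _ hcy
    rw [hzp] at h3
    exact (hpmem _ hyon (by rw [h3]; exact one_ne_zero)).resolve_left (E.rot_ne _)
  · exfalso
    have hne : t.snd ≠ r.snd := by
      rw [← hd, ← hd', ← h]
      exact d.fst_ne_snd
    rcases hymem d hfd hzd _ hyon hcy with h' | h' | h'
    · exact hne (by rw [← hyfst, h', ← hd', ← h]; rfl)
    · exact E.rot_ne _ h'
    · exact hne (by rw [← hyfst, h']; rfl)
  · right
    have hne : t.snd ≠ r.snd := by
      rw [← hd, ← hd', ← h]
      exact d'.snd_ne_fst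
    have hy1 : E.rot t.symm = d'.symm := by
      rcases hymem d' hfd' hzd _ hyon hcy with h' | h' | h'
      · exact h'
      · exact (E.rot_ne _ h').elim
      · exact (hne (by rw [← hyfst, h']; rfl)).elim
    refine ⟨d', hfd', hy1, ?_⟩
    have hcy2 : c (E.face (E.rot d')) = 1 := by rw [E.face_rot, ← hy1, hcy]
    have hfst2 : (E.rot d').fst = r.snd := by rw [E.rot_fst, hd']
    rcases hymem d' hfd' hzd _ (by rw [hfst2]; exact hq2) hcy2 with h' | h' | h'
    · exact (hne (by rw [← hfst2, h', ← hd, ← h]; rfl)).elim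
    · exact (hne (by rw [← hfst2, h']; rfl)).elim
    · exact h'

end Strips

end PlaneGraph

namespace PlaneGraph

set_option linter.unusedSectionVars false

open SimpleGraph

/-! ### Configurations forced by the pattern of steps -/

section Ladders

variable {V : Type*} [Fintype V] {G : SimpleGraph V} [DecidableRel G.Adj] {I : Type*}

/-- The cyclic sequence of the edges between the two borders of a strip of triangles and quadrangles.
A vertex of both borders counts as an edge of length zero. -/
structure Ladder (G : SimpleGraph V) [DecidableRel G.Adj] (I : Type*) where
  next : Equiv.Perm I
  a : I → V
  b : I → V
  adj_a : ∀ i, a (next i) ≠ a i → G.Adj (a i) (a (next i))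
  adj_b : ∀ i, b (next i) ≠ b i → G.Adj (b i) (b (next i))
  moves : ∀ i, a (next i) ≠ a i ∨ b (next i) ≠ b i
  rung : ∀ i, a i ≠ b i → G.Adj (a i) (b i)
  a_ne_b : ∀ i j, a i ≠ b i → a i ≠ b j
  b_ne_a : ∀ i j, a i ≠ b i → b i ≠ a j
  moves_of_eq : ∀ i, a i = b i → a (next i) ≠ a i ∧ b (next i) ≠ b i
  moves_of_next_eq : ∀ i, a (next i) = b (next i) → a (next i) ≠ a i ∧ b (next i) ≠ b i
  -- The `k + 1` rungs of a maximal run at a vertex, and its two border edges.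
  degree_a : ∀ i (k : ℕ), a i ≠ b i → a (next.symm i) ≠ a i → (∀ l ≤ k, a ((next ^ l) i) = a i) →
    a ((next ^ (k + 1)) i) ≠ a i → G.degree (a i) = k + 3
  degree_b : ∀ i (k : ℕ), a i ≠ b i → b (next.symm i) ≠ b i → (∀ l ≤ k, b ((next ^ l) i) = b i) →
    b ((next ^ (k + 1)) i) ≠ b i → G.degree (b i) = k + 3
  ne_a : ∀ i (k : ℕ), a (next.symm i) ≠ a i → (∀ l ≤ k, a ((next ^ l) i) = a i) →
    a ((next ^ (k + 1)) i) ≠ a i → a (next.symm i) ≠ a ((next ^ (k + 1)) i)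
  ne_b : ∀ i (k : ℕ), b (next.symm i) ≠ b i → (∀ l ≤ k, b ((next ^ l) i) = b i) →
    b ((next ^ (k + 1)) i) ≠ b i → b (next.symm i) ≠ b ((next ^ (k + 1)) i)

namespace Ladder

variable (R : Ladder G I)

/-- Exchange the two borders. -/
def swap : Ladder G I where
  next := R.next
  a := R.b
  b := R.a
  adj_a := R.adj_b
  adj_b := R.adj_a
  moves i := (R.moves i).symm
  rung i h := (R.rung i h.symm).symm
  a_ne_b i j h := R.b_ne_a i j h.symm
  b_ne_a i j h := R.a_ne_b i j h.symm
  moves_of_eq i h := (R.moves_of_eq i h.symm).symm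
  moves_of_next_eq i h := (R.moves_of_next_eq i h.symm).symm
  degree_a i k h := R.degree_b i k h.symm
  degree_b i k h := R.degree_a i k h.symm
  ne_a := R.ne_b
  ne_b := R.ne_a

theorem ne_of_stay_a {i : I} (h : R.a (R.next i) = R.a i) :
    R.a i ≠ R.b i ∧ R.a (R.next i) ≠ R.b (R.next i) :=
  ⟨fun h' => (R.moves_of_eq i h').1 h, fun h' => (R.moves_of_next_eq i h').1 h⟩

theorem ne_of_stay_b {i : I} (h : R.b (R.next i) = R.b i) :
    R.a i ≠ R.b i ∧ R.a (R.next i) ≠ R.b (R.next i) :=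
  ⟨fun h' => (R.moves_of_eq i h').2 h, fun h' => (R.moves_of_next_eq i h').2 h⟩

/-- A maximal run read backwards is a maximal run that starts at its other end, with the neighbors
before and after exchanged. -/
theorem run_reverse {W : Type*} (N : Equiv.Perm I) (f : I → W) {i : I} {k : ℕ}
    (h : f (N i) ≠ f i) (hk : ∀ l ≤ k, f ((N.symm ^ l) i) = f i)
    (hk' : f ((N.symm ^ (k + 1)) i) ≠ f i) :
    f (N.symm ((N.symm ^ k) i)) ≠ f ((N.symm ^ k) i) ∧
    (∀ l ≤ k, f ((N ^ l) ((N.symm ^ k) i)) = f ((N.symm ^ k) i)) ∧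
    f ((N ^ (k + 1)) ((N.symm ^ k) i)) ≠ f ((N.symm ^ k) i) ∧
    f (N.symm ((N.symm ^ k) i)) = f ((N.symm ^ (k + 1)) i) ∧
    f ((N ^ (k + 1)) ((N.symm ^ k) i)) = f (N i) := by
  have h1 : ∀ l m, (N ^ l) ((N.symm ^ (l + m)) i) = (N.symm ^ m) i := by
    intro l m
    rw [pow_add, Equiv.Perm.mul_apply]
    induction l with
    | zero => rfl
    | succ l ih => rw [pow_succ, Equiv.Perm.mul_apply, pow_succ' N.symm, Equiv.Perm.mul_apply,
        Equiv.apply_symm_apply, ih]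
  have h2 : N.symm ((N.symm ^ k) i) = (N.symm ^ (k + 1)) i := by
    rw [pow_succ', Equiv.Perm.mul_apply]
  have h3 : (N ^ (k + 1)) ((N.symm ^ k) i) = N i := by
    rw [pow_succ', Equiv.Perm.mul_apply]
    congr 1
    exact h1 k 0
  refine ⟨?_, ?_, ?_, by rw [h2], by rw [h3]⟩
  · rw [h2, hk k le_rfl]; exact hk'
  · intro l hl
    obtain ⟨m, rfl⟩ := Nat.exists_eq_add_of_le hl
    rw [h1, hk _ le_rfl, hk _ (by omega)]
  · rw [h3, hk k le_rfl]; exact h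

theorem ne_of_a_run {i : I} {k : ℕ} (h : R.a i ≠ R.b i)
    (hk : ∀ l ≤ k, R.a ((R.next.symm ^ l) i) = R.a i) :
    R.a ((R.next.symm ^ k) i) ≠ R.b ((R.next.symm ^ k) i) := by
  intro h'
  rw [hk k le_rfl] at h'
  exact R.a_ne_b i _ h h'

/-- Reverse the direction of the sequence. -/
def reverse : Ladder G I where
  next := R.next.symm
  a := R.a
  b := R.b
  adj_a i h := by
    have := R.adj_a (R.next.symm i)
    rw [Equiv.apply_symm_apply] at this
    exact (this h.symm).symm
  adj_b i h := by
    have := R.adj_b (R.next.symm i)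
    rw [Equiv.apply_symm_apply] at this
    exact (this h.symm).symm
  moves i := by
    have := R.moves (R.next.symm i)
    rw [Equiv.apply_symm_apply] at this
    exact this.imp Ne.symm Ne.symm
  rung := R.rung
  a_ne_b := R.a_ne_b
  b_ne_a := R.b_ne_a
  moves_of_eq i h := by
    have := R.moves_of_next_eq (R.next.symm i)
    rw [Equiv.apply_symm_apply] at this
    exact (this h).imp Ne.symm Ne.symm
  moves_of_next_eq i h := by
    have := R.moves_of_eq (R.next.symm i)
    rw [Equiv.apply_symm_apply] at this
    exact (this h).imp Ne.symm Ne.symm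
  degree_a i k h h0 hk hk' := by
    obtain ⟨h1, h2, h3, -, -⟩ := run_reverse R.next R.a h0 hk hk'
    rw [← hk k le_rfl]
    exact R.degree_a _ k (R.ne_of_a_run h hk) h1 h2 h3
  degree_b i k h h0 hk hk' := by
    obtain ⟨h1, h2, h3, -, -⟩ := run_reverse R.next R.b h0 hk hk'
    rw [← hk k le_rfl]
    exact R.degree_b _ k (R.swap.ne_of_a_run h.symm hk).symm h1 h2 h3
  ne_a i k h0 hk hk' := by
    obtain ⟨h1, h2, h3, h4, h5⟩ := run_reverse R.next R.a h0 hk hk'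
    have := R.ne_a _ k h1 h2 h3
    rw [h4, h5] at this
    exact this.symm
  ne_b i k h0 hk hk' := by
    obtain ⟨h1, h2, h3, h4, h5⟩ := run_reverse R.next R.b h0 hk hk'
    have := R.ne_b _ k h1 h2 h3
    rw [h4, h5] at this
    exact this.symm

variable {R}

theorem degree_a_eq_three {i j : I} (hij : R.next i = j) (hne : R.a j ≠ R.b j)
    (h : R.a i ≠ R.a j) (h' : R.a (R.next j) ≠ R.a j) :
    G.degree (R.a j) = 3 ∧ R.a i ≠ R.a (R.next j) := by
  subst hij
  have h1 : R.next.symm (R.next i) = i := R.next.symm_apply_apply i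
  have h2 : ∀ l ≤ 0, R.a ((R.next ^ l) (R.next i)) = R.a (R.next i) := by
    intro l hl
    obtain rfl := Nat.le_zero.1 hl
    rfl
  have h3 := R.degree_a (R.next i) 0 hne (by rwa [h1]) h2 (by simpa using h')
  have h4 := R.ne_a (R.next i) 0 (by rwa [h1]) h2 (by simpa using h')
  exact ⟨h3, by simpa [h1] using h4⟩

theorem degree_a_eq_four {i j k : I} (hij : R.next i = j) (hjk : R.next j = k)
    (hne : R.a j ≠ R.b j) (h : R.a i ≠ R.a j) (h1 : R.a k = R.a j)
    (h' : R.a (R.next k) ≠ R.a k) :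
    G.degree (R.a j) = 4 ∧ R.a i ≠ R.a (R.next k) := by
  subst hij hjk
  have e1 : R.next.symm (R.next i) = i := R.next.symm_apply_apply i
  have h2 : ∀ l ≤ 1, R.a ((R.next ^ l) (R.next i)) = R.a (R.next i) := by
    intro l hl
    interval_cases l
    · rfl
    · exact h1
  have h' : R.a ((R.next ^ 2) (R.next i)) ≠ R.a (R.next i) := by
    rw [← h1]; exact h'
  have h3 := R.degree_a (R.next i) 1 hne (by rwa [e1]) h2 h'
  have h4 := R.ne_a (R.next i) 1 (by rwa [e1]) h2 h'
  exact ⟨h3, by rw [e1] at h4; exact h4⟩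

theorem degree_a_eq_five {i j k m : I} (hij : R.next i = j) (hjk : R.next j = k)
    (hkm : R.next k = m) (hne : R.a j ≠ R.b j) (h : R.a i ≠ R.a j) (h1 : R.a k = R.a j)
    (h1' : R.a m = R.a k) (h' : R.a (R.next m) ≠ R.a m) :
    G.degree (R.a j) = 5 ∧ R.a i ≠ R.a (R.next m) := by
  subst hij hjk hkm
  have e1 : R.next.symm (R.next i) = i := R.next.symm_apply_apply i
  have h2 : ∀ l ≤ 2, R.a ((R.next ^ l) (R.next i)) = R.a (R.next i) := by
    intro l hl
    interval_cases l
    · rfl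
    · exact h1
    · exact h1'.trans h1
  have h' : R.a ((R.next ^ 3) (R.next i)) ≠ R.a (R.next i) := by
    rw [← h1, ← h1']; exact h'
  have h3 := R.degree_a (R.next i) 2 hne (by rwa [e1]) h2 h'
  have h4 := R.ne_a (R.next i) 2 (by rwa [e1]) h2 h'
  exact ⟨h3, by rw [e1] at h4; exact h4⟩

variable (G) in
/-- One of the configurations that occur in graphs of minimum degree at least 3. -/
def HasConfig : Prop := ConfigD G ∨ ConfigE G ∨ ConfigF G ∨ ConfigG G ∨ ConfigH G

theorem hasConfig_of_triangle {x y z : V} (hxy : G.Adj x y) (hyz : G.Adj y z) (hzx : G.Adj z x)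
    (hy : G.degree y = 3) (hz : G.degree z = 3) : HasConfig G :=
  Or.inr (Or.inl ⟨x, y, z, ⟨hxy, hyz, hzx⟩, hy, hz⟩)

theorem hasConfig_of_odd {v x y : V} (hv : G.degree v = 3) (hx : G.Adj v x) (hy : G.Adj v y)
    (hxy : x ≠ y) (hx' : Odd (G.degree x)) (hy' : Odd (G.degree y)) : HasConfig G :=
  Or.inl ⟨v, x, y, hv, hx, hy, hxy, hx', hy'⟩

/-- The end of a run of the first border before two steps of this border. -/
theorem hasConfig_or_degree_of_two_steps {i : I} (h0 : R.b (R.next i) = R.b i)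
    (h1 : R.b (R.next (R.next i)) = R.b (R.next i)) :
    HasConfig G ∨ R.a (R.next.symm i) = R.a i ∧ (G.degree (R.b i) = 5 → G.degree (R.a i) = 4) := by
  have n0 := R.ne_of_stay_b h0
  have n1 := R.ne_of_stay_b h1
  have m0 : R.a (R.next i) ≠ R.a i := (R.moves i).resolve_right (not_not.2 h0)
  have m1 : R.a (R.next (R.next i)) ≠ R.a (R.next i) := (R.moves _).resolve_right (not_not.2 h1)
  have d1 := (degree_a_eq_three (R := R) rfl n0.2 m0.symm m1).1
  set j := R.next.symm i with hj
  have hji : R.next j = i := R.next.apply_symm_apply i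
  have ac1 : G.Adj (R.a (R.next i)) (R.b i) := h0 ▸ R.rung _ n0.2
  -- Follow the run at `a i` backwards. One rung makes `a i` and the next vertex adjacent 3-vertices
  -- in a triangle with `b i`; two rungs mean degree 4; three mean degree 5, so that the next vertex
  -- has two odd neighbors if `b i` has degree 5; a longer run has two consecutive 3-vertices
  -- opposite to it.
  by_cases hs : R.a j = R.a i
  swap
  · left
    have d0 := (degree_a_eq_three hji n0.1 hs m0).1
    exact hasConfig_of_triangle (R.rung i n0.1).symm (R.adj_a i m0) ac1 d0 d1
  have nj := R.ne_of_stay_a (i := j) (by rw [hji, hs])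
  have bj : R.b i ≠ R.b j := by
    have := (R.moves j).resolve_left (by rw [hji, hs]; simp)
    rwa [hji] at this
  set l := R.next.symm j with hl
  have hlj : R.next l = j := R.next.apply_symm_apply j
  by_cases hs' : R.a l = R.a j
  swap
  · right
    have := (degree_a_eq_four hlj hji nj.1 hs' hs.symm m0).1
    rw [hs] at this
    exact ⟨hs, fun _ => this⟩
  have nl := R.ne_of_stay_a (i := l) (by rw [hlj, hs'])
  have bl : R.b j ≠ R.b l := by
    have := (R.moves l).resolve_left (by rw [hlj, hs']; simp)
    rwa [hlj] at this
  set m := R.next.symm l with hm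
  have hml : R.next m = l := R.next.apply_symm_apply l
  by_cases hs'' : R.a m = R.a l
  swap
  · have d0 := (degree_a_eq_five hml hlj hji nl.1 hs'' hs'.symm hs.symm m0).1
    rw [hs', hs] at d0
    by_cases hd5 : G.degree (R.b i) = 5
    · left
      exact hasConfig_of_odd d1 (R.adj_a i m0).symm ac1 n0.1 (by rw [d0]; decide)
        (by rw [hd5]; decide)
    · exact Or.inr ⟨hs, fun h => (hd5 h).elim⟩
  have bm : R.b l ≠ R.b m := by
    have := (R.moves m).resolve_left (by rw [hml, hs'']; simp)
    rwa [hml] at this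
  left
  have d2 := (degree_a_eq_three (R := R.swap) (i := m) (j := l) hml nl.1.symm bm.symm
    (by change R.b (R.next l) ≠ R.b l; rw [hlj]; exact bl)).1
  have d3 := (degree_a_eq_three (R := R.swap) (i := l) (j := j) hlj nj.1.symm bl.symm
    (by change R.b (R.next j) ≠ R.b j; rw [hji]; exact bj)).1
  have adjlj : G.Adj (R.b l) (R.b j) := by
    have := R.adj_b l
    rw [hlj] at this
    exact this bl
  refine hasConfig_of_triangle (x := R.a j) ?_ adjlj (R.rung j nj.1).symm d2 d3
  rw [← hs']
  exact R.rung l nl.1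

/-- Two consecutive steps on the same border lead to a configuration. -/
theorem hasConfig_of_two_steps {i : I} (h0 : R.b (R.next i) = R.b i)
    (h1 : R.b (R.next (R.next i)) = R.b (R.next i)) : HasConfig G := by
  by_contra hcon
  obtain ⟨hp, hp4⟩ := (hasConfig_or_degree_of_two_steps h0 h1).resolve_left hcon
  -- The same analysis beyond the other end of the two steps, by reversal.
  obtain ⟨hs, hs4⟩ := (hasConfig_or_degree_of_two_steps (R := R.reverse)
    (i := R.next (R.next i))
    (by change R.b (R.next.symm _) = _; rw [Equiv.symm_apply_apply]; exact h1.symm)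
    (by
      change R.b (R.next.symm (R.next.symm _)) = R.b (R.next.symm _)
      rw [Equiv.symm_apply_apply, Equiv.symm_apply_apply, h0])).resolve_left hcon
  change R.a (R.next (R.next (R.next i))) = R.a (R.next (R.next i)) at hs
  change G.degree (R.b _) = 5 → G.degree (R.a _) = 4 at hs4
  have n0 := R.ne_of_stay_b h0
  have n1 := R.ne_of_stay_b h1
  have m0 : R.a (R.next i) ≠ R.a i := (R.moves i).resolve_right (not_not.2 h0)
  have m1 : R.a (R.next (R.next i)) ≠ R.a (R.next i) := (R.moves _).resolve_right (not_not.2 h1)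
  obtain ⟨d1, e1⟩ := degree_a_eq_three (R := R) rfl n0.2 m0.symm m1
  set j := R.next.symm i with hj
  have hji : R.next j = i := R.next.apply_symm_apply i
  have nj := R.ne_of_stay_a (i := j) (by rw [hji, hp])
  have n2 := R.ne_of_stay_a hs
  have bj : R.b i ≠ R.b j := by
    have := (R.moves j).resolve_left (by rw [hji, hp]; simp)
    rwa [hji] at this
  have b2 : R.b (R.next (R.next (R.next i))) ≠ R.b (R.next (R.next i)) :=
    (R.moves _).resolve_left (not_not.2 hs)
  -- The first end rests just before and just after, so the run at `b i` has exactly three rungs.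
  -- Degree 5 then forces degree 4 at the outer vertices, which completes the fan.
  obtain ⟨d5, e5⟩ := degree_a_eq_five (R := R.swap) (i := j) (j := i) hji rfl rfl n0.1.symm bj.symm
    h0 h1 b2
  change G.degree (R.b i) = 5 at d5
  change R.b j ≠ R.b (R.next (R.next (R.next i))) at e5
  have dx := hp4 d5
  have dz := hs4 (by rw [h1, h0]; exact d5)
  have bb : R.b (R.next (R.next i)) = R.b i := h1.trans h0
  have adjbj : G.Adj (R.b j) (R.b i) := by
    have := R.adj_b j
    rw [hji] at this
    exact this bj
  have adjb2 := R.adj_b _ b2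
  rw [bb] at adjb2
  have r1 := R.rung _ n0.2
  rw [h0] at r1
  have r2 := R.rung _ n1.2
  rw [bb] at r2
  have rj := R.rung _ nj.1
  rw [hp] at rj
  have r3 := R.rung _ n2.2
  rw [hs] at r3
  refine hcon (Or.inr (Or.inr (Or.inr (Or.inr ⟨R.b i, R.b j, R.a i, R.a (R.next i),
    R.a (R.next (R.next i)), R.b (R.next (R.next (R.next i))), ?_, rj.symm, R.adj_a _ m0,
    R.adj_a _ m1, r3, adjbj.symm, (R.rung i n0.1).symm, r1.symm, r2.symm, adjb2, d5, dx, dz, d1⟩))))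
  simp only [List.nodup_cons, List.mem_cons, List.not_mem_nil, or_false, not_or, not_false_eq_true,
    List.nodup_nil, and_true]
  exact ⟨⟨rj.ne.symm, R.b_ne_a _ _ nj.1, R.b_ne_a _ _ nj.1, e5⟩, ⟨m0.symm, e1, R.a_ne_b _ _ n0.1⟩,
    ⟨m1.symm, R.a_ne_b _ _ n0.2⟩, r3.ne⟩

/-- Two consecutive quadrangles lead to a configuration. -/
theorem hasConfig_of_two_quads {i : I} (hne : R.a (R.next i) ≠ R.b (R.next i))
    (ha0 : R.a (R.next i) ≠ R.a i) (hb0 : R.b (R.next i) ≠ R.b i)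
    (ha1 : R.a (R.next (R.next i)) ≠ R.a (R.next i))
    (hb1 : R.b (R.next (R.next i)) ≠ R.b (R.next i)) : HasConfig G := by
  have da := (degree_a_eq_three (R := R) rfl hne ha0.symm ha1).1
  have db := (degree_a_eq_three (R := R.swap) (i := i) rfl hne.symm hb0.symm hb1).1
  change G.degree (R.b (R.next i)) = 3 at db
  have r1 := R.rung _ hne
  have adja := R.adj_a _ ha1
  have adjb := R.adj_b _ hb1
  -- The common rung of the quadrangles joins two 3-vertices. If the second quadrangle degenerates
  -- to a triangle these already suffice; otherwise the border that moves next contains another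
  -- 3-vertex.
  by_cases h2 : R.a (R.next (R.next i)) = R.b (R.next (R.next i))
  · rw [h2] at adja
    exact hasConfig_of_triangle adja.symm r1 adjb da db
  rcases R.moves (R.next (R.next i)) with h3 | h3
  · have d2 := (degree_a_eq_three (R := R) rfl h2 ha1.symm h3).1
    exact hasConfig_of_odd da r1 adja (R.b_ne_a _ _ hne) (by rw [db]; decide) (by rw [d2]; decide)
  · have d2 := (degree_a_eq_three (R := R.swap) (i := R.next i) rfl (Ne.symm h2) hb1.symm h3).1
    change G.degree (R.b (R.next (R.next i))) = 3 at d2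
    exact hasConfig_of_odd db r1.symm adjb (R.a_ne_b _ _ hne) (by rw [da]; decide)
      (by rw [d2]; decide)

/-- A quadrangle followed by a step on the first border leads to a configuration. -/
theorem hasConfig_of_quad_step {i : I} (ha0 : R.a (R.next i) ≠ R.a i)
    (hb0 : R.b (R.next i) ≠ R.b i) (hb1 : R.b (R.next (R.next i)) = R.b (R.next i)) :
    HasConfig G := by
  by_contra hcon
  set r1 := R.next i with hr1
  set r2 := R.next r1 with hr2
  set r3 := R.next r2 with hr3
  set r4 := R.next r3 with hr4
  have n1 := R.ne_of_stay_b hb1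
  have ha1 : R.a r2 ≠ R.a r1 := (R.moves r1).resolve_right (not_not.2 hb1)
  have d1 := (degree_a_eq_three hr1.symm n1.1 ha0.symm ha1).1
  have hb2 : R.b r3 ≠ R.b r2 := fun h => hcon (hasConfig_of_two_steps hb1 h)
  have db1 := (degree_a_eq_four (R := R.swap) hr1.symm hr2.symm n1.1.symm hb0.symm hb1 hb2).1
  change G.degree (R.b r1) = 4 at db1
  have rung1 := R.rung _ n1.1
  have rung2 := R.rung _ n1.2
  rw [← hr2, hb1] at rung2
  have adja1 := R.adj_a _ ha1
  -- Moving on at once would make `a r1` and `a r2` 3-vertices in a triangle with `b r1`.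
  have ha2 : R.a r3 = R.a r2 := by
    by_contra h
    have d2 := (degree_a_eq_three (R := R) hr2.symm n1.2 ha1.symm h).1
    exact hcon (hasConfig_of_triangle rung1.symm adja1 rung2 d1 d2)
  have n2 := R.ne_of_stay_a ha2
  have ha3 : R.a r4 ≠ R.a r3 := fun h => hcon (hasConfig_of_two_steps (R := R.swap) ha2 h)
  obtain ⟨d2, e2⟩ := degree_a_eq_four hr2.symm hr3.symm n1.2 ha1.symm ha2 ha3
  have rung3 := R.rung _ n2.2
  rw [← hr3, ha2] at rung3
  have adjb2 := R.adj_b _ hb2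
  rw [← hr3, hb1] at adjb2
  -- Now `b r1` and `a r2` have degree 4 and `a r1` has degree 3. If `b r3` has two rungs, three
  -- triangles around `a r2` form configuration 7; if it has one, its degree 3 is odd and
  -- configuration 6 arises.
  by_cases hb3 : R.b r4 = R.b r3
  · have n3 := R.ne_of_stay_b hb3
    have hb4 : R.b (R.next r4) ≠ R.b r4 := fun h => hcon (hasConfig_of_two_steps hb3 h)
    have db3 := (degree_a_eq_four (R := R.swap) hr3.symm hr4.symm n2.2.symm hb2.symm hb3 hb4).1
    change G.degree (R.b r3) = 4 at db3
    have rung4 := R.rung _ n3.2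
    rw [← hr4, hb3] at rung4
    have adja3 := R.adj_a _ ha3
    rw [← hr4, ha2] at adja3
    exact hcon (Or.inr (Or.inr (Or.inr (Or.inl ⟨R.a r2, R.b r1, R.b r3, R.a r1, R.a r4,
      ⟨rung2, adjb2, rung3.symm⟩, ⟨rung1, rung2.symm, adja1.symm⟩,
      ⟨adja3.symm, rung3, rung4.symm⟩, R.a_ne_b _ _ n1.1, (R.b_ne_a _ _ n1.1).symm, e2, d2, db1,
      db3, d1⟩))))
  · have db3 := (degree_a_eq_three (R := R.swap) hr3.symm n2.2.symm hb2.symm hb3).1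
    change G.degree (R.b r3) = 3 at db3
    exact hcon (Or.inr (Or.inr (Or.inl ⟨R.a r1, R.b r3, R.b r1, R.a r2, R.a_ne_b _ _ n1.1,
      ⟨rung1, rung2.symm, adja1.symm⟩, ⟨adjb2.symm, rung2.symm, rung3⟩, db1, d2, d1,
      by rw [db3]; decide⟩)))

/-- A quadrangle that ends with an edge of positive length leads to a configuration. -/
theorem hasConfig_of_quad {i : I} (hne : R.a (R.next i) ≠ R.b (R.next i))
    (ha0 : R.a (R.next i) ≠ R.a i) (hb0 : R.b (R.next i) ≠ R.b i) : HasConfig G := by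
  by_cases ha1 : R.a (R.next (R.next i)) = R.a (R.next i)
  · exact hasConfig_of_quad_step (R := R.swap) hb0 ha0 ha1
  by_cases hb1 : R.b (R.next (R.next i)) = R.b (R.next i)
  · exact hasConfig_of_quad_step ha0 hb0 hb1
  exact hasConfig_of_two_quads hne ha0 hb0 ha1 hb1

variable (R) in
/-- Without configurations, the steps on the two borders alternate. -/
theorem hasConfig_or_alternating {i : I} (hne : R.a i ≠ R.b i) :
    HasConfig G ∨ R.a (R.next i) ≠ R.b (R.next i) ∧
      (R.a (R.next i) = R.a i ∧ R.b (R.next i) ≠ R.b i ∧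
          R.b (R.next (R.next i)) = R.b (R.next i) ∨
        R.b (R.next i) = R.b i ∧ R.a (R.next i) ≠ R.a i ∧
          R.a (R.next (R.next i)) = R.a (R.next i)) := by
  rw [or_iff_not_imp_left]
  intro hcon
  -- Read backwards, a step of both ends from a rung of positive length is a quadrangle that ends
  -- with such a rung.
  have key : ∀ j, R.a j ≠ R.b j → R.a (R.next j) = R.a j ∨ R.b (R.next j) = R.b j := by
    intro j hj
    by_contra! h
    refine hcon (hasConfig_of_quad (R := R.reverse) (i := R.next j) ?_ ?_ ?_)
    · change R.a (R.next.symm _) ≠ R.b (R.next.symm _)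
      rwa [Equiv.symm_apply_apply]
    · change R.a (R.next.symm _) ≠ R.a _
      rw [Equiv.symm_apply_apply]
      exact h.1.symm
    · change R.b (R.next.symm _) ≠ R.b _
      rw [Equiv.symm_apply_apply]
      exact h.2.symm
  rcases key i hne with h | h
  · have n := R.ne_of_stay_a h
    refine ⟨n.2, Or.inl ⟨h, (R.moves i).resolve_left (not_not.2 h), ?_⟩⟩
    exact (key _ n.2).resolve_left fun h' => hcon (hasConfig_of_two_steps (R := R.swap) h h')
  · have n := R.ne_of_stay_b h
    refine ⟨n.2, Or.inr ⟨h, (R.moves i).resolve_right (not_not.2 h), ?_⟩⟩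
    exact (key _ n.2).resolve_right fun h' => hcon (hasConfig_of_two_steps h h')

end Ladder

end Ladders

end PlaneGraph

namespace PlaneGraph

set_option linter.unusedSectionVars false

open SimpleGraph

/-! ### Alternating steps give an antiprism -/

section Antiprisms

variable {V : Type*} [Fintype V] {G : SimpleGraph V} [DecidableRel G.Adj]

/-- A graph that consists of two periodic sequences of vertices with the adjacencies of an antiprism is
an antiprism. -/
theorem nonempty_iso_graphP {n : ℕ} (hn : n ≠ 0) {u v : ℤ → V}
    (hu : ∀ k x, G.Adj (u k) x ↔ x = u (k - 1) ∨ x = u (k + 1) ∨ x = v k ∨ x = v (k - 1))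
    (hv : ∀ k x, G.Adj (v k) x ↔ x = v (k - 1) ∨ x = v (k + 1) ∨ x = u k ∨ x = u (k + 1))
    (huv : ∀ k l, u k ≠ v l) (huu : ∀ k l, u k = u l ↔ (n : ℤ) ∣ l - k)
    (hvv : ∀ k l, v k = v l ↔ (n : ℤ) ∣ l - k) (hcov : ∀ x, ∃ k, x = u k ∨ x = v k) :
    Nonempty (G ≃g graphP n) := by
  have : NeZero n := ⟨hn⟩
  have huu' : ∀ k l : ℤ, u k = u l ↔ (k : ZMod n) = (l : ZMod n) := fun k l => by
    rw [huu, ZMod.intCast_eq_intCast_iff_dvd_sub]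
  have hvv' : ∀ k l : ℤ, v k = v l ↔ (k : ZMod n) = (l : ZMod n) := fun k l => by
    rw [hvv, ZMod.intCast_eq_intCast_iff_dvd_sub]
  let U : ZMod n → V := fun x => u (x.cast : ℤ)
  -- The shift by one reconciles the labels: here `v k` is joined to `u k` and `u (k + 1)`, in
  -- `graphP` to the indices `k - 1` and `k`.
  let W : ZMod n → V := fun x => v ((x.cast : ℤ) - 1)
  have hU : ∀ k : ℤ, U (k : ZMod n) = u k := fun k => by
    rw [huu']
    simp
  have hW : ∀ k : ℤ, W (k : ZMod n) = v (k - 1) := fun k => by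
    rw [hvv']
    simp
  have hbij : Function.Bijective (Sum.elim U W) := by
    constructor
    · rintro (x | x) (y | y) h <;> obtain ⟨k, rfl⟩ := ZMod.intCast_surjective x <;>
        obtain ⟨l, rfl⟩ := ZMod.intCast_surjective y <;>
        simp only [Sum.elim_inl, Sum.elim_inr, hU, hW] at h
      · rw [(huu' k l).1 h]
      · exact (huv _ _ h).elim
      · exact (huv _ _ h.symm).elim
      · rw [hvv'] at h
        push_cast at h
        rw [sub_left_inj.1 h]
    · intro x
      obtain ⟨k, rfl | rfl⟩ := hcov x
      · exact ⟨Sum.inl k, hU k⟩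
      · refine ⟨Sum.inr ((k + 1 : ℤ) : ZMod n), ?_⟩
        rw [Sum.elim_inr, hW, add_sub_cancel_right]
  refine ⟨RelIso.symm ⟨Equiv.ofBijective _ hbij, ?_⟩⟩
  intro x y
  have hne : G.Adj (Sum.elim U W x) (Sum.elim U W y) → x ≠ y := by
    rintro h rfl
    exact h.ne rfl
  change G.Adj (Sum.elim U W x) (Sum.elim U W y) ↔ _
  rw [graphP, fromRel_adj, ← and_iff_right_of_imp hne]
  refine and_congr_right fun _ => ?_
  rcases x with x | x <;> rcases y with y | y <;> obtain ⟨k, rfl⟩ := ZMod.intCast_surjective x <;>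
    obtain ⟨l, rfl⟩ := ZMod.intCast_surjective y <;>
    simp only [Sum.elim_inl, Sum.elim_inr, hU, hW, hu, hv, huv, fun k l => (huv k l).symm, huu',
      hvv', false_or, or_false] <;> push_cast
  · rw [or_comm, eq_sub_iff_add_eq, @eq_comm _ ((l : ZMod n) + 1)]
  · rw [sub_left_inj, or_comm, sub_eq_iff_eq_add, eq_sub_iff_add_eq, @eq_comm _ ((k : ZMod n) + 1),
      @eq_comm _ (k : ZMod n), or_comm]
  · rw [sub_add_cancel]
  · rw [sub_left_inj, sub_add_cancel, or_comm, eq_sub_iff_add_eq, sub_eq_iff_eq_add,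
      @eq_comm _ (k : ZMod n)]

theorem card_four {α : Type*} [DecidableEq α] {x y z w : α} (hxy : x ≠ y) (hxz : x ≠ z)
    (hxw : x ≠ w) (hyz : y ≠ z) (hyw : y ≠ w) (hzw : z ≠ w) : ({x, y, z, w} : Finset α).card = 4 := by
  rw [Finset.card_insert_of_notMem, Finset.card_insert_of_notMem, Finset.card_pair hzw] <;> simp [*]

namespace Ladder

variable {I : Type*} [Finite I] {R : Ladder G I}

/-- Strict alternation gives every vertex met two rungs and hence degree 4, so its four known
neighbors are all of them. By connectedness the two sequences exhaust the graph, and the sequence of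
rungs closes up periodically. -/
theorem exists_iso_graphP (hG : G.Preconnected) (hcon : ¬ HasConfig G)
    (hinj : ∀ i j, R.a i = R.a j → R.b i = R.b j → i = j) {i : I} (hi : R.a i ≠ R.b i) :
    ∃ n, 3 ≤ n ∧ Nonempty (G ≃g graphP n) := by
  classical
  have hback : ∀ i, R.a i ≠ R.b i → R.a (R.next.symm i) ≠ R.b (R.next.symm i) := fun i h =>
    ((hasConfig_or_alternating R.reverse h).resolve_left hcon).1
  let A : I → Prop := fun i =>
    R.a i ≠ R.b i ∧ R.b (R.next i) = R.b i ∧ R.a (R.next i) ≠ R.a i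
  let B : I → Prop := fun i =>
    R.a i ≠ R.b i ∧ R.a (R.next i) = R.a i ∧ R.b (R.next i) ≠ R.b i
  have hAB : ∀ i, A i → B i → False := fun i h h' => h.2.2 h'.2.1
  have hor : ∀ i, R.a i ≠ R.b i → A i ∨ B i := by
    intro i h
    rcases ((hasConfig_or_alternating R h).resolve_left hcon).2 with h' | h'
    · exact Or.inr ⟨h, h'.1, h'.2.1⟩
    · exact Or.inl ⟨h, h'.1, h'.2.1⟩
  have hA : ∀ i, A i → B (R.next i) := by
    intro i h
    obtain ⟨h1, h2⟩ := (hasConfig_or_alternating R h.1).resolve_left hcon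
    have h3 := (h2.resolve_left fun h' => h.2.2 h'.1).2.2
    exact (hor _ h1).resolve_left fun h' => h'.2.2 h3
  have hB : ∀ i, B i → A (R.next i) := by
    intro i h
    obtain ⟨h1, h2⟩ := (hasConfig_or_alternating R h.1).resolve_left hcon
    have h3 := (h2.resolve_right fun h' => h.2.2 h'.1).2.2
    exact (hor _ h1).resolve_right fun h' => h'.2.2 h3
  have hA' : ∀ i, A i → B (R.next.symm i) := by
    intro i h
    refine (hor _ (hback i h.1)).resolve_left fun h' => ?_
    have := hA _ h'
    rw [Equiv.apply_symm_apply] at this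
    exact hAB i h this
  have hB' : ∀ i, B i → A (R.next.symm i) := by
    intro i h
    refine (hor _ (hback i h.1)).resolve_right fun h' => ?_
    have := hB _ h'
    rw [Equiv.apply_symm_apply] at this
    exact hAB i this h
  obtain ⟨i₀, h₀⟩ : ∃ i, A i := (hor i hi).elim (fun h => ⟨i, h⟩) fun h => ⟨_, hB i h⟩
  -- Two steps advance both borders by one vertex. The rungs `e k` precede steps on the first
  -- border, the rungs `R.next (e k)` steps on the second.
  let M : Equiv.Perm I := R.next * R.next
  let e : ℤ → I := fun k => (M ^ k) i₀
  have he1 : ∀ k, e (k + 1) = R.next (R.next (e k)) := fun k => by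
    change (M ^ (k + 1)) i₀ = _
    rw [add_comm, zpow_add, zpow_one]
    rfl
  have he1' : ∀ k, e (k - 1) = R.next.symm (R.next.symm (e k)) := fun k => by
    rw [Equiv.eq_symm_apply, Equiv.eq_symm_apply, ← he1, sub_add_cancel]
  have heA : ∀ k, A (e k) := by
    intro k
    induction k using Int.induction_on with
    | zero => exact h₀
    | succ k ih => rw [he1]; exact hB _ (hA _ ih)
    | pred k ih => rw [he1']; exact hB' _ (hA' _ ih)
  set u : ℤ → V := fun k => R.a (e k) with hu
  set v : ℤ → V := fun k => R.b (e k) with hv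
  have hfB : ∀ k, B (R.next (e k)) := fun k => hA _ (heA k)
  have haf : ∀ k, R.a (R.next (e k)) = u (k + 1) := fun k => by
    rw [hu]
    change _ = R.a (e (k + 1))
    rw [he1]
    exact (hfB k).2.1.symm
  have hbf : ∀ k, R.b (R.next (e k)) = v k := fun k => (heA k).2.1
  have huv : ∀ k l, u k ≠ v l := fun k l => R.a_ne_b _ _ (heA k).1
  have u1 : ∀ k, u (k + 1) ≠ u k := fun k => by rw [← haf]; exact (heA k).2.2
  have v1 : ∀ k, v (k + 1) ≠ v k := fun k => by
    rw [← hbf k]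
    change R.b (e (k + 1)) ≠ _
    rw [he1]
    exact (hfB k).2.2
  have auu : ∀ k, G.Adj (u k) (u (k + 1)) := fun k => by
    rw [← haf]; exact R.adj_a _ (heA k).2.2
  have avv : ∀ k, G.Adj (v k) (v (k + 1)) := fun k => by
    rw [← hbf k]
    change G.Adj _ (R.b (e (k + 1)))
    rw [he1]
    exact R.adj_b _ (hfB k).2.2
  have auv : ∀ k, G.Adj (u k) (v k) := fun k => R.rung _ (heA k).1
  have auv' : ∀ k, G.Adj (u (k + 1)) (v k) := fun k => by
    rw [← haf, ← hbf]; exact R.rung _ (hfB k).1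
  have du : ∀ k, G.degree (u (k + 1)) = 4 ∧ u k ≠ u (k + 1 + 1) := fun k => by
    have := degree_a_eq_four (R := R) (i := e k) rfl (he1 k).symm (hfB k).1
      (heA k).2.2.symm (by rw [haf]) (heA (k + 1)).2.2
    rw [haf, haf] at this
    exact this
  have dv : ∀ k, G.degree (v (k + 1)) = 4 ∧ v k ≠ v (k + 1 + 1) := fun k => by
    have := degree_a_eq_four (R := R.swap) (i := R.next (e k)) (he1 k).symm rfl
      (heA (k + 1)).1.symm (by rw [he1]; exact (hfB k).2.2.symm)
      (heA (k + 1)).2.1 (hfB (k + 1)).2.2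
    refine ⟨this.1, ?_⟩
    have h2 := this.2
    change R.b (R.next (e k)) ≠ R.b (R.next (R.next (e (k + 1)))) at h2
    rw [hbf, ← he1] at h2
    exact h2
  have nu : ∀ k x, G.Adj (u k) x ↔ x = u (k - 1) ∨ x = u (k + 1) ∨ x = v k ∨ x = v (k - 1) := by
    intro k x
    obtain ⟨l, rfl⟩ : ∃ l, k = l + 1 := ⟨k - 1, by ring⟩
    rw [add_sub_cancel_right]
    have hsub : ({u l, u (l + 1 + 1), v (l + 1), v l} : Finset V) ⊆ G.neighborFinset (u (l + 1)) := by
      intro y hy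
      rw [mem_neighborFinset]
      simp only [Finset.mem_insert, Finset.mem_singleton] at hy
      rcases hy with rfl | rfl | rfl | rfl
      exacts [(auu l).symm, auu _, auv _, auv' _]
    have hcard : ({u l, u (l + 1 + 1), v (l + 1), v l} : Finset V).card = 4 :=
      card_four (du l).2 (huv _ _) (huv _ _) (huv _ _) (huv _ _) (v1 l)
    have := Finset.eq_of_subset_of_card_le hsub (by
      rw [card_neighborFinset_eq_degree, (du l).1, hcard])
    rw [← mem_neighborFinset, ← this]
    simp only [Finset.mem_insert, Finset.mem_singleton]
  have nv : ∀ k x, G.Adj (v k) x ↔ x = v (k - 1) ∨ x = v (k + 1) ∨ x = u k ∨ x = u (k + 1) := by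
    intro k x
    obtain ⟨l, rfl⟩ : ∃ l, k = l + 1 := ⟨k - 1, by ring⟩
    rw [add_sub_cancel_right]
    have hsub : ({v l, v (l + 1 + 1), u (l + 1), u (l + 1 + 1)} : Finset V) ⊆
        G.neighborFinset (v (l + 1)) := by
      intro y hy
      rw [mem_neighborFinset]
      simp only [Finset.mem_insert, Finset.mem_singleton] at hy
      rcases hy with rfl | rfl | rfl | rfl
      exacts [(avv l).symm, avv _, (auv _).symm, (auv' _).symm]
    have hcard : ({v l, v (l + 1 + 1), u (l + 1), u (l + 1 + 1)} : Finset V).card = 4 :=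
      card_four (dv l).2 (huv _ _).symm (huv _ _).symm (huv _ _).symm (huv _ _).symm (u1 _).symm
    have := Finset.eq_of_subset_of_card_le hsub (by
      rw [card_neighborFinset_eq_degree, (dv l).1, hcard])
    rw [← mem_neighborFinset, ← this]
    simp only [Finset.mem_insert, Finset.mem_singleton]
  have hcov : ∀ x, ∃ k, x = u k ∨ x = v k := by
    intro x
    obtain ⟨p⟩ := (hG (u 0) x).symm
    generalize hy : u 0 = y at p
    have hp : ∃ k, y = u k ∨ y = v k := ⟨0, Or.inl hy.symm⟩
    clear hy
    induction p with
    | nil => exact hp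
    | cons h p ih =>
      obtain ⟨k, rfl | rfl⟩ := ih hp
      · rw [adj_comm, nu] at h
        rcases h with rfl | rfl | rfl | rfl
        exacts [⟨_, Or.inl rfl⟩, ⟨_, Or.inl rfl⟩, ⟨_, Or.inr rfl⟩, ⟨_, Or.inr rfl⟩]
      · rw [adj_comm, nv] at h
        rcases h with rfl | rfl | rfl | rfl
        exacts [⟨_, Or.inr rfl⟩, ⟨_, Or.inr rfl⟩, ⟨_, Or.inl rfl⟩, ⟨_, Or.inl rfl⟩]
  set n := Function.minimalPeriod M i₀ with hn
  have hee : ∀ k l, e k = e l ↔ (n : ℤ) ∣ l - k := by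
    intro k l
    have h1 := MulAction.zpow_smul_eq_iff_minimalPeriod_dvd (a := M) (b := i₀) (n := l - k)
    rw [Equiv.Perm.smul_def] at h1
    change _ ↔ (n : ℤ) ∣ l - k at h1
    rw [← h1, sub_eq_neg_add, zpow_add, Equiv.Perm.mul_apply, zpow_neg, Equiv.Perm.inv_eq_iff_eq,
      eq_comm]
  have huu : ∀ k l, u k = u l ↔ (n : ℤ) ∣ l - k := by
    intro k l
    rw [← hee]
    refine ⟨fun h => ?_, fun h => congrArg R.a h⟩
    -- The vertex `v k` is then a neighbor of `u l` on the other border. Being `v (l - 1)` would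
    -- identify a rung before a step on the first border with one before a step on the second.
    have h1 := auv k
    rw [h, nu] at h1
    rcases h1 with h1 | h1 | h1 | h1
    · exact (huv _ _ h1.symm).elim
    · exact (huv _ _ h1.symm).elim
    · exact hinj _ _ h h1
    · exfalso
      have h2 : e k = R.next (e (l - 1)) := by
        refine hinj _ _ ?_ ?_
        · rw [haf, sub_add_cancel]; exact h
        · rw [hbf]; exact h1
      exact hAB _ (heA k) (h2 ▸ hfB (l - 1))
  have hvv : ∀ k l, v k = v l ↔ (n : ℤ) ∣ l - k := by
    intro k l
    rw [← hee]
    refine ⟨fun h => ?_, fun h => congrArg R.b h⟩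
    have h1 := (auv k).symm
    rw [h, nv] at h1
    rcases h1 with h1 | h1 | h1 | h1
    · exact (huv _ _ h1).elim
    · exact (huv _ _ h1).elim
    · exact hinj _ _ h1 h
    · exfalso
      have h2 : e k = R.next (e l) := by
        refine hinj _ _ ?_ ?_
        · rw [haf]; exact h1
        · rw [hbf]; exact h
      exact hAB _ (heA k) (h2 ▸ hfB l)
  have hn0 : n ≠ 0 := by
    have : i₀ ∈ Function.periodicPts M :=
      Function.mk_mem_periodicPts (orderOf_pos M) (by
        rw [Function.IsPeriodicPt, Function.IsFixedPt, ← Equiv.Perm.coe_pow, pow_orderOf_eq_one]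
        rfl)
    exact (Function.minimalPeriod_pos_of_mem_periodicPts this).ne'
  -- Period 1 would make adjacent vertices equal, and period 2 the two border neighbors of a vertex.
  have hn1 : n ≠ 1 := fun h => u1 0 ((huu _ _).2 (by rw [h]; exact one_dvd _))
  have hn2 : n ≠ 2 := fun h => (du 0).2 ((huu _ _).2 (by rw [h]; norm_num))
  exact ⟨n, by omega, PlaneGraph.nonempty_iso_graphP hn0 nu nv huv huu hvv hcov⟩

end Ladder

end Antiprisms

end PlaneGraph

namespace PlaneGraph

set_option linter.unusedSectionVars false

open SimpleGraph

/-! ### From a rung to the next one -/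

section Steps

variable {V : Type*} [Fintype V] {G : SimpleGraph V}

/-- Without chords the dart would be a border edge, so that `rot e` or `rot (rot e)` would be `e`;
minimum degree 3 excludes this. -/
theorem Bordered.not_on₁_rot_snd (E : Bordered G) {e : G.Dart} (he : E.face e = E.f₁) :
    ¬ E.On₁ (E.rot e).snd := by
  intro h
  rcases E.face_of_on₁ (e := E.rot e) ⟨e, (E.rot_fst e).symm, he⟩ h with h' | h'
  · exact E.rot_ne e (E.eq_of_face_eq_f₁ h' he (E.rot_fst e))
  · refine E.rot_rot_ne e (E.eq_of_face_eq_f₁ ?_ he (by rw [E.rot_fst, E.rot_fst]))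
    rw [E.face_rot, h']

theorem Bordered.not_on₁_of_rot_eq (E : Bordered G) {e r : G.Dart} (he : E.face e = E.f₁)
    (hr : E.rot r = e.symm) : ¬ E.On₁ r.snd := by
  intro h
  have hfst : r.fst = e.snd := by
    rw [← E.rot_fst, hr]; rfl
  rcases E.face_of_on₁ (e := r) (hfst ▸ E.on₁_snd he) h with h' | h'
  · refine E.rot_rot_ne r ?_
    rw [hr]
    refine E.eq_of_face_eq_f₁ ?_ h' (by rw [E.rot_fst, hfst]; rfl)
    rw [E.face_rot, Dart.symm_symm, he]
  · refine E.face_symm_ne_f₁ he ?_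
    rw [← hr, E.face_rot, h']

theorem Bordered.on₂_of_not_on₁ (E : Bordered G) {v : V} (h : ¬ E.On₁ v) : E.On₂ v :=
  (E.on_or_on v).resolve_left h

theorem Bordered.on₁_of_not_on₂ (E : Bordered G) {v : V} (h : ¬ E.On₂ v) : E.On₁ v :=
  (E.on_or_on v).resolve_right h

/-- The pairs of ends of the edges between the two borders, including the edges of length zero. -/
def Bordered.IsRung (E : Bordered G) (p : V × V) : Prop :=
  p.1 = p.2 ∧ E.On₁ p.1 ∧ E.On₂ p.2 ∨ G.Adj p.1 p.2 ∧ ¬ E.On₂ p.1 ∧ ¬ E.On₁ p.2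

theorem Bordered.IsRung.on₁ {E : Bordered G} {p : V × V} (h : E.IsRung p) : E.On₁ p.1 :=
  h.elim (fun h => h.2.1) fun h => E.on₁_of_not_on₂ h.2.1

theorem Bordered.IsRung.on₂ {E : Bordered G} {p : V × V} (h : E.IsRung p) : E.On₂ p.2 :=
  h.elim (fun h => h.2.2) fun h => E.on₂_of_not_on₁ h.2.2

theorem Bordered.IsRung.of_ne {E : Bordered G} {p : V × V} (h : E.IsRung p) (hne : p.1 ≠ p.2) :
    G.Adj p.1 p.2 ∧ ¬ E.On₂ p.1 ∧ ¬ E.On₁ p.2 :=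
  h.resolve_left fun h' => hne h'.1

theorem Bordered.IsRung.swap {E : Bordered G} {p : V × V} (h : E.IsRung p) :
    E.swap.IsRung p.swap :=
  h.imp (fun h => ⟨h.1.symm, h.2.2, h.2.1⟩) fun h => ⟨h.1.symm, h.2.2, h.2.1⟩

/-- A triangular face with one edge on the border of the first face. -/
def Bordered.StepOne (E : Bordered G) (p q : V × V) : Prop :=
  ∃ e r : G.Dart, E.face e = E.f₁ ∧ ¬ E.On₂ e.fst ∧ ¬ E.On₂ e.snd ∧ ¬ E.On₁ r.snd ∧
    E.rot r = e.symm ∧ E.rot (E.rot e).symm = r.symm ∧ p = (e.fst, r.snd) ∧ q = (e.snd, r.snd)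

/-- A quadrangular face, possibly degenerate, with edges on both borders. -/
def Bordered.StepBoth (E : Bordered G) (p q : V × V) : Prop :=
  ∃ e e' : G.Dart, E.face e = E.f₁ ∧ E.face e' = E.f₂ ∧
    (e.fst ≠ e'.snd → (E.rot e).snd = e'.snd ∧ E.rot (E.rot e).symm = e'.symm) ∧
    (e.snd ≠ e'.fst → (E.rot e').snd = e.snd ∧ E.rot (E.rot e').symm = e.symm) ∧
    p = (e.fst, e'.snd) ∧ q = (e.snd, e'.fst)

/-- The pairs `p` and `q` are the two edges between the borders on the boundary of one face. -/
def Bordered.Step (E : Bordered G) (p q : V × V) : Prop :=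
  E.StepOne p q ∨ E.swap.StepOne q.swap p.swap ∨ E.StepBoth p q

/-- Both borders are followed with their face on the left, hence in opposite directions across the
strip. Exchanging them reverses the step. -/
theorem Bordered.Step.swap {E : Bordered G} {p q : V × V} (h : E.Step p q) :
    E.swap.Step q.swap p.swap := by
  rcases h with h | h | ⟨e, e', he, he', h1, h2, rfl, rfl⟩
  · exact Or.inr (Or.inl h)
  · exact Or.inl h
  · exact Or.inr (Or.inr ⟨e', e, he', he, fun h => h2 h.symm, fun h => h1 h.symm, rfl, rfl⟩)

/-- The face ahead of a rung is given by `exists_triangle` or `exists_quad`, with degenerate forms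
at common vertices and common edges of the borders. -/
theorem Bordered.exists_step (E : Bordered G) {p : V × V} (hp : E.IsRung p) :
    ∃ q, E.IsRung q ∧ E.Step p q := by
  obtain ⟨a, b⟩ := p
  have : Nonempty V := ⟨a⟩
  rcases hp with ⟨hab, ha, hb⟩ | ⟨hab, ha, hb⟩ <;> dsimp only at hab ha hb
  · subst hab
    obtain ⟨e, rfl, he⟩ := ha
    by_cases hs : E.On₂ e.snd
    · have he' : E.face e.symm = E.f₂ := (E.face_of_on₂ hb hs).resolve_left
        fun h => E.f₁_ne_f₂ (he.symm.trans h)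
      exact ⟨(e.snd, e.snd), Or.inl ⟨rfl, E.on₁_snd he, hs⟩, Or.inr (Or.inr ⟨e, e.symm, he, he',
        fun h => (h rfl).elim, fun h => (h rfl).elim, rfl, rfl⟩)⟩
    · set r := E.rot.symm e.symm with hrdef
      have hr : E.rot r = e.symm := E.rot.apply_symm_apply _
      have hrfst : r.fst = e.snd := by rw [← E.rot_fst, hr]; rfl
      have hq := E.not_on₁_of_rot_eq he hr
      obtain ⟨d, hd, h1, h2⟩ := E.exists_triangle (r := r) (by rwa [hrfst]) (E.on₂_of_not_on₁ hq)
        (by rw [hr]; exact hb) (by rw [hr]; exact E.face_symm_ne_f₁ he)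
      rw [hr, Dart.symm_symm] at h1
      have hd1 : d.fst = r.snd := by rw [← E.rot_fst, h2]; rfl
      have hd2 : d.snd = e.fst := by
        have : (E.rot e).fst = d.snd := by rw [h1]; rfl
        rw [← this, E.rot_fst]
      refine ⟨(e.snd, r.snd), Or.inr ⟨hrfst ▸ r.adj, hs, hq⟩, Or.inr (Or.inr ⟨e, d, he, hd,
        fun h => (h hd2.symm).elim, fun _ => ⟨?_, ?_⟩, by rw [hd2], by rw [hd1]⟩)⟩
      · rw [h2]; exact hrfst
      · rw [h2, Dart.symm_symm, hr]
  · let t : G.Dart := ⟨(a, b), hab⟩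
    -- The face of the step lies in the corner between `x` and `t`; which borders contain the end of
    -- `x` decides its shape.
    set x := E.rot.symm t with hxdef
    have hx : E.rot x = t := E.rot.apply_symm_apply _
    have hxfst : x.fst = a := by rw [← E.rot_fst, hx]
    have htf : E.face t ≠ E.f₁ := fun h => hb (E.on₁_snd h)
    have hxa : ¬ E.On₂ x.fst := by rwa [hxfst]
    have htsnd : E.On₂ t.snd := E.on₂_of_not_on₁ hb
    by_cases hs : E.On₁ x.snd
    · have he : E.face x = E.f₁ := by
        refine (E.face_of_on₁ (E.on₁_of_not_on₂ hxa) hs).resolve_right fun h => htf ?_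
        rw [← hx, E.face_rot, h]
      by_cases hs2 : E.On₂ x.snd
      · obtain ⟨d, hd, h1, h2⟩ := E.exists_triangle hxa hs2 (by rw [hx]; exact htsnd)
          (by rw [hx]; exact htf)
        have hd1 : d.fst = x.snd := by rw [← E.rot_fst, h2]; rfl
        have hd2 : d.snd = b := by
          have : (E.rot (E.rot x).symm).fst = d.snd := by rw [h1]; rfl
          rw [← this, E.rot_fst, hx]; rfl
        exact ⟨(x.snd, x.snd), Or.inl ⟨rfl, hs, hs2⟩, Or.inr (Or.inr ⟨x, d, he, hd,
          fun _ => ⟨by rw [hx, hd2], h1⟩, fun h => (h hd1.symm).elim, by rw [hxfst, hd2],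
          by rw [hd1]⟩)⟩
      · set r := E.rot.symm x.symm with hrdef
        have hr : E.rot r = x.symm := E.rot.apply_symm_apply _
        have hrfst : r.fst = x.snd := by rw [← E.rot_fst, hr]; rfl
        have hq := E.not_on₁_of_rot_eq he hr
        rcases E.exists_quad he hxa hs2 (by rw [hx]; exact htsnd) (E.on₂_of_not_on₁ hq) hr with
          h1 | ⟨d, hd, h1, h2⟩
        · have hrb : r.snd = b := by
            have : (E.rot (E.rot x).symm).fst = r.snd := by rw [h1]; rfl
            rw [← this, E.rot_fst, hx]; rfl
          refine ⟨(x.snd, b), Or.inr ⟨?_, hs2, hb⟩, Or.inl ⟨x, r, he, hxa, hs2, hq, hr, h1,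
            by rw [hxfst, hrb], by rw [hrb]⟩⟩
          have := r.adj
          rwa [hrfst, hrb] at this
        · have hd1 : d.fst = r.snd := by rw [← E.rot_fst, h2]; rfl
          have hd2 : d.snd = b := by
            have : (E.rot (E.rot x).symm).fst = d.snd := by rw [h1]; rfl
            rw [← this, E.rot_fst, hx]; rfl
          refine ⟨(x.snd, r.snd), Or.inr ⟨hrfst ▸ r.adj, hs2, hq⟩, Or.inr (Or.inr ⟨x, d, he, hd,
            fun _ => ⟨by rw [hx, hd2], h1⟩, fun _ => ⟨?_, ?_⟩, by rw [hxfst, hd2], by rw [hd1]⟩)⟩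
          · rw [h2]; exact hrfst
          · rw [h2, Dart.symm_symm, hr]
    · obtain ⟨d, hd, h1, h2⟩ := E.exists_triangle hxa (E.on₂_of_not_on₁ hs)
        (by rw [hx]; exact htsnd) (by rw [hx]; exact htf)
      rw [hx] at h1
      have hd1 : d.fst = x.snd := by rw [← E.rot_fst, h2]; rfl
      have hd2 : d.snd = b := by
        have : (E.rot t.symm).fst = d.snd := by rw [h1]; rfl
        rw [← this, E.rot_fst]; rfl
      refine ⟨(a, x.snd), Or.inr ⟨hxfst ▸ x.adj, ha, hs⟩, Or.inr (Or.inl ⟨d, t.symm, hd, ?_, ?_, ha,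
        h1, ?_, ?_, ?_⟩)⟩
      · rw [hd1]; exact hs
      · rw [hd2]; exact hb
      · change E.rot (E.rot d).symm = t.symm.symm
        rw [h2, Dart.symm_symm, Dart.symm_symm, hx]
      · rw [hd1]; rfl
      · rw [hd2]; rfl

theorem Bordered.StepOne.rot_eq {E : Bordered G} {e r : G.Dart}
    (h : E.rot (E.rot e).symm = r.symm) {t : G.Dart} (ht : t.toProd = (e.fst, r.snd)) :
    E.rot e = t := by
  refine Dart.ext _ _ (Prod.ext ?_ ?_)
  · rw [E.rot_fst, ht]
  · have : (E.rot (E.rot e).symm).fst = r.snd := by rw [h]; rfl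
    rw [ht, ← this, E.rot_fst]; rfl

open scoped Classical in
-- The right side involves only the rung and the embedding, so it settles uniqueness: an end moves
-- exactly if the other dart at its corner of the face is a border edge.
theorem Bordered.Step.eq_of_dart {E : Bordered G} {p q : V × V} (h : E.Step p q) {t : G.Dart}
    (ht : t.toProd = p) :
    q = (if E.face (E.rot.symm t) = E.f₁ then (E.rot.symm t).snd else p.1,
      if E.face (E.rot t.symm).symm = E.f₂ then (E.rot t.symm).snd else p.2) := by
  rcases h with ⟨e, r, he, h1, h2, h3, h4, h5, rfl, rfl⟩ | ⟨e, r, he, h1, h2, h3, h4, h5, hp, hq⟩ |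
    ⟨e, e', he, he', h1, -, rfl, rfl⟩
  · have het := StepOne.rot_eq h5 ht
    have e1 : E.rot.symm t = e := by rw [← het, Equiv.symm_apply_apply]
    rw [e1, if_pos he]
    rw [het] at h5
    rw [h5, Dart.symm_symm, if_neg]
    intro h
    refine h2 ⟨r, ?_, h⟩
    rw [← E.rot_fst, h4]; rfl
  · change E.face e = E.f₂ at he
    change ¬ E.On₁ e.fst at h1
    change E.rot (E.rot e).symm = r.symm at h5
    change E.rot r = e.symm at h4
    obtain rfl : q = (r.snd, e.fst) := Prod.swap_injective hp
    obtain rfl : p = (r.snd, e.snd) := Prod.swap_injective hq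
    have hrt : t = r.symm := by
      refine Dart.ext _ _ (ht.trans (Prod.ext rfl ?_))
      change e.snd = r.fst
      rw [← E.rot_fst r, h4]; rfl
    have e1 : E.rot.symm t = (E.rot e).symm := by rw [hrt, ← h5, Equiv.symm_apply_apply]
    rw [e1, hrt, Dart.symm_symm, h4, Dart.symm_symm, if_pos he, if_neg]
    · rfl
    · intro h
      refine h1 ?_
      have := E.on₁_snd h
      rwa [show (E.rot e).symm.snd = (E.rot e).fst from rfl, E.rot_fst] at this
  · have hne : e.fst ≠ e'.snd := by
      have := t.fst_ne_snd
      rwa [ht] at this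
    obtain ⟨h2, h3⟩ := h1 hne
    have het : E.rot e = t := by
      refine Dart.ext _ _ (Prod.ext ?_ ?_)
      · rw [E.rot_fst, ht]
      · rw [h2, ht]
    have e1 : E.rot.symm t = e := by rw [← het, Equiv.symm_apply_apply]
    rw [het] at h3
    rw [e1, if_pos he, h3, Dart.symm_symm, if_pos he']
    rfl

theorem Bordered.Step.both_of_eq {E : Bordered G} {p q : V × V} (h : E.Step p q)
    (hp : p.1 = p.2) : E.StepBoth p q := by
  rcases h with ⟨e, r, he, h1, h2, h3, h4, h5, rfl, rfl⟩ | ⟨e, r, he, h1, h2, h3, h4, h5, hp', hq⟩ | h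
  · dsimp only at hp
    exact (h3 (hp ▸ ⟨e, rfl, he⟩)).elim
  · obtain rfl : p = (r.snd, e.snd) := Prod.swap_injective hq
    dsimp only at hp
    exact (h3 (hp.symm ▸ E.on₂_snd he)).elim
  · exact h

theorem Bordered.Step.unique {E : Bordered G} {p q q' : V × V} (hp : E.IsRung p) (h : E.Step p q)
    (h' : E.Step p q') : q = q' := by
  by_cases hne : p.1 = p.2
  · obtain ⟨e, e', he, he', -, -, rfl, rfl⟩ := h.both_of_eq hne
    obtain ⟨d, d', hd, hd', -, -, h1, rfl⟩ := h'.both_of_eq hne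
    rw [Prod.mk.injEq] at h1
    obtain rfl := E.eq_of_face_eq_f₁ he hd h1.1
    have : E.next e' = E.next d' := by
      refine E.eq_of_face_eq_f₂ ?_ ?_ ?_
      · rw [E.face_apply_next, he']
      · rw [E.face_apply_next, hd']
      · rw [E.next_fst, E.next_fst, h1.2]
    rw [E.next.injective this]
  · let t : G.Dart := ⟨p, (hp.of_ne hne).1⟩
    rw [h.eq_of_dart (t := t) rfl, h'.eq_of_dart (t := t) rfl]

/-- Together with `enter` and `exit` this describes the clockwise order at a vertex off the second
border: the outgoing border edge, the rungs in reverse order, the incoming border edge. -/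
theorem Bordered.Step.stay {E : Bordered G} {p q : V × V} (h : E.Step p q) (hq : q.1 = p.1)
    {t : G.Dart} (ht : t.toProd = q) : (E.rot t).toProd = p := by
  rcases h with ⟨e, r, -, -, -, -, -, -, rfl, rfl⟩ | ⟨e, r, he, h1, h2, h3, h4, h5, hq', hp⟩ |
    ⟨e, e', -, -, -, -, rfl, rfl⟩
  · exact (e.snd_ne_fst hq).elim
  · obtain rfl : q = (r.snd, e.fst) := Prod.swap_injective hq'
    obtain rfl : p = (r.snd, e.snd) := Prod.swap_injective hp
    have het : E.rot e = t.symm :=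
      StepOne.rot_eq (E := E.swap) h5 (t := t.symm) (by
        rw [Dart.symm]
        simp [ht])
    change E.rot (E.rot e).symm = r.symm at h5
    rw [het, Dart.symm_symm] at h5
    rw [h5]
    refine Prod.ext rfl ?_
    change r.fst = e.snd
    change E.rot r = e.symm at h4
    rw [← E.rot_fst r, h4]; rfl
  · exact (e.snd_ne_fst hq).elim

theorem Bordered.Step.enter {E : Bordered G} {p q : V × V} (h : E.Step p q) (hq : q.1 ≠ p.1)
    {t : G.Dart} (ht : t.toProd = q) :
    ∃ e : G.Dart, E.face e = E.f₁ ∧ e.toProd = (p.1, q.1) ∧ E.rot t = e.symm := by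
  rcases h with ⟨e, r, he, -, -, -, h4, -, rfl, rfl⟩ | ⟨e, r, he, h1, h2, h3, h4, h5, hq', hp⟩ |
    ⟨e, e', he, -, -, h1, rfl, rfl⟩
  · refine ⟨e, he, rfl, ?_⟩
    have : t = r := by
      refine Dart.ext _ _ (ht.trans (Prod.ext ?_ rfl))
      change e.snd = r.fst
      rw [← E.rot_fst r, h4]; rfl
    rw [this, h4]
  · obtain rfl : q = (r.snd, e.fst) := Prod.swap_injective hq'
    obtain rfl : p = (r.snd, e.snd) := Prod.swap_injective hp
    exact (hq rfl).elim
  · have hne : e.snd ≠ e'.fst := by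
      have := t.fst_ne_snd
      rwa [ht] at this
    obtain ⟨h2, h3⟩ := h1 hne
    refine ⟨e, he, rfl, ?_⟩
    have : t = (E.rot e').symm := by
      refine Dart.ext _ _ (ht.trans (Prod.ext h2.symm ?_))
      change e'.fst = (E.rot e').fst
      rw [E.rot_fst]
    rw [this, h3]

theorem Bordered.Step.exit {E : Bordered G} {p q : V × V} (h : E.Step p q) (hq : q.1 ≠ p.1)
    (hp : p.1 ≠ p.2) : ∃ e : G.Dart, E.face e = E.f₁ ∧ e.snd = q.1 ∧ (E.rot e).toProd = p := by
  rcases h with ⟨e, r, he, -, -, -, -, h5, rfl, rfl⟩ | ⟨e, r, he, h1, h2, h3, h4, h5, hq', hp⟩ |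
    ⟨e, e', he, -, h1, -, rfl, rfl⟩
  · refine ⟨e, he, rfl, Prod.ext (E.rot_fst e) ?_⟩
    change (E.rot e).snd = r.snd
    have : (E.rot (E.rot e).symm).fst = r.snd := by rw [h5]; rfl
    rw [← this, E.rot_fst]; rfl
  · obtain rfl : q = (r.snd, e.fst) := Prod.swap_injective hq'
    obtain rfl : p = (r.snd, e.snd) := Prod.swap_injective hp
    exact (hq rfl).elim
  · exact ⟨e, he, rfl, Prod.ext (E.rot_fst e) (h1 hp).1⟩

end Steps

end PlaneGraph

namespace PlaneGraph

set_option linter.unusedSectionVars false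

open SimpleGraph

/-! ### The strip of an embedding is a ladder -/

section BorderedLadder

variable {V : Type*} [Fintype V] {G : SimpleGraph V}

theorem Bordered.Step.exists_dart {E : Bordered G} {p q : V × V} (h : E.Step p q)
    (hq : q.1 ≠ p.1) : ∃ e : G.Dart, E.face e = E.f₁ ∧ e.toProd = (p.1, q.1) := by
  rcases h with ⟨e, r, he, -, -, -, -, h5, rfl, rfl⟩ | ⟨e, r, -, -, -, -, -, -, hq', hp⟩ |
    ⟨e, e', he, -, -, -, rfl, rfl⟩
  · exact ⟨e, he, rfl⟩
  · obtain rfl : q = (r.snd, e.fst) := Prod.swap_injective hq'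
    obtain rfl : p = (r.snd, e.snd) := Prod.swap_injective hp
    exact (hq rfl).elim
  · exact ⟨e, he, rfl⟩

theorem Bordered.Step.moves {E : Bordered G} {p q : V × V} (h : E.Step p q) :
    q.1 ≠ p.1 ∨ q.2 ≠ p.2 := by
  rcases h with ⟨e, r, -, -, -, -, -, -, rfl, rfl⟩ | ⟨e, r, -, -, -, -, -, -, hq', hp⟩ |
    ⟨e, e', -, -, -, -, rfl, rfl⟩
  · exact Or.inl e.snd_ne_fst
  · obtain rfl : q = (r.snd, e.fst) := Prod.swap_injective hq'
    obtain rfl : p = (r.snd, e.snd) := Prod.swap_injective hp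
    exact Or.inr e.fst_ne_snd
  · exact Or.inl e.snd_ne_fst

theorem Bordered.Step.moves_of_eq {E : Bordered G} {p q : V × V} (h : E.Step p q)
    (hp : p.1 = p.2) : q.1 ≠ p.1 ∧ q.2 ≠ p.2 := by
  obtain ⟨e, e', -, -, -, -, rfl, rfl⟩ := h.both_of_eq hp
  exact ⟨e.snd_ne_fst, e'.fst_ne_snd⟩

theorem Bordered.Step.moves_of_eq' {E : Bordered G} {p q : V × V} (h : E.Step p q)
    (hq : q.1 = q.2) : q.1 ≠ p.1 ∧ q.2 ≠ p.2 := by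
  have := h.swap.moves_of_eq hq.symm
  exact ⟨this.2.symm, this.1.symm⟩

section Runs

variable {E : Bordered G} {I : Type*} {N : Equiv.Perm I} {p : I → V × V}

/-- The border edges before and after a run are consecutive on the boundary walk, which never turns
back. -/
theorem Bordered.ne_of_run (hN : ∀ i, E.Step (p i) (p (N i))) (i : I) (k : ℕ)
    (h : (p (N.symm i)).1 ≠ (p i).1) (hk : ∀ l ≤ k, (p ((N ^ l) i)).1 = (p i).1)
    (hk' : (p ((N ^ (k + 1)) i)).1 ≠ (p i).1) :
    (p (N.symm i)).1 ≠ (p ((N ^ (k + 1)) i)).1 := by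
  intro heq
  have h1 := hN (N.symm i)
  rw [Equiv.apply_symm_apply] at h1
  obtain ⟨e, he, he'⟩ := h1.exists_dart h.symm
  have h2 := hN ((N ^ k) i)
  rw [← Equiv.Perm.mul_apply, ← pow_succ'] at h2
  obtain ⟨d, hd, hd'⟩ := h2.exists_dart (by rw [hk k le_rfl]; exact hk')
  rw [hk k le_rfl] at hd'
  have h3 : d = E.next e := by
    refine E.eq_of_face_eq_f₁ hd (by rw [E.face_apply_next, he]) ?_
    rw [E.next_fst, he', hd']
  refine E.next_ne_symm e ?_
  rw [← h3]
  refine Dart.ext _ _ ?_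
  change d.toProd = e.toProd.swap
  rw [hd', ← heq, he']
  rfl

/-- The rotation started at the outgoing border dart meets the `k + 1` rungs, then the incoming
border edge, and is back after `k + 3` turns. -/
theorem Bordered.degree_of_run [DecidableRel G.Adj] (hp : ∀ i, E.IsRung (p i))
    (hN : ∀ i, E.Step (p i) (p (N i))) (i : I) (k : ℕ) (hi : (p i).1 ≠ (p i).2)
    (h : (p (N.symm i)).1 ≠ (p i).1) (hk : ∀ l ≤ k, (p ((N ^ l) i)).1 = (p i).1)
    (hk' : (p ((N ^ (k + 1)) i)).1 ≠ (p i).1) : G.degree (p i).1 = k + 3 := by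
  classical
  have hi2 : ¬ E.On₂ (p i).1 := ((hp i).of_ne hi).2.1
  have hne : ∀ l ≤ k, (p ((N ^ l) i)).1 ≠ (p ((N ^ l) i)).2 := by
    intro l hl h'
    rw [hk l hl] at h'
    exact hi2 (h' ▸ (hp _).on₂)
  have hexit := hN ((N ^ k) i)
  rw [← Equiv.Perm.mul_apply, ← pow_succ'] at hexit
  obtain ⟨d, hd, hdsnd, hdrot⟩ := hexit.exit (by rw [hk k le_rfl]; exact hk') (hne k le_rfl)
  have hdfst : d.fst = (p i).1 := by rw [← E.rot_fst, hdrot, hk k le_rfl]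
  have hrungs : ∀ m ≤ k, ((E.rot ^ (m + 1)) d).toProd = p ((N ^ (k - m)) i) := by
    intro m
    induction m with
    | zero => intro _; exact hdrot
    | succ m ih =>
      intro hm
      have h1 := ih (by omega)
      have h2 := hN ((N ^ (k - (m + 1))) i)
      rw [← Equiv.Perm.mul_apply, ← pow_succ', show k - (m + 1) + 1 = k - m by omega] at h2
      rw [pow_succ', Equiv.Perm.mul_apply]
      exact h2.stay (by rw [hk _ (by omega), hk _ (by omega)]) h1
  have henter := hN (N.symm i)
  rw [Equiv.apply_symm_apply] at henter
  have h0 := hrungs k le_rfl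
  rw [Nat.sub_self] at h0
  obtain ⟨e, he, heprod, herot⟩ := henter.enter h.symm h0
  have hde : d = E.next e := by
    refine E.eq_of_face_eq_f₁ hd (by rw [E.face_apply_next, he]) ?_
    rw [E.next_fst, heprod, hdfst]
  have hlast : (E.rot ^ (k + 2)) d = e.symm := by
    rw [pow_succ', Equiv.Perm.mul_apply]; exact herot
  have hcycle : (E.rot ^ (k + 3)) d = d := by
    rw [pow_succ', Equiv.Perm.mul_apply, hlast, ← E.next_apply, ← hde]
  -- A rung ends off the first border, so it cannot be `d`; the incoming edge cannot either, since
  -- the walk does not turn back.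
  have hmin : ∀ m, 0 < m → m < k + 3 → (E.rot ^ m) d ≠ d := by
    intro m hm hm' h'
    rcases Nat.lt_or_ge m (k + 2) with hmk | hmk
    · obtain ⟨l, rfl⟩ : ∃ l, m = l + 1 := ⟨m - 1, by omega⟩
      have h1 := hrungs l (by omega)
      rw [h'] at h1
      refine ((hp ((N ^ (k - l)) i)).of_ne (hne _ (by omega))).2.2 ?_
      rw [← h1]
      exact E.on₁_snd hd
    · obtain rfl : m = k + 2 := by omega
      rw [hlast, hde] at h'
      exact E.next_ne_symm e h'.symm
  rw [← G.dart_fst_fiber_card_eq_degree]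
  have himage : (Finset.univ.filter fun a : G.Dart => a.fst = (p i).1) =
      (Finset.range (k + 3)).image fun m => (E.rot ^ m) d := by
    ext a
    simp only [Finset.mem_filter, Finset.mem_univ, true_and, Finset.mem_image, Finset.mem_range]
    constructor
    · intro ha
      refine E.rot_induction (p := fun a => ∃ m < k + 3, (E.rot ^ m) d = a) ?_
        (hdfst.trans ha.symm) ⟨0, by omega, rfl⟩
      rintro _ ⟨m, hm, rfl⟩
      rcases Nat.lt_or_ge (m + 1) (k + 3) with h' | h'
      · exact ⟨m + 1, h', by rw [pow_succ', Equiv.Perm.mul_apply]⟩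
      · obtain rfl : m = k + 2 := by omega
        refine ⟨0, by omega, ?_⟩
        rw [← Equiv.Perm.mul_apply, ← pow_succ', hcycle]
        rfl
    · rintro ⟨m, -, rfl⟩
      rw [← hdfst]
      induction m with
      | zero => rfl
      | succ m ih => rw [pow_succ', Equiv.Perm.mul_apply, E.rot_fst, ih]
  rw [himage, Finset.card_image_of_injOn, Finset.card_range]
  have hlt : ∀ l m, l < m → m < k + 3 → (E.rot ^ l) d ≠ (E.rot ^ m) d := by
    intro l m hlm hm h'
    refine hmin (m - l) (by omega) (by omega) ((E.rot ^ l).injective ?_)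
    rw [← Equiv.Perm.mul_apply, ← pow_add, h']
    congr 2; omega
  intro l hl m hm h'
  simp only [Finset.coe_range, Set.mem_Iio] at hl hm
  rcases lt_trichotomy l m with h2 | h2 | h2
  · exact (hlt l m h2 hm h').elim
  · exact h2
  · exact (hlt m l h2 hl h'.symm).elim

end Runs

/-- Successors of rungs exist. Uniqueness applied after exchanging the borders makes predecessors
unique, so the successor map is injective on a finite set. -/
theorem Bordered.exists_perm (E : Bordered G) :
    ∃ N : Equiv.Perm {p // E.IsRung p}, ∀ i, E.Step i.1 (N i).1 := by
  choose f hf using fun i : {p // E.IsRung p} => E.exists_step i.2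
  let F : {p // E.IsRung p} → {p // E.IsRung p} := fun i => ⟨f i, (hf i).1⟩
  have hinj : Function.Injective F := by
    intro i j hij
    have h1 := (hf i).2.swap
    have h2 := (hf j).2.swap
    rw [show f i = f j from congrArg Subtype.val hij] at h1
    exact Subtype.ext (Prod.swap_injective (h1.unique (hf j).1.swap h2))
  exact ⟨Equiv.ofBijective F (Finite.injective_iff_bijective.1 hinj), fun i => (hf i).2⟩

/-- The strip between the borders of the two faces. -/
theorem Bordered.exists_ladder [DecidableRel G.Adj] (E : Bordered G) :
    ∃ R : Ladder G {p // E.IsRung p}, ∀ i, R.a i = i.1.1 ∧ R.b i = i.1.2 := by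
  obtain ⟨N, hN⟩ := E.exists_perm
  have hN' : ∀ i, E.swap.Step i.1.swap (N.symm i).1.swap := by
    intro i
    have := (hN (N.symm i)).swap
    rwa [Equiv.apply_symm_apply] at this
  refine ⟨{
    next := N
    a := fun i => i.1.1
    b := fun i => i.1.2
    adj_a := fun i h => ?_
    adj_b := fun i h => ?_
    moves := fun i => (hN i).moves
    rung := fun i h => (i.2.of_ne h).1
    a_ne_b := fun i j h h' => (i.2.of_ne h).2.1 (h' ▸ j.2.on₂)
    b_ne_a := fun i j h h' => (i.2.of_ne h).2.2 (h' ▸ j.2.on₁)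
    moves_of_eq := fun i h => (hN i).moves_of_eq h
    moves_of_next_eq := fun i h => (hN i).moves_of_eq' h
    degree_a := fun i k => Bordered.degree_of_run (p := Subtype.val) (fun i => i.2) hN i k
    degree_b := fun i k h h0 hk hk' => ?_
    ne_a := fun i k => Bordered.ne_of_run (p := Subtype.val) hN i k
    ne_b := fun i k h0 hk hk' => ?_ }, fun i => ⟨rfl, rfl⟩⟩
  · obtain ⟨e, -, he⟩ := (hN i).exists_dart h
    have := e.adj
    rwa [he] at this
  · obtain ⟨e, -, he⟩ := (hN i).swap.exists_dart (Ne.symm h)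
    have := e.adj
    rw [he] at this
    exact this.symm
  -- On the second border the steps of the exchanged embedding run backwards, so the run is read
  -- from its other end.
  · obtain ⟨h1, h2, h3, -, -⟩ := Ladder.run_reverse N.symm (fun i => i.1.2) h0 hk hk'
    have := Bordered.degree_of_run (E := E.swap) (p := fun i => i.1.swap) (fun i => i.2.swap) hN'
      ((N ^ k) i) k ?_ h1 h2 h3
    · rw [← hk k le_rfl]
      exact this
    · intro h'
      change ((N ^ k) i).1.2 = ((N ^ k) i).1.1 at h'
      rw [hk k le_rfl] at h'
      exact (i.2.of_ne h).2.2 (h' ▸ ((N ^ k) i).2.on₁)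
  · obtain ⟨h1, h2, h3, h4, h5⟩ := Ladder.run_reverse N.symm (fun i => i.1.2) h0 hk hk'
    have := Bordered.ne_of_run (E := E.swap) (p := fun i => i.1.swap) hN' ((N ^ k) i) k h1 h2 h3
    intro h6
    exact this (h4.trans (h6.symm.trans h5.symm))

theorem Bordered.reachable_of_on₁ (E : Bordered G) {x y : V} (hx : E.On₁ x) (hy : E.On₁ y) :
    G.Reachable x y := by
  obtain ⟨d, rfl, hd⟩ := hx
  obtain ⟨d', rfl, hd'⟩ := hy
  obtain ⟨L, hL, hdL, hinj⟩ := E.exists_period d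
  obtain ⟨i, -, rfl⟩ := E.walk_eq_of_face hd hd' hL hdL hinj
  clear hd'
  induction i with
  | zero => exact Reachable.refl _
  | succ i ih =>
    rw [← E.walk_snd]
    exact ih.trans (E.walk d i).adj.reachable

theorem Bordered.exists_rung_of_not_on₂ (E : Bordered G) {v : V} (hv : ¬ E.On₂ v) :
    ∃ p, E.IsRung p ∧ p.1 ≠ p.2 := by
  obtain ⟨e, rfl, he⟩ := E.on₁_of_not_on₂ hv
  refine ⟨(e.fst, (E.rot e).snd), Or.inr ⟨?_, hv, E.not_on₁_rot_snd he⟩, ?_⟩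
  · have := (E.rot e).adj
    rwa [E.rot_fst] at this
  · have := (E.rot e).fst_ne_snd
    rwa [E.rot_fst] at this

theorem Bordered.exists_rung (E : Bordered G) [Nonempty V] : ∃ p, E.IsRung p ∧ p.1 ≠ p.2 := by
  by_cases h : ∃ v, ¬ E.On₂ v
  · obtain ⟨v, hv⟩ := h
    exact E.exists_rung_of_not_on₂ hv
  push Not at h
  obtain ⟨v⟩ := ‹Nonempty V›
  obtain ⟨d, -, hd⟩ := h v
  -- It is impossible that all vertices are on the second border: the dart after a border dart leads
  -- off that border.
  obtain ⟨p, hp, hne⟩ := E.swap.exists_rung_of_not_on₂ (E.swap.not_on₁_rot_snd hd |> fun h' =>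
    (h' (h _)).elim : ¬ E.swap.On₂ v)
  exact ⟨p.swap, hp.swap, hne.symm⟩

/-- Each border is a single closed walk, the two contain all vertices, and a rung of positive length
joins them. -/
theorem Bordered.preconnected (E : Bordered G) [Nonempty V] : G.Preconnected := by
  obtain ⟨p, hp, hne⟩ := E.exists_rung
  have hadj := (hp.of_ne hne).1
  have key : ∀ x, G.Reachable p.1 x := by
    intro x
    rcases E.on_or_on x with h | h
    · exact E.reachable_of_on₁ hp.on₁ h
    · exact hadj.reachable.trans (E.swap.reachable_of_on₁ hp.on₂ h)
  exact fun x y => (key x).symm.trans (key y)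

/-- A graph of minimum degree at least 3 with all vertices on the borders of two faces has one of the
configurations, or is an antiprism. -/
theorem Bordered.hasConfig_or_iso [DecidableRel G.Adj] [Nonempty V] (E : Bordered G) :
    Ladder.HasConfig G ∨ ∃ n, 3 ≤ n ∧ Nonempty (G ≃g graphP n) := by
  rw [or_iff_not_imp_left]
  intro hcon
  obtain ⟨R, hR⟩ := E.exists_ladder
  obtain ⟨p, hp, hne⟩ := E.exists_rung
  refine Ladder.exists_iso_graphP (R := R) E.preconnected hcon ?_ (i := ⟨p, hp⟩) ?_
  · intro i j h1 h2
    rw [(hR i).1, (hR j).1] at h1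
    rw [(hR i).2, (hR j).2] at h2
    exact Subtype.ext (Prod.ext h1 h2)
  · rw [(hR _).1, (hR _).2]
    exact hne

end BorderedLadder

end PlaneGraph

namespace PlaneGraph

set_option linter.unusedSectionVars false

open SimpleGraph

/-! ### Suppressing a vertex of degree 2 -/

section Suppression

variable {V : Type*} [Fintype V] {G : SimpleGraph V} {u v w : V}

theorem deleteVertexAddEdge_adj (huw : u ≠ w) {x y : ({v}ᶜ : Set V)} :
    (deleteVertexAddEdge G v u w).Adj x y ↔
      G.Adj x y ∨ (x.1 = u ∧ y.1 = w ∨ x.1 = w ∧ y.1 = u) := by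
  simp only [deleteVertexAddEdge, comap_adj, sup_adj, edge_adj, Function.Embedding.subtype_apply]
  constructor
  · rintro (h | h)
    exacts [Or.inl h, Or.inr h.1]
  · rintro (h | h)
    · exact Or.inl h
    · refine Or.inr ⟨h, ?_⟩
      rintro h'
      rw [h'] at h
      rcases h with ⟨h1, h2⟩ | ⟨h1, h2⟩
      exacts [huw (h1.symm.trans h2), huw (h2.symm.trans h1)]

open scoped Classical in
/-- The darts after suppressing a vertex of degree 2, as darts of the original graph. -/
noncomputable def suppressDart (huw : u ≠ w) (hu : G.Adj u v) (hw : G.Adj v w)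
    (d : (deleteVertexAddEdge G v u w).Dart) : G.Dart :=
  -- A dart of the new edge is read as the dart into `v` with the same initial vertex.
  if h : G.Adj d.fst d.snd then ⟨(d.fst, d.snd), h⟩ else ⟨(d.fst, v), by
    rcases ((deleteVertexAddEdge_adj huw).1 d.adj).resolve_left h with h | h
    · rw [h.1]; exact hu
    · rw [h.1]; exact hw.symm⟩

variable {huw : u ≠ w} {hu : G.Adj u v} {hw : G.Adj v w}

theorem suppressDart_fst (d : (deleteVertexAddEdge G v u w).Dart) :
    (suppressDart huw hu hw d).fst = d.fst := by
  rw [suppressDart]; split_ifs <;> rfl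

theorem suppressDart_of_adj {d : (deleteVertexAddEdge G v u w).Dart} (h : G.Adj d.fst d.snd) :
    suppressDart huw hu hw d = ⟨(d.fst, d.snd), h⟩ := by
  rw [suppressDart, dif_pos h]

theorem suppressDart_of_not_adj {d : (deleteVertexAddEdge G v u w).Dart}
    (h : ¬ G.Adj d.fst d.snd) : (suppressDart huw hu hw d).toProd = (d.fst.1, v) := by
  rw [suppressDart, dif_neg h]

theorem ends_of_not_adj (huw : u ≠ w) {d : (deleteVertexAddEdge G v u w).Dart}
    (h : ¬ G.Adj d.fst d.snd) : d.fst.1 = u ∧ d.snd.1 = w ∨ d.fst.1 = w ∧ d.snd.1 = u :=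
  ((deleteVertexAddEdge_adj huw).1 d.adj).resolve_left h

theorem suppressDart_injective : Function.Injective (suppressDart huw hu hw) := by
  intro d d' h
  have h1 : d.fst = d'.fst := Subtype.ext (by
    rw [← suppressDart_fst (huw := huw) (hu := hu) (hw := hw) d, h, suppressDart_fst])
  refine Dart.ext _ _ (Prod.ext h1 (Subtype.ext ?_))
  by_cases hd : G.Adj d.fst d.snd <;> by_cases hd' : G.Adj d'.fst d'.snd
  · rw [suppressDart_of_adj hd, suppressDart_of_adj hd'] at h
    exact congrArg (fun d : G.Dart => d.snd) h
  · rw [suppressDart_of_adj hd] at h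
    have := suppressDart_of_not_adj (huw := huw) (hu := hu) (hw := hw) hd'
    rw [← h] at this
    exact (d.snd.2 (congrArg Prod.snd this)).elim
  · rw [suppressDart_of_adj hd'] at h
    have := suppressDart_of_not_adj (huw := huw) (hu := hu) (hw := hw) hd
    rw [h] at this
    exact (d'.snd.2 (congrArg Prod.snd this)).elim
  · have e1 := ends_of_not_adj huw hd
    have e2 := ends_of_not_adj huw hd'
    rw [← h1] at e2
    rcases e1 with e1 | e1 <;> rcases e2 with e2 | e2
    · rw [e1.2, e2.2]
    · exact (huw (e1.1.symm.trans e2.1)).elim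
    · exact (huw (e2.1.symm.trans e1.1)).elim
    · rw [e1.2, e2.2]

theorem exists_suppressDart (hn : ¬ G.Adj u w) (hdeg : ∀ x, G.Adj v x → x = u ∨ x = w) {d : G.Dart}
    (hd : d.fst ≠ v) : ∃ d', suppressDart huw hu hw d' = d := by
  have hu' : u ≠ v := hu.ne
  have hw' : w ≠ v := hw.ne.symm
  by_cases hs : d.snd = v
  · have huw' : ∃ y, y ≠ v ∧ (d.fst = u ∧ y = w ∨ d.fst = w ∧ y = u) := by
      rcases hdeg d.fst (hs ▸ d.adj.symm) with h | h
      · exact ⟨w, hw', Or.inl ⟨h, rfl⟩⟩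
      · exact ⟨u, hu', Or.inr ⟨h, rfl⟩⟩
    obtain ⟨y, hy, hxy⟩ := huw'
    let d' : (deleteVertexAddEdge G v u w).Dart :=
      ⟨(⟨d.fst, hd⟩, ⟨y, hy⟩), (deleteVertexAddEdge_adj huw).2 (Or.inr hxy)⟩
    by_cases h : G.Adj d'.fst d'.snd
    · change G.Adj d.fst y at h
      rcases hxy with ⟨h1, rfl⟩ | ⟨h1, rfl⟩
      · exact (hn (h1 ▸ h)).elim
      · exact (hn (h1 ▸ h.symm)).elim
    · exact ⟨d', Dart.ext _ _ ((suppressDart_of_not_adj h).trans (Prod.ext rfl hs.symm))⟩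
  · let d' : (deleteVertexAddEdge G v u w).Dart :=
      ⟨(⟨d.fst, hd⟩, ⟨d.snd, hs⟩), (deleteVertexAddEdge_adj huw).2 (Or.inl d.adj)⟩
    exact ⟨d', suppressDart_of_adj (d := d') d.adj⟩

/-- At a vertex of degree 2, the rotation exchanges the two darts. -/
theorem FaceSystem.rot_eq_of_two_darts (E : FaceSystem G) (hdeg : ∀ x, G.Adj v x → x = u ∨ x = w)
    {a b : G.Dart} (ha : a.fst = v) (hb : b.fst = v) (hab : a ≠ b) : E.rot a = b := by
  by_contra hne
  have hs : ∀ c : G.Dart, c.fst = v → c.snd = u ∨ c.snd = w := fun c hc => hdeg _ (hc ▸ c.adj)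
  have hext : ∀ c d : G.Dart, c.fst = v → d.fst = v → c.snd = d.snd → c = d :=
    fun c d hc hd h => Dart.ext _ _ (Prod.ext (hc.trans hd.symm) h)
  have hall : ∀ c : G.Dart, c.fst = v → c = a ∨ c = b := by
    intro c hc
    rcases hs a ha with h1 | h1 <;> rcases hs b hb with h2 | h2 <;> rcases hs c hc with h3 | h3
    · exact Or.inl (hext _ _ hc ha (h3.trans h1.symm))
    · exact (hab (hext _ _ ha hb (h1.trans h2.symm))).elim
    · exact Or.inl (hext _ _ hc ha (h3.trans h1.symm))
    · exact Or.inr (hext _ _ hc hb (h3.trans h2.symm))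
    · exact Or.inr (hext _ _ hc hb (h3.trans h2.symm))
    · exact Or.inl (hext _ _ hc ha (h3.trans h1.symm))
    · exact (hab (hext _ _ ha hb (h1.trans h2.symm))).elim
    · exact Or.inl (hext _ _ hc ha (h3.trans h1.symm))
  have h1 := (hall (E.rot a) (by rw [E.rot_fst, ha])).resolve_right hne
  exact hab (E.rot_induction (p := fun c => c = a) (by rintro c rfl; exact h1)
    (ha.trans hb.symm) rfl).symm

/-- The darts after suppressing a vertex `v` of degree 2 correspond to the darts that do not start
at `v`. -/
noncomputable def suppressDartEquiv (huw : u ≠ w) (hu : G.Adj u v) (hw : G.Adj v w)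
    (hn : ¬ G.Adj u w) (hdeg : ∀ x, G.Adj v x → x = u ∨ x = w) :
    (deleteVertexAddEdge G v u w).Dart ≃ {d : G.Dart // d.fst ≠ v} :=
  Equiv.ofBijective
    (fun d => ⟨suppressDart huw hu hw d, by rw [suppressDart_fst]; exact d.fst.2⟩)
    ⟨fun d d' h => suppressDart_injective (huw := huw) (hu := hu) (hw := hw)
        (congrArg Subtype.val h), fun d => by
      obtain ⟨d', hd'⟩ := exists_suppressDart (huw := huw) (hu := hu) (hw := hw) hn hdeg d.2
      exact ⟨d', Subtype.ext hd'⟩⟩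

/-- The rotation preserves the set of darts that do not start at `v`; its restriction is transported
along the correspondence of darts. -/
theorem exists_suppressed_rot (E : FaceSystem G) (huw : u ≠ w) (hu : G.Adj u v)
    (hw : G.Adj v w) (hn : ¬ G.Adj u w) (hdeg : ∀ x, G.Adj v x → x = u ∨ x = w) :
    ∃ rot : Equiv.Perm (deleteVertexAddEdge G v u w).Dart,
      (∀ d, suppressDart huw hu hw (rot d) = E.rot (suppressDart huw hu hw d)) ∧
      ∀ d d', d.fst = d'.fst → rot.SameCycle d d' := by
  classical
  let ι := suppressDartEquiv huw hu hw hn hdeg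
  let ρ : Equiv.Perm {d : G.Dart // d.fst ≠ v} :=
    E.rot.subtypePerm fun d => by rw [E.rot_fst]
  let rot' : Equiv.Perm (deleteVertexAddEdge G v u w).Dart := (ι.trans ρ).trans ι.symm
  have hrot : ∀ d, suppressDart huw hu hw (rot' d) = E.rot (suppressDart huw hu hw d) := fun d =>
    congrArg Subtype.val (ι.apply_symm_apply (ρ (ι d)))
  have hpow : ∀ (n : ℕ) d,
      suppressDart huw hu hw ((rot' ^ n) d) = (E.rot ^ n) (suppressDart huw hu hw d) := by
    intro n d
    induction n with
    | zero => rfl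
    | succ n ih => rw [pow_succ', pow_succ', Equiv.Perm.mul_apply, Equiv.Perm.mul_apply, hrot, ih]
  refine ⟨rot', hrot, fun d d' h => ?_⟩
  obtain ⟨n, -, hn⟩ := (E.rot_cyclic (suppressDart huw hu hw d) (suppressDart huw hu hw d')
    (by rw [suppressDart_fst, suppressDart_fst, h])).exists_pow_eq'
  refine ⟨n, suppressDart_injective (huw := huw) (hu := hu) (hw := hw) ?_⟩
  rw [zpow_natCast, hpow, hn]

/-- The rotation at `v` only exchanges its two darts, so the face walk passes straight through `v`
and keeps its face on the same side. -/
theorem face_suppressDart_symm_symm (E : FaceSystem G)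
    (hdeg : ∀ x, G.Adj v x → x = u ∨ x = w) (d : (deleteVertexAddEdge G v u w).Dart) :
    E.face (suppressDart huw hu hw d.symm).symm = E.face (suppressDart huw hu hw d) := by
  by_cases h : G.Adj d.fst d.snd
  · rw [suppressDart_of_adj h, suppressDart_of_adj (d := d.symm) h.symm]
    rfl
  · have h' : ¬ G.Adj d.symm.fst d.symm.snd := fun h' => h h'.symm
    have e1 := suppressDart_of_not_adj (huw := huw) (hu := hu) (hw := hw) h
    have e2 := suppressDart_of_not_adj (huw := huw) (hu := hu) (hw := hw) h'
    have hr : E.rot (suppressDart huw hu hw d).symm = (suppressDart huw hu hw d.symm).symm := by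
      refine E.rot_eq_of_two_darts hdeg (congrArg Prod.snd e1) (congrArg Prod.snd e2) fun he => ?_
      rw [Dart.symm_involutive.injective.eq_iff] at he
      have := congrArg (fun d : G.Dart => d.fst) he
      rw [suppressDart_fst, suppressDart_fst] at this
      exact d.adj.ne (Subtype.ext this)
    rw [← hr, E.face_rot, Dart.symm_symm]

/-- The faces at a vertex of degree 2 are faces at each of its neighbors. -/
theorem exists_face_of_fst_eq (E : FaceSystem G) (hu : G.Adj u v)
    (hdeg : ∀ x, G.Adj v x → x = u ∨ x = w) {d : G.Dart} (hd : d.fst = v) :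
    ∃ d' : G.Dart, d'.fst = u ∧ E.face d' = E.face d := by
  by_cases h : d.snd = u
  · refine ⟨E.rot d.symm, by rw [E.rot_fst]; exact h, E.face_next d⟩
  · refine ⟨⟨(u, v), hu⟩, rfl, ?_⟩
    rw [← E.face_next ⟨(u, v), hu⟩, E.rot_eq_of_two_darts hdeg rfl hd]
    rintro rfl
    exact h rfl

theorem deleteVertexAddEdge_exists_adj (huw : u ≠ w) (hu : G.Adj u v) (hw : G.Adj v w)
    (hdeg : ∀ x, G.Adj v x → x = u ∨ x = w) (hiso : ∀ x, ∃ y, G.Adj x y) (x : ({v}ᶜ : Set V)) :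
    ∃ y, (deleteVertexAddEdge G v u w).Adj x y := by
  obtain ⟨y, hy⟩ := hiso x
  by_cases h : y = v
  · subst h
    rcases hdeg x hy.symm with h | h
    · exact ⟨⟨w, hw.ne.symm⟩, (deleteVertexAddEdge_adj huw).2 (Or.inr (Or.inl ⟨h, rfl⟩))⟩
    · exact ⟨⟨u, hu.ne⟩, (deleteVertexAddEdge_adj huw).2 (Or.inr (Or.inr ⟨h, rfl⟩))⟩
  · exact ⟨⟨y, h⟩, (deleteVertexAddEdge_adj huw).2 (Or.inl hy)⟩

/-- Since `g` undoes `f` up to reachability, `f` induces an injective map on components. -/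
theorem card_connectedComponent_le {V W : Type*} [Finite W] {G : SimpleGraph V}
    {H : SimpleGraph W} (f : V → W) (g : W → V)
    (hg : ∀ x y, H.Adj x y → G.Reachable (g x) (g y))
    (hf : ∀ x y, G.Adj x y → H.Reachable (f x) (f y)) (hgf : ∀ x, G.Reachable (g (f x)) x) :
    Nat.card G.ConnectedComponent ≤ Nat.card H.ConnectedComponent := by
  have hr : ∀ {x y}, H.Reachable x y → G.Reachable (g x) (g y) := by
    rintro x y ⟨p⟩
    induction p with
    | nil => rfl
    | cons h _ ih => exact (hg _ _ h).trans ih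
  have hr' : ∀ {x y}, G.Reachable x y → H.Reachable (f x) (f y) := by
    rintro x y ⟨p⟩
    induction p with
    | nil => rfl
    | cons h _ ih => exact (hf _ _ h).trans ih
  refine Nat.card_le_card_of_injective
    (ConnectedComponent.lift (fun x => H.connectedComponentMk (f x))
      fun x y p _ => ConnectedComponent.eq.2 (hr' ⟨p⟩)) fun c c' => ?_
  induction c using ConnectedComponent.ind with | _ x
  induction c' using ConnectedComponent.ind with | _ y
  intro h
  have h : H.Reachable (f x) (f y) := ConnectedComponent.eq.1 h
  exact ConnectedComponent.eq.2 ((hgf x).symm.trans ((hr h).trans (hgf y)))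

theorem card_connectedComponent_deleteVertexAddEdge (huw : u ≠ w) (hu : G.Adj u v)
    (hw : G.Adj v w) (hdeg : ∀ x, G.Adj v x → x = u ∨ x = w) :
    Nat.card (deleteVertexAddEdge G v u w).ConnectedComponent = Nat.card G.ConnectedComponent := by
  classical
  let g : V → ({v}ᶜ : Set V) := fun x => if h : x = v then ⟨u, hu.ne⟩ else ⟨x, h⟩
  have hgv : g v = ⟨u, hu.ne⟩ := dif_pos rfl
  have hgx : ∀ x (h : x ≠ v), g x = ⟨x, h⟩ := fun x h => dif_neg h
  have h1 : ∀ x y : ({v}ᶜ : Set V), (deleteVertexAddEdge G v u w).Adj x y →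
      G.Reachable x.1 y.1 := by
    intro x y h
    have huw' : G.Reachable u w := hu.reachable.trans hw.reachable
    rcases (deleteVertexAddEdge_adj huw).1 h with h | ⟨h, h'⟩ | ⟨h, h'⟩
    · exact h.reachable
    · rw [h, h']; exact huw'
    · rw [h, h']; exact huw'.symm
  have h3 : ∀ x, G.Adj v x → (deleteVertexAddEdge G v u w).Reachable (g v) (g x) := by
    intro x h
    rw [hgv, hgx x h.ne.symm]
    rcases hdeg x h with rfl | rfl
    · rfl
    · exact ((deleteVertexAddEdge_adj huw).2 (Or.inr (Or.inl ⟨rfl, rfl⟩))).reachable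
  have h2 : ∀ x y, G.Adj x y → (deleteVertexAddEdge G v u w).Reachable (g x) (g y) := by
    intro x y h
    by_cases hx : x = v
    · subst hx; exact h3 y h
    by_cases hy : y = v
    · subst hy; exact (h3 x h.symm).symm
    rw [hgx x hx, hgx y hy]
    exact ((deleteVertexAddEdge_adj huw).2 (Or.inl h)).reachable
  refine le_antisymm (card_connectedComponent_le (fun x => x.1) g h2 h1 fun x => ?_)
    (card_connectedComponent_le g (fun x => x.1) h1 h2 fun x => ?_)
  · rw [hgx x.1 x.2]
  · by_cases hx : x = v
    · subst hx; rw [hgv]; exact hu.reachable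
    · rw [hgx x hx]

theorem card_edgeSet_deleteVertexAddEdge [DecidableRel G.Adj] (huw : u ≠ w) (hu : G.Adj u v)
    (hw : G.Adj v w) (hn : ¬ G.Adj u w) (hdeg : ∀ x, G.Adj v x → x = u ∨ x = w)
    (hdv : G.degree v = 2) :
    Nat.card (deleteVertexAddEdge G v u w).edgeSet + 1 = Nat.card G.edgeSet := by
  classical
  have h1 := G.dart_card_eq_twice_card_edges
  have h2 := (deleteVertexAddEdge G v u w).dart_card_eq_twice_card_edges
  have h3 := Fintype.card_congr (suppressDartEquiv huw hu hw hn hdeg)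
  -- Exactly the two darts that start at `v` are lost, which amounts to one edge.
  have h4 : Fintype.card {d : G.Dart // d.fst ≠ v} + 2 = Fintype.card G.Dart := by
    have h5 := G.dart_fst_fiber_card_eq_degree v
    rw [← hdv, ← h5, Fintype.card_subtype, add_comm, ← Finset.card_univ]
    exact Finset.card_filter_add_card_filter_not (s := Finset.univ) (fun d : G.Dart => d.fst = v)
  rw [Nat.card_eq_fintype_card, Nat.card_eq_fintype_card, ← edgeFinset_card, ← edgeFinset_card]
  omega

/-- Suppressing a vertex of degree 2 whose neighbors are not adjacent preserves 2-boundary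
planarity. -/
theorem TwoBoundaryPlanar.deleteVertexAddEdge [DecidableRel G.Adj] (hG : TwoBoundaryPlanar G)
    (hiso : ∀ x, ∃ y, G.Adj x y) (huw : u ≠ w) (hu : G.Adj u v) (hw : G.Adj v w)
    (hn : ¬ G.Adj u w) (hdeg : ∀ x, G.Adj v x → x = u ∨ x = w) (hdv : G.degree v = 2) :
    TwoBoundaryPlanar (deleteVertexAddEdge G v u w) := by
  classical
  obtain ⟨E, f₁, f₂, hE⟩ := hG
  obtain ⟨rot', hrot, hcyc⟩ := exists_suppressed_rot E.toFaceSystem huw hu hw hn hdeg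
  have hiso' := deleteVertexAddEdge_exists_adj huw hu hw hdeg hiso
  let E' : FaceSystem (PlaneGraph.deleteVertexAddEdge G v u w) :=
    { rot := rot'
      rot_fst := fun d => Subtype.ext (by
        rw [← suppressDart_fst (huw := huw) (hu := hu) (hw := hw) (rot' d), hrot, E.rot_fst,
          suppressDart_fst])
      rot_cyclic := hcyc
      numFaces := E.numFaces
      face := fun d => E.face (suppressDart huw hu hw d)
      face_next := fun d => by
        rw [hrot, E.face_rot, face_suppressDart_symm_symm E.toFaceSystem hdeg]
      isolatedFace := fun x => ((hiso' x.1).elim fun y hy => x.2 y hy).elim }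
  -- Incidences with faces survive; those of `v` are inherited by `u`, which keeps the faces linked.
  have hb : ∀ x f, E.OnBoundary x f → ∀ x' : ({v}ᶜ : Set V), (x ≠ v → x'.1 = x) →
      (x = v → x'.1 = u) → E'.OnBoundary x' f := by
    intro x f h x' hx' hx''
    obtain ⟨d, hd, rfl⟩ := h.resolve_right fun h => (hiso x).elim fun y hy => h.1 y hy
    have : ∃ d' : G.Dart, d'.fst = x'.1 ∧ E.face d' = E.face d := by
      by_cases hx : x = v
      · rw [hx'' hx]
        exact exists_face_of_fst_eq E.toFaceSystem hu hdeg (hd.trans hx)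
      · exact ⟨d, by rw [hx' hx, hd], rfl⟩
    obtain ⟨d', hd', hf⟩ := this
    obtain ⟨e, he⟩ := exists_suppressDart (huw := huw) (hu := hu) (hw := hw) hn hdeg
      (d := d') (by rw [hd']; exact x'.2)
    refine Or.inl ⟨e, Subtype.ext ?_, ?_⟩
    · rw [← suppressDart_fst (huw := huw) (hu := hu) (hw := hw) e, he, hd']
    · change E.face (suppressDart huw hu hw e) = _
      rw [he, hf]
  refine ⟨{ E' with
    faces_linked := fun f g => Relation.ReflTransGen.mono (fun f g h => ?_) _ _ (E.faces_linked f g)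
    euler := ?_ }, f₁, f₂, fun x => ?_⟩
  · obtain ⟨x, hf, hg⟩ := h
    by_cases hx : x = v
    · exact ⟨⟨u, hu.ne⟩, hb x f hf _ (fun h => (h hx).elim) fun _ => rfl,
        hb x g hg _ (fun h => (h hx).elim) fun _ => rfl⟩
    · exact ⟨⟨x, hx⟩, hb x f hf _ (fun _ => rfl) fun h => (hx h).elim,
        hb x g hg _ (fun _ => rfl) fun h => (hx h).elim⟩
  -- One vertex and one edge disappear, while faces and components keep their numbers.
  · have h1 := E.euler
    have h2 := card_edgeSet_deleteVertexAddEdge huw hu hw hn hdeg hdv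
    have h3 := card_connectedComponent_deleteVertexAddEdge huw hu hw hdeg
    have h4 : Nat.card ({v}ᶜ : Set V) + 1 = Nat.card V := by
      have := Set.ncard_add_ncard_compl ({v} : Set V)
      rw [Set.ncard_singleton] at this
      rw [← this, add_comm]
      rfl
    change Nat.card ({v}ᶜ : Set V) + E.numFaces = _
    omega
  · exact (hE x.1).imp (fun h => hb x.1 f₁ h x (fun _ => rfl) fun h => (x.2 h).elim)
      fun h => hb x.1 f₂ h x (fun _ => rfl) fun h => (x.2 h).elim

end Suppression

end PlaneGraph

namespace PlaneGraph

set_option linter.unusedSectionVars false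

open SimpleGraph

/-! ### Reduction to minimum degree 3 -/

section MinDegree

variable {V : Type*} [Fintype V] {G : SimpleGraph V}

theorem FaceSystem.degree_le_two [DecidableRel G.Adj] (E : FaceSystem G) {d : G.Dart}
    (h : E.rot (E.rot d) = d) : G.degree d.fst ≤ 2 := by
  classical
  rw [← G.dart_fst_fiber_card_eq_degree]
  refine (Finset.card_le_card (t := {d, E.rot d}) fun c hc => ?_).trans Finset.card_le_two
  have hc : c.fst = d.fst := by simpa using hc
  rw [Finset.mem_insert, Finset.mem_singleton]
  refine E.rot_induction (p := fun c => c = d ∨ c = E.rot d) ?_ hc.symm (Or.inl rfl)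
  rintro c (rfl | rfl)
  exacts [Or.inr rfl, Or.inl h]

theorem TwoBoundaryPlanar.nonempty_bordered [DecidableRel G.Adj] (hG : TwoBoundaryPlanar G)
    (hdeg : ∀ v, 3 ≤ G.degree v) : Nonempty (Bordered G) := by
  obtain ⟨E, f₁, f₂, hE⟩ := hG
  have hne : ∀ d, E.rot (E.rot d) ≠ d := fun d h =>
    absurd (hdeg d.fst) (not_le.2 (Nat.lt_succ_of_le (E.degree_le_two h)))
  have hb : ∀ v f, E.OnBoundary v f → ∃ d : G.Dart, d.fst = v ∧ E.face d = f := by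
    intro v f h
    refine h.resolve_right fun h => ?_
    obtain ⟨w, hw⟩ := (G.degree_pos_iff_exists_adj v).1 (lt_of_lt_of_le (by norm_num) (hdeg v))
    exact h.1 w hw
  refine ⟨{ E with
    f₁ := f₁
    f₂ := f₂
    cover := fun v => ?_
    rot_ne := fun d h => hne d (by rw [h, h])
    rot_rot_ne := hne }⟩
  rcases hE v with h | h
  · exact (hb v _ h).imp fun d h => ⟨h.1, Or.inl h.2⟩
  · exact (hb v _ h).imp fun d h => ⟨h.1, Or.inr h.2⟩

theorem TwoBoundaryPlanar.configB_or_configC [DecidableRel G.Adj] (hG : TwoBoundaryPlanar G)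
    (hiso : ∀ v, G.degree v ≠ 0) {v : V} (hv : G.degree v = 2) : ConfigB G ∨ ConfigC G := by
  classical
  obtain ⟨u, w, huw, h⟩ := Finset.card_eq_two.1 hv
  have hadj : ∀ x, G.Adj v x ↔ x = u ∨ x = w := by
    intro x
    rw [← mem_neighborFinset, h, Finset.mem_insert, Finset.mem_singleton]
  have hu : G.Adj u v := ((hadj u).2 (Or.inl rfl)).symm
  have hw : G.Adj v w := (hadj w).2 (Or.inr rfl)
  by_cases hn : G.Adj u w
  · exact Or.inl ⟨u, v, w, ⟨hu, hw, hn.symm⟩, hv⟩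
  · exact Or.inr ⟨u, v, w, huw, hu, hw, hv, hn, hG.deleteVertexAddEdge
      (fun x => (G.degree_pos_iff_exists_adj x).1 (Nat.pos_of_ne_zero (hiso x)))
      huw hu hw hn (fun x => (hadj x).1) hv⟩

end MinDegree

end PlaneGraph

/-! ### The lemma -/

theorem lemma2p2 {V : Type*} [Fintype V] [Nonempty V] (G : SimpleGraph V) [DecidableRel G.Adj]
    (hG : PlaneGraph.TwoBoundaryPlanar G)
    (hiso : ∀ v, G.degree v ≠ 0)
    (hM : ¬ ∃ n : ℕ, 3 ≤ n ∧ Nonempty (G ≃g PlaneGraph.graphM n))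
    (hP : ¬ ∃ n : ℕ, 3 ≤ n ∧ Nonempty (G ≃g PlaneGraph.graphP n)) :
    PlaneGraph.ConfigA G ∨ PlaneGraph.ConfigB G ∨ PlaneGraph.ConfigC G ∨ PlaneGraph.ConfigD G ∨
      PlaneGraph.ConfigE G ∨ PlaneGraph.ConfigF G ∨ PlaneGraph.ConfigG G ∨
      PlaneGraph.ConfigH G := by
  by_cases h1 : ∃ v, G.degree v = 1
  · exact Or.inl h1
  by_cases h2 : ∃ v, G.degree v = 2
  · obtain ⟨v, hv⟩ := h2
    exact Or.inr ((hG.configB_or_configC hiso hv).imp_right Or.inl)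
  have hdeg : ∀ v, 3 ≤ G.degree v := by
    intro v
    have h0 := hiso v
    have h1' : G.degree v ≠ 1 := fun h => h1 ⟨v, h⟩
    have h2' : G.degree v ≠ 2 := fun h => h2 ⟨v, h⟩
    omega
  obtain ⟨E⟩ := hG.nonempty_bordered hdeg
  exact Or.inr (Or.inr (Or.inr (E.hasConfig_or_iso.resolve_right hP)))
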